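/- \textbf{Conventions.} For a skew-symmetric matrix $A$ over a field (with zero diagonal) with rows and columns indexed by $U$, $\mathbf D(A)$ is the set system on $U$ whose feasible sets are the $X\subseteq U$ with $A[X]$ nonsingular. Contraction of $T$ keeps the sets $F\setminus T$ with $F$ feasible and $T\subseteq F$; projection $|Z$ keeps the sets $F\setminus Z$ with $F$ feasible. A \emph{sparse representation} of a (projected) linear delta-matroid $D=(V,\mathcal F)$, $V=\{v_1,\dots,v_n\}$, is a skew-symmetric matrix $A$ indexed by $T\cup V\cup Z$ with $A[V\cup Z]=0$ and $D=(\mathbf D(A)/T)|Z$; here $Z=\emptyset$ if $D$ is linear, and $|Z|\le 1$ for an elementary projection. In a sparse representation of rank $r$ of a linear delta-matroid $|T|=r$, where the rank is the maximum size of a feasible set. For a monomial $m$ in $x_1,\dots,x_n$ put $V_m=\{v_i : x_i \text{ divides } m\}$, and let $P(m)$ be its coefficient in $P$. Programs are those of a random access machine with unit-cost field operations and zero tests, in which operations on natural numbers are charged the bit lengths involved; they contain no field constants other than $0,1$. Input matrices and circuits are given by their entries and gates; the rest of the memory initially has arbitrary contents. \textbf{Theorem.} Let $(\mathbb F_\iota)_\iota$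 be any family of fields (e.g.\ a single field, or all fields) and let $\omega$ be a real number such that one program multiplies $n\times n$ matrices over all $\mathbb F_\iota$ in time $O(n^\omega(\log (n+1))^{O(1)})$ for $n\ge 1$. Then there are one program and a constant $K$ such that the following holds for every field $\mathbb F$ of the family. Let $D=(V,\mathcal F)$, $V=\{v_1,\dots,v_n\}$, be a delta-matroid with $D=(\mathbf D(A)/T)|Z$, where $A$ is a skew-symmetric matrix over $\mathbb F$ indexed by $T\cup V\cup Z$ with $A[V\cup Z]=0$ (with $Z=\emptyset$ in the linear case), and let $P\in\mathbb F[x_1,\dots,x_n]$ be homogeneous of degree $k$, given as an arithmetic circuit with $s$ gates (in topological order, sums and products of fan-in $2$). Given $A$, the circuit and a point $\rho=(x,y)\in\mathbb F^{n}\times\mathbb F^{Z}$, the program halts after at most $K\,(n+|T|+|Z|+s)^K\,2^{\omega |T|}$ steps; in particular, if $|T|$ is the rank of $\mathbf D(A)/T$ and $|Z|\le 1$, after at most $K\,(n+|T|+|Z|+s)^K\,2^{\omega r}$ steps, where $r$ is the rank of $D$ (that is, in time $O^*(2^{\omega r})$). It returns \[ Q(\rho)=\sum_{m\text{ multilinear}}\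 \sum_{Y\subseteq Z} P(m)\,\det A[T\cup V_m\cup Y]\,\prod_{v_i\in V_m}x_i\prod_{j\in Y}y_j \] (for $Z=\emptyset$: $Q(x)=\sum_{m} P(m)\det A[T\cup V_m]\,x^m$ over the multilinear $m$), and an answer (accept or reject), with the following properties. \begin{itemize} \item If $P$ has no multilinear term $m$ with nonzero coefficient such that $V_m$ is feasible in $D$, then it rejects for every $\rho$. \item If $P$ has such a term, then for every finite nonempty $S\subseteq\mathbb F$ and $\rho$ uniformly random in $S^{n+|Z|}$ it accepts with probability at least $1-(k+|Z|)/|S|$. (So the test succeeds with probability at least $2/3$ as soon as $|S|\ge 3(k+|Z|)$.) \end{itemize} -/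

import Mathlib

open Finset
open scoped symmDiff

/-! ### Delta-matroids and sparse representations -/

/-- A delta-matroid on the ground set `V`: a family of feasible sets satisfying the symmetric
exchange axiom. -/
structure DeltaMatroid (V : Type*) [DecidableEq V] where
  feasible : Set (Finset V)
  exchange : ∀ A ∈ feasible, ∀ B ∈ feasible, ∀ x ∈ A ∆ B,
    ∃ y ∈ A ∆ B, A ∆ {x, y} ∈ feasible

namespace DeltaMatroid

/-- The size of a largest member of a family of finite sets (the rank of a delta-matroid is the
size of its largest feasible sets). -/
noncomputable def rank {V : Type*} (𝓕 : Set (Finset V)) : ℕ :=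
  sSup {c | ∃ X ∈ 𝓕, X.card = c}

/-- Skew-symmetric matrices; the diagonal is required to be zero (this matters only in
characteristic two). -/
def IsSkew {V R : Type*} [Ring R] (A : Matrix V V R) : Prop :=
  A.transpose = -A ∧ ∀ v, A v v = 0

/-- The principal submatrix `A[X]`. -/
def principal {V R : Type*} (A : Matrix V V R) (X : Finset V) : Matrix X X R :=
  A.submatrix Subtype.val Subtype.val

/-- The feasible sets of `𝐃(A)`: all `X` with `A[X]` nonsingular. -/
def ofMatrix {V R : Type*} [DecidableEq V] [Field R] (A : Matrix V V R) : Set (Finset V) :=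
  {X | (principal A X).det ≠ 0}

/-- The feasible sets of the contraction `D / T`, for `D` on the ground set `T ∪ W`:
all `F ∖ T` with `F` feasible and `T ⊆ F`. -/
def contract {T W : Type*} [Fintype T] (𝓕 : Set (Finset (T ⊕ W))) : Set (Finset W) :=
  {X | (Finset.univ : Finset T).disjSum X ∈ 𝓕}

/-- The feasible sets of the projection `D | Z`, for `D` on the ground set `V ∪ Z`:
all `F ∖ Z` with `F` feasible. -/
def project {V Z : Type*} (𝓕 : Set (Finset (V ⊕ Z))) : Set (Finset V) :=
  {X | ∃ Y : Finset Z, X.disjSum Y ∈ 𝓕}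

/-- The shape of a sparse representation: `A` is skew-symmetric and vanishes outside of the rows
and the columns in `T`. -/
def IsSparse {T W R : Type*} [Ring R] (A : Matrix (T ⊕ W) (T ⊕ W) R) : Prop :=
  IsSkew A ∧ ∀ v w : W, A (Sum.inr v) (Sum.inr w) = 0

end DeltaMatroid

/-! ### Arithmetic circuits -/

/-- The gate at position `i` of a circuit in `n` variables: an input gate (a variable or a
constant), or a fan-in two gate whose arguments are gates at earlier positions. -/
inductive Gate (F : Type*) (n i : ℕ) where
  | var (v : Fin n)
  | const (c : F)
  | add (a b : Fin i)
  | mul (a b : Fin i)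

/-- An arithmetic circuit in `n` variables over `F`, with its gates in topological order.
It has `last + 1` gates, and the gate at position `last` is the output gate. -/
structure Circuit (F : Type*) (n : ℕ) where
  last : ℕ
  gate : (i : Fin (last + 1)) → Gate F n i

namespace Circuit

/-- The polynomial computed at a gate. -/
noncomputable def value {F : Type*} [Field F] {n : ℕ} (C : Circuit F n)
    (i : Fin (C.last + 1)) : MvPolynomial (Fin n) F :=
  match C.gate i with
  | .var v => MvPolynomial.X v
  | .const c => MvPolynomial.C c
  | .add a b => C.value ⟨a, a.isLt.trans i.isLt⟩ + C.value ⟨b, b.isLt.trans i.isLt⟩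
  | .mul a b => C.value ⟨a, a.isLt.trans i.isLt⟩ * C.value ⟨b, b.isLt.trans i.isLt⟩
termination_by i.val
decreasing_by
  all_goals first
    | exact a.isLt
    | exact b.isLt

/-- The polynomial computed by the circuit. -/
noncomputable def poly {F : Type*} [Field F] {n : ℕ} (C : Circuit F n) : MvPolynomial (Fin n) F :=
  C.value (Fin.last C.last)

end Circuit

/-! ### The machine model

A random access machine with registers and arrays for natural numbers, and registers and arrays
for elements of a field. Field operations have unit cost. Operations on natural numbers are charged
the bit length of the numbers involved, memory accesses also the bit length of the address. Programs
contain no field constants but `0` and `1`, so that one program runs over every field. -/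

/-- Programs. Registers and arrays are named by natural numbers. -/
inductive Prog where
  /-- `x := c` -/
  | natConst (x c : ℕ)
  /-- `x := y + z` -/
  | natAdd (x y z : ℕ)
  /-- `x := y - z`, truncated at zero -/
  | natSub (x y z : ℕ)
  /-- `x := a[y]` -/
  | natLoad (x a y : ℕ)
  /-- `a[y] := x` -/
  | natStore (a y x : ℕ)
  /-- `x := 0` in the field -/
  | fldZero (x : ℕ)
  /-- `x := 1` in the field -/
  | fldOne (x : ℕ)
  /-- `x := y + z` in the field -/
  | fldAdd (x y z : ℕ)
  /-- `x := y - z` in the field -/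
  | fldSub (x y z : ℕ)
  /-- `x := y * z` in the field -/
  | fldMul (x y z : ℕ)
  /-- `x := y⁻¹` in the field -/
  | fldInv (x y : ℕ)
  /-- `x := a[y]`, for a field register, a field array, and a natural number register -/
  | fldLoad (x a y : ℕ)
  /-- `a[y] := x`, for a field array, a natural number register, and a field register -/
  | fldStore (a y x : ℕ)
  /-- first `p`, then `q` -/
  | seq (p q : Prog)
  /-- `p` if the natural number register `x` is nonzero, and `q` otherwise -/
  | natIf (x : ℕ) (p q : Prog)
  /-- `p` if the field register `x` is nonzero, and `q` otherwise -/
  | fldIf (x : ℕ) (p q : Prog)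
  /-- repeat `p` as long as the natural number register `x` is nonzero -/
  | while (x : ℕ) (p : Prog)

/-- The memory of the machine. -/
structure Memory (F : Type*) where
  nat : ℕ → ℕ
  natArr : ℕ → ℕ → ℕ
  fld : ℕ → F
  fldArr : ℕ → ℕ → F

namespace Memory

variable {F : Type*}

def setNat (σ : Memory F) (x v : ℕ) : Memory F :=
  { σ with nat := Function.update σ.nat x v }

def setNatArr (σ : Memory F) (a j v : ℕ) : Memory F :=
  { σ with natArr := Function.update σ.natArr a (Function.update (σ.natArr a) j v) }

def setFld (σ : Memory F) (x : ℕ) (v : F) : Memory F :=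
  { σ with fld := Function.update σ.fld x v }

def setFldArr (σ : Memory F) (a j : ℕ) (v : F) : Memory F :=
  { σ with fldArr := Function.update σ.fldArr a (Function.update (σ.fldArr a) j v) }

end Memory

/-- `Exec p σ σ' c`: started in memory `σ`, the program `p` halts in memory `σ'` at cost `c`.
Here `Nat.size m` is the bit length of `m`. -/
inductive Exec {F : Type*} [Field F] : Prog → Memory F → Memory F → ℕ → Prop
  | natConst (σ : Memory F) (x c : ℕ) :
      Exec (.natConst x c) σ (σ.setNat x c) (1 + c.size)
  | natAdd (σ : Memory F) (x y z : ℕ) :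
      Exec (.natAdd x y z) σ (σ.setNat x (σ.nat y + σ.nat z))
        (1 + (σ.nat y).size + (σ.nat z).size)
  | natSub (σ : Memory F) (x y z : ℕ) :
      Exec (.natSub x y z) σ (σ.setNat x (σ.nat y - σ.nat z))
        (1 + (σ.nat y).size + (σ.nat z).size)
  | natLoad (σ : Memory F) (x a y : ℕ) :
      Exec (.natLoad x a y) σ (σ.setNat x (σ.natArr a (σ.nat y)))
        (1 + (σ.nat y).size + (σ.natArr a (σ.nat y)).size)
  | natStore (σ : Memory F) (a y x : ℕ) :
      Exec (.natStore a y x) σ (σ.setNatArr a (σ.nat y) (σ.nat x))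
        (1 + (σ.nat y).size + (σ.nat x).size)
  | fldZero (σ : Memory F) (x : ℕ) : Exec (.fldZero x) σ (σ.setFld x 0) 1
  | fldOne (σ : Memory F) (x : ℕ) : Exec (.fldOne x) σ (σ.setFld x 1) 1
  | fldAdd (σ : Memory F) (x y z : ℕ) :
      Exec (.fldAdd x y z) σ (σ.setFld x (σ.fld y + σ.fld z)) 1
  | fldSub (σ : Memory F) (x y z : ℕ) :
      Exec (.fldSub x y z) σ (σ.setFld x (σ.fld y - σ.fld z)) 1
  | fldMul (σ : Memory F) (x y z : ℕ) :
      Exec (.fldMul x y z) σ (σ.setFld x (σ.fld y * σ.fld z)) 1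
  | fldInv (σ : Memory F) (x y : ℕ) :
      Exec (.fldInv x y) σ (σ.setFld x (σ.fld y)⁻¹) 1
  | fldLoad (σ : Memory F) (x a y : ℕ) :
      Exec (.fldLoad x a y) σ (σ.setFld x (σ.fldArr a (σ.nat y))) (1 + (σ.nat y).size)
  | fldStore (σ : Memory F) (a y x : ℕ) :
      Exec (.fldStore a y x) σ (σ.setFldArr a (σ.nat y) (σ.fld x)) (1 + (σ.nat y).size)
  | seq {p q : Prog} {σ σ' σ'' : Memory F} {c d : ℕ} :
      Exec p σ σ' c → Exec q σ' σ'' d → Exec (.seq p q) σ σ'' (c + d)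
  | natIf_true {x : ℕ} {p q : Prog} {σ σ' : Memory F} {c : ℕ} :
      σ.nat x ≠ 0 → Exec p σ σ' c → Exec (.natIf x p q) σ σ' (1 + (σ.nat x).size + c)
  | natIf_false {x : ℕ} {p q : Prog} {σ σ' : Memory F} {c : ℕ} :
      σ.nat x = 0 → Exec q σ σ' c → Exec (.natIf x p q) σ σ' (1 + (σ.nat x).size + c)
  | fldIf_true {x : ℕ} {p q : Prog} {σ σ' : Memory F} {c : ℕ} :
      σ.fld x ≠ 0 → Exec p σ σ' c → Exec (.fldIf x p q) σ σ' (1 + c)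
  | fldIf_false {x : ℕ} {p q : Prog} {σ σ' : Memory F} {c : ℕ} :
      σ.fld x = 0 → Exec q σ σ' c → Exec (.fldIf x p q) σ σ' (1 + c)
  | while_true {x : ℕ} {p : Prog} {σ σ' σ'' : Memory F} {c d : ℕ} :
      σ.nat x ≠ 0 → Exec p σ σ' c → Exec (.while x p) σ' σ'' d →
      Exec (.while x p) σ σ'' (1 + (σ.nat x).size + c + d)
  | while_false {x : ℕ} {p : Prog} {σ : Memory F} :
      σ.nat x = 0 → Exec (.while x p) σ σ 1

/-- `w` is an exponent of matrix multiplication for a family of fields: one program multiplies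
`n × n` matrices over all these fields at cost `n ^ w` up to a polylogarithmic factor. (The infimum
of these numbers is the exponent of matrix multiplication.) The number `n` is given in register `0`,
the factors are given row by row in the field arrays `0` and `1`, and the product has to be returned
in the field array `2`; the rest of the memory may initially contain anything. -/
def IsMatMulExponent {ι : Type*} (F : ι → Type*) [∀ i, Field (F i)] (w : ℝ) : Prop :=
  ∃ (p : Prog) (K : ℕ), ∀ (i : ι) (n : ℕ), 1 ≤ n → ∀ (A B : Matrix (Fin n) (Fin n) (F i))
    (σ : Memory (F i)), σ.nat 0 = n →
    (∀ a b : Fin n, σ.fldArr 0 (a * n + b) = A a b) →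
    (∀ a b : Fin n, σ.fldArr 1 (a * n + b) = B a b) →
    ∃ (σ' : Memory (F i)) (c : ℕ), Exec p σ σ' c ∧
      (∀ a b : Fin n, σ'.fldArr 2 (a * n + b) = (A * B) a b) ∧
      (c : ℝ) ≤ K * (n : ℝ) ^ w * (n.size : ℝ) ^ K

/-! ### Sieving instances -/

/-- The position of an element of `T ∪ V ∪ Z` in the enumeration that lists `T` first, then `V`,
then `Z`. -/
def position {t n z : ℕ} : Fin t ⊕ (Fin n ⊕ Fin z) → ℕ
  | .inl a => a
  | .inr (.inl b) => t + b
  | .inr (.inr c) => t + n + c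

/-- The memory `σ` contains the input: the numbers `n`, `t`, `z` and the number of gates in the
registers `0` to `3`, the matrix `A` row by row in the field array `0`, the circuit in the arrays of
natural numbers `0` (type of gate), `1`, `2` (arguments) and in the field array `1` (constants), and
the point `ρ` (the random elements) in the field array `2`. The rest of the memory may contain
anything. -/
def HoldsInput {F : Type*} {t n z : ℕ}
    (A : Matrix (Fin t ⊕ (Fin n ⊕ Fin z)) (Fin t ⊕ (Fin n ⊕ Fin z)) F)
    (C : Circuit F n) (ρ : Fin n ⊕ Fin z → F) (σ : Memory F) : Prop :=
  σ.nat 0 = n ∧ σ.nat 1 = t ∧ σ.nat 2 = z ∧ σ.nat 3 = C.last + 1 ∧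
  (∀ u v, σ.fldArr 0 (position u * (t + n + z) + position v) = A u v) ∧
  (∀ i : Fin (C.last + 1),
    match C.gate i with
    | .var v => σ.natArr 0 i = 0 ∧ σ.natArr 1 i = v
    | .const c => σ.natArr 0 i = 1 ∧ σ.fldArr 1 i = c
    | .add a b => σ.natArr 0 i = 2 ∧ σ.natArr 1 i = a ∧ σ.natArr 2 i = b
    | .mul a b => σ.natArr 0 i = 3 ∧ σ.natArr 1 i = a ∧ σ.natArr 2 i = b) ∧
  (∀ j : Fin n, σ.fldArr 2 j = ρ (.inl j)) ∧
  (∀ j : Fin z, σ.fldArr 2 (n + j) = ρ (.inr j))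

/-- A program accepts if it halts with `1` in register `0`. -/
def Accepts {F : Type*} [Field F] (p : Prog) (σ : Memory F) : Prop :=
  ∃ (σ' : Memory F) (c : ℕ), Exec p σ σ' c ∧ σ'.nat 0 = 1

/-- `P` has a multilinear term whose support is in the family `𝓕`. -/
def HasTerm {F : Type*} [Field F] {n : ℕ} (P : MvPolynomial (Fin n) F)
    (𝓕 : Set (Finset (Fin n))) : Prop :=
  ∃ m ∈ P.support, (∀ i, m i ≤ 1) ∧ m.support ∈ 𝓕

/-- The value at `ρ` of the sieved polynomial: the sum over the multilinear monomials `m` of `P`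
(and over `Y ⊆ Z`, in the projected case) of `P(m) * det A[T ∪ V_m ∪ Y]` times the product of the
variables in `m` and in `Y`. -/
noncomputable def sieved {F : Type*} [Field F] {t n z : ℕ}
    (A : Matrix (Fin t ⊕ (Fin n ⊕ Fin z)) (Fin t ⊕ (Fin n ⊕ Fin z)) F)
    (P : MvPolynomial (Fin n) F) (ρ : Fin n ⊕ Fin z → F) : F :=
  ∑ m ∈ P.support with ∀ i, m i ≤ 1, ∑ Y : Finset (Fin z),
    P.coeff m *
      (DeltaMatroid.principal A
        ((Finset.univ : Finset (Fin t)).disjSum (m.support.disjSum Y))).det *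
      ((∏ i ∈ m.support, ρ (.inl i)) * ∏ j ∈ Y, ρ (.inr j))

/-!
The sieve evaluates the circuit at operators on a Fock space, one for each element. The supertrace
kills words in these operators with repetitions, and turns the other words into determinants.

*Operators.* Let `t = |T|`. An element `e` of `T ∪ V ∪ Z` gets a pair of vectors `(aₑ, bₑ)` of
length `t` (`Fock.elementPair`), and the pair gets the even operator `Eₑ`, "create `aₑ`, then
annihilate `bₑ`", on the exterior algebra of a `t`-dimensional space, a matrix of size `2 ^ t`
(`Fock.cliff`, `Fock.pairOp`). By the anticommutation relations, the supertrace of a product of such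
operators vanishes if the vectors `aₑ`, or the vectors `bₑ`, have a common nonzero orthogonal
vector. For a product of exactly `t` operators it is therefore alternating in the `aₑ` and in the
`bₑ`, and equal to `det a * det b` (`Fock.str_word`, Berezin integration).

*Bordered determinants.* Let `h` be a formal variable that counts operators. The coefficient of
`h ^ t` in the supertrace of `h ^ d E₁ ⋯ E_d ∏ (1 + h E_r)` is the determinant of the matrix
`∑ a_r b_rᵀ`
bordered by the columns `a₁, …, a_d` and the rows `-b₁, …, -b_d` (`Fock.str_coeff_word`): both sides
obey the same recursion when a factor `1 + h E_r` is removed. With the factors of the elements of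
`T`, whose pairs satisfy `∑ a_r b_rᵀ = A[T]`, this bordered determinant is `det A[T ∪ X]` times the
random elements of `X`, if `X` consists of the elements `1, …, d`; here it matters that `A` is
sparse and skew-symmetric. It is zero if an element occurs twice, and so only multilinear monomials
survive. The factors of the elements of `Z` sum over the subsets of `Z`
(`Fock.bordered_add_elements`).

*Noncommutativity.* The result depends only on the set of elements in a word, not on their order.
Hence, if the circuit is evaluated at the operators `h E_v` in place of the variables, the sieve
returns the sieved value of the commutative polynomial (`Fock.liftings`, `Fock.str_coeff_lifting`).

*Time.* Powers of `h` beyond `t` are not needed, so that a gate costs polynomially many products of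
matrices of size `2 ^ t`, which the given program computes in time `2 ^ (ω t)` up to a polynomial in
`t`. All else takes, up to polynomial factors, time linear in the number `4 ^ t` of entries of a
matrix, and this is no more than the time for a multiplication, which has to write its result
(`Prog.Multiplies.sq_le`). Programs are verified by weakest preconditions (`Prog.wp`) and a rule for
loops (`Prog.Runs.forLoop`). The given program, which may use any memory, is run with all its names
shifted beyond those in use (`Prog.exec_shift`). The program is `Prog.sieve`, and `Prog.runs_sieve`
is its specification.

*Probability.* The program accepts if the sieved value is not zero. The sieved value is that of a
polynomial of degree at most `k + z` in the random elements, in which distinct terms have distinct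
monomials (`Fock.sievedPoly_ne_zero`), so that the Schwartz-Zippel lemma applies. A projection by at
most one element decreases the rank by at most one, so that the bound in terms of the rank of `D`
costs only a constant factor.
-/

/-! ### The Clifford algebra and the supertrace -/

namespace Fock

/-- The index set of the standard basis of the Fock space on `t` modes. It has `2 ^ t` elements;
the last mode splits it into two halves (unoccupied, occupied). -/
def Ix : ℕ → Type
  | 0 => Unit
  | t + 1 => Ix t ⊕ Ix t

instance fintypeIx : (t : ℕ) → Fintype (Ix t)
  | 0 => inferInstanceAs (Fintype Unit)
  | t + 1 => @instFintypeSum _ _ (fintypeIx t) (fintypeIx t)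

instance decidableEqIx : (t : ℕ) → DecidableEq (Ix t)
  | 0 => inferInstanceAs (DecidableEq Unit)
  | t + 1 => @instDecidableEqSum _ _ (decidableEqIx t) (decidableEqIx t)

variable {F : Type*} [Field F]

/-- The operator on the Fock space on `t + 1` modes with the given blocks, with respect to the
splitting by the last mode. -/
def blocks {t : ℕ} (A B C D : Matrix (Ix t) (Ix t) F) : Matrix (Ix (t + 1)) (Ix (t + 1)) F :=
  Matrix.fromBlocks A B C D

lemma blocks_one (t : ℕ) : (1 : Matrix (Ix (t + 1)) (Ix (t + 1)) F) = blocks 1 0 0 1 :=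
  (Matrix.fromBlocks_one (l := Ix t) (m := Ix t)).symm

lemma blocks_mul {t : ℕ} (A B C D A' B' C' D' : Matrix (Ix t) (Ix t) F) :
    blocks A B C D * blocks A' B' C' D' =
      blocks (A * A' + B * C') (A * B' + B * D') (C * A' + D * C') (C * B' + D * D') :=
  Matrix.fromBlocks_multiply A B C D A' B' C' D'

lemma blocks_add {t : ℕ} (A B C D A' B' C' D' : Matrix (Ix t) (Ix t) F) :
    blocks A B C D + blocks A' B' C' D' = blocks (A + A') (B + B') (C + C') (D + D') :=
  Matrix.fromBlocks_add A B C D A' B' C' D'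

lemma blocks_smul {t : ℕ} (c : F) (A B C D : Matrix (Ix t) (Ix t) F) :
    c • blocks A B C D = blocks (c • A) (c • B) (c • C) (c • D) :=
  Matrix.fromBlocks_smul c A B C D

lemma trace_blocks {t : ℕ} (A B C D : Matrix (Ix t) (Ix t) F) :
    Matrix.trace (blocks A B C D) = Matrix.trace A + Matrix.trace D := by
  refine (Fintype.sum_sum_type (α₁ := Ix t) (α₂ := Ix t) _).trans ?_
  rfl

/-- The Clifford map: the matrix by which `γ Γ + ∑ aᵢ (creation of i) + ∑ bᵢ (annihilation of i)`
acts on the Fock space on `t` modes, where `Γ` is the parity operator. -/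
def cliff : (t : ℕ) → F → (Fin t → F) → (Fin t → F) → Matrix (Ix t) (Ix t) F
  | 0, γ, _, _ => γ • (1 : Matrix (Ix 0) (Ix 0) F)
  | t + 1, γ, a, b =>
    blocks (cliff t γ (fun i => a i.castSucc) (fun i => b i.castSucc))
      (b (Fin.last t) • 1) (a (Fin.last t) • 1)
      (-cliff t γ (fun i => a i.castSucc) (fun i => b i.castSucc))

/-- The anticommutation relations: the image of the Clifford map consists of square roots of the
quadratic form `γ² + ∑ aᵢ bᵢ`, in polarized form. -/
theorem cliff_mul_add_mul (t : ℕ) (γ γ' : F) (a b a' b' : Fin t → F) :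
    cliff t γ a b * cliff t γ' a' b' + cliff t γ' a' b' * cliff t γ a b =
      (2 * γ * γ' + ∑ i, (a i * b' i + b i * a' i)) • (1 : Matrix (Ix t) (Ix t) F) := by
  induction t with
  | zero =>
    simp only [cliff, Matrix.smul_mul, one_mul, smul_smul, ← add_smul, Finset.univ_eq_empty,
      Finset.sum_empty]
    congr 1
    ring
  | succ t ih =>
    have h := ih (fun i => a i.castSucc) (fun i => b i.castSucc) (fun i => a' i.castSucc)
      (fun i => b' i.castSucc)
    rw [Fin.sum_univ_castSucc, blocks_one]
    simp only [cliff]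
    rw [blocks_mul, blocks_mul, blocks_add, blocks_smul]
    set X := cliff t γ (fun i => a i.castSucc) (fun i => b i.castSucc)
    set Y := cliff t γ' (fun i => a' i.castSucc) (fun i => b' i.castSucc)
    rw [← add_assoc (2 * γ * γ'), add_smul, ← h]
    congr 1
    · simp only [Matrix.smul_mul, Matrix.mul_smul, one_mul, smul_smul, add_smul]
      rw [mul_comm (a' _)]
      abel
    · simp
    · simp
    · simp only [Matrix.smul_mul, Matrix.mul_smul, one_mul, smul_smul, add_smul, neg_mul_neg]
      rw [mul_comm (b' _)]
      abel

/-- The parity operator. -/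
abbrev parity (t : ℕ) : Matrix (Ix t) (Ix t) F := cliff t 1 0 0

/-- The creation operator of a vector. -/
abbrev create {t : ℕ} (a : Fin t → F) : Matrix (Ix t) (Ix t) F := cliff t 0 a 0

/-- The annihilation operator of a covector. -/
abbrev annih {t : ℕ} (b : Fin t → F) : Matrix (Ix t) (Ix t) F := cliff t 0 0 b

theorem cliff_add (t : ℕ) (γ γ' : F) (a b a' b' : Fin t → F) :
    cliff t (γ + γ') (a + a') (b + b') = cliff t γ a b + cliff t γ' a' b' := by
  induction t with
  | zero => exact add_smul _ _ _
  | succ t ih =>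
    simp only [cliff, blocks_add]
    have h := ih (fun i => a i.castSucc) (fun i => b i.castSucc) (fun i => a' i.castSucc)
      (fun i => b' i.castSucc)
    have h1 : cliff t (γ + γ') (fun i : Fin t => (a + a') i.castSucc)
        (fun i : Fin t => (b + b') i.castSucc) = _ := h
    rw [h1]
    simp only [Pi.add_apply, add_smul, neg_add]

theorem cliff_smul (t : ℕ) (c γ : F) (a b : Fin t → F) :
    cliff t (c * γ) (c • a) (c • b) = c • cliff t γ a b := by
  induction t with
  | zero => exact mul_smul _ _ _
  | succ t ih =>
    simp only [cliff, blocks_smul]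
    have h := ih (fun i => a i.castSucc) (fun i => b i.castSucc)
    have h1 : cliff t (c * γ) (fun i : Fin t => (c • a) i.castSucc)
        (fun i : Fin t => (c • b) i.castSucc) = _ := h
    rw [h1]
    simp only [Pi.smul_apply, smul_smul, smul_eq_mul, smul_neg]

lemma create_add {t : ℕ} (a a' : Fin t → F) : create (a + a') = create a + create a' := by
  simpa using cliff_add t 0 0 a 0 a' 0

lemma create_smul {t : ℕ} (c : F) (a : Fin t → F) : create (c • a) = c • create a := by
  simpa using cliff_smul t c 0 a 0

lemma annih_add {t : ℕ} (a a' : Fin t → F) : annih (a + a') = annih a + annih a' := by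
  simpa using cliff_add t 0 0 0 a 0 a'

lemma annih_smul {t : ℕ} (c : F) (a : Fin t → F) : annih (c • a) = c • annih a := by
  simpa using cliff_smul t c 0 0 a

theorem parity_mul_parity (t : ℕ) : parity t * parity t = (1 : Matrix (Ix t) (Ix t) F) := by
  induction t with
  | zero =>
    simp [cliff]
  | succ t ih =>
    simp only [parity, cliff, Pi.zero_apply, zero_smul]
    rw [blocks_mul, blocks_one]
    have h : cliff t 1 (fun _ : Fin t => (0 : F)) (fun _ => 0) = parity t := rfl
    rw [h]
    simp only [ih, neg_mul_neg, mul_zero, zero_mul, add_zero, zero_add]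

/-- The operator by which a pair of vectors enters the sieve: create `a`, then annihilate `b`. -/
def pairOp {t : ℕ} (p : (Fin t → F) × (Fin t → F)) : Matrix (Ix t) (Ix t) F :=
  annih p.2 * create p.1

/-- The supertrace. -/
def str {t : ℕ} : Matrix (Ix t) (Ix t) F →ₗ[F] F :=
  Matrix.traceLinearMap (Ix t) F F ∘ₗ LinearMap.mulLeft F (parity t)

lemma str_apply {t : ℕ} (X : Matrix (Ix t) (Ix t) F) :
    str X = Matrix.trace (parity t * X) := rfl

/-- The supertrace of an operator that commutes with an odd operator `S` vanishes, as soon as `S`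
has a partner `S'` with `S S' + S' S = 1`. -/
theorem str_eq_zero_of_commute {t : ℕ} {X S S' : Matrix (Ix t) (Ix t) F} (hX : Commute S X)
    (hS : parity t * S = -(S * parity t)) (hSS : S * S' + S' * S = 1) : str X = 0 := by
  have h1 : Matrix.trace (parity t * (X * (S' * S))) =
      -Matrix.trace (parity t * (X * (S * S'))) := by
    calc Matrix.trace (parity t * (X * (S' * S)))
        = Matrix.trace ((parity t * (X * S')) * S) := by simp only [mul_assoc]
      _ = Matrix.trace (S * (parity t * (X * S'))) := Matrix.trace_mul_comm _ _
      _ = Matrix.trace ((S * parity t) * (X * S')) := by simp only [mul_assoc]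
      _ = -Matrix.trace ((parity t * S) * (X * S')) := by rw [hS]; simp
      _ = -Matrix.trace (parity t * ((S * X) * S')) := by simp only [mul_assoc]
      _ = -Matrix.trace (parity t * (X * (S * S'))) := by rw [hX.eq]; simp only [mul_assoc]
  rw [str_apply, ← mul_one X, ← hSS, mul_add, mul_add, Matrix.trace_add, h1]
  simp

lemma parity_mul_create {t : ℕ} (a : Fin t → F) :
    parity t * create a = -(create a * parity t) := by
  have := cliff_mul_add_mul t 1 0 0 0 a (0 : Fin t → F)
  exact eq_neg_of_add_eq_zero_left (by simpa using this)

lemma parity_mul_annih {t : ℕ} (a : Fin t → F) :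
    parity t * annih a = -(annih a * parity t) := by
  have := cliff_mul_add_mul t 1 0 0 0 (0 : Fin t → F) a
  exact eq_neg_of_add_eq_zero_left (by simpa using this)

lemma create_mul_create {t : ℕ} (a a' : Fin t → F) :
    create a * create a' = -(create a' * create a) := by
  have := cliff_mul_add_mul t 0 0 a 0 a' (0 : Fin t → F)
  exact eq_neg_of_add_eq_zero_left (by simpa using this)

lemma annih_mul_annih {t : ℕ} (a a' : Fin t → F) :
    annih a * annih a' = -(annih a' * annih a) := by
  have := cliff_mul_add_mul t 0 0 0 a (0 : Fin t → F) a'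
  exact eq_neg_of_add_eq_zero_left (by simpa using this)

lemma annih_mul_create {t : ℕ} (b a : Fin t → F) :
    annih b * create a + create a * annih b = (b ⬝ᵥ a) • 1 := by
  have := cliff_mul_add_mul t 0 0 0 b a (0 : Fin t → F)
  simpa [dotProduct] using this

lemma commute_annih_pairOp {t : ℕ} {u : Fin t → F} {p : (Fin t → F) × (Fin t → F)}
    (h : u ⬝ᵥ p.1 = 0) : Commute (annih u) (pairOp p) := by
  have h1 : annih u * create p.1 = -(create p.1 * annih u) :=
    eq_neg_of_add_eq_zero_left (by rw [annih_mul_create, h, zero_smul])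
  unfold pairOp Commute SemiconjBy
  rw [← mul_assoc, annih_mul_annih, neg_mul, mul_assoc, h1, mul_neg, neg_neg, mul_assoc]

lemma commute_create_pairOp {t : ℕ} {u : Fin t → F} {p : (Fin t → F) × (Fin t → F)}
    (h : u ⬝ᵥ p.2 = 0) : Commute (create u) (pairOp p) := by
  have h1 : create u * annih p.2 = -(annih p.2 * create u) :=
    eq_neg_of_add_eq_zero_right (by rw [annih_mul_create, dotProduct_comm, h, zero_smul])
  unfold pairOp Commute SemiconjBy
  rw [← mul_assoc, h1, neg_mul, mul_assoc, create_mul_create, mul_neg, neg_neg, mul_assoc]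

lemma exists_dotProduct_eq_one {t : ℕ} {u : Fin t → F} (hu : u ≠ 0) : ∃ w, u ⬝ᵥ w = 1 := by
  obtain ⟨i, hi⟩ := Function.ne_iff.mp hu
  exact ⟨Pi.single i (u i)⁻¹, by simpa using mul_inv_cancel₀ hi⟩

/-- If `u` is orthogonal to all created vectors, annihilating `u` commutes with all pair
operators. -/
theorem str_prod_eq_zero_left {t : ℕ} (l : List ((Fin t → F) × (Fin t → F))) {u : Fin t → F}
    (hu : u ≠ 0) (h : ∀ p ∈ l, u ⬝ᵥ p.1 = 0) : str (l.map pairOp).prod = 0 := by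
  obtain ⟨w, hw⟩ := exists_dotProduct_eq_one hu
  refine str_eq_zero_of_commute (S := annih u) (S' := create w) (Commute.list_prod_right _ _ ?_)
    (parity_mul_annih u) (by rw [annih_mul_create, hw, one_smul])
  intro x hx
  obtain ⟨p, hp, rfl⟩ := List.mem_map.mp hx
  exact commute_annih_pairOp (h p hp)

/-- If `u` is orthogonal to all annihilated covectors, creating `u` commutes with all pair
operators. -/
theorem str_prod_eq_zero_right {t : ℕ} (l : List ((Fin t → F) × (Fin t → F))) {u : Fin t → F}
    (hu : u ≠ 0) (h : ∀ p ∈ l, u ⬝ᵥ p.2 = 0) : str (l.map pairOp).prod = 0 := by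
  obtain ⟨w, hw⟩ := exists_dotProduct_eq_one hu
  refine str_eq_zero_of_commute (S := create u) (S' := annih w) (Commute.list_prod_right _ _ ?_)
    (parity_mul_create u) (by rw [add_comm, annih_mul_create, dotProduct_comm, hw, one_smul])
  intro x hx
  obtain ⟨p, hp, rfl⟩ := List.mem_map.mp hx
  exact commute_create_pairOp (h p hp)

/-- Fewer than `t` vectors of length `t` have a common nonzero orthogonal vector. -/
lemma exists_orthogonal {t d : ℕ} (hd : d < t) (a : Fin d → Fin t → F) :
    ∃ u : Fin t → F, u ≠ 0 ∧ ∀ k, u ⬝ᵥ a k = 0 := by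
  let M : Matrix (Fin t) (Fin t) F := fun k => if h : k.val < d then a ⟨k, h⟩ else 0
  have hM : M.det = 0 := Matrix.det_eq_zero_of_row_eq_zero ⟨d, hd⟩ (by simp [M])
  obtain ⟨u, hu, h⟩ := Matrix.exists_mulVec_eq_zero_iff.mpr hM
  refine ⟨u, hu, fun k => ?_⟩
  have := congrFun h ⟨k, k.isLt.trans hd⟩
  rw [dotProduct_comm]
  simpa [M, Matrix.mulVec] using this

lemma exists_orthogonal_of_det {t : ℕ} (a : Fin t → Fin t → F) (h : (Matrix.of a).det = 0) :
    ∃ u : Fin t → F, u ≠ 0 ∧ ∀ k, u ⬝ᵥ a k = 0 := by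
  obtain ⟨u, hu, h⟩ := Matrix.exists_mulVec_eq_zero_iff.mpr h
  refine ⟨u, hu, fun k => ?_⟩
  rw [dotProduct_comm]
  simpa [Matrix.mulVec] using congrFun h k

/-- The word in the pairs `(a k, b k)`. -/
def word {t d : ℕ} (a b : Fin d → Fin t → F) : Matrix (Ix t) (Ix t) F :=
  (List.ofFn fun k => pairOp (a k, b k)).prod

lemma word_eq_map {t d : ℕ} (a b : Fin d → Fin t → F) :
    word a b = ((List.ofFn fun k => (a k, b k)).map pairOp).prod := by
  rw [word, List.map_ofFn]; rfl

/-- The word, as a multilinear function of the created vectors. -/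
noncomputable def wordLeft {t : ℕ} (b : Fin t → Fin t → F) :
    MultilinearMap F (fun _ : Fin t => Fin t → F) (Matrix (Ix t) (Ix t) F) :=
  (MultilinearMap.mkPiAlgebraFin F t (Matrix (Ix t) (Ix t) F)).compLinearMap fun k =>
    { toFun := fun a => pairOp (a, b k)
      map_add' := fun x y => by simp only [pairOp, create_add, mul_add]
      map_smul' := fun c x => by simp only [pairOp, create_smul, Matrix.mul_smul]; rfl }

/-- The word, as a multilinear function of the annihilated covectors. -/
noncomputable def wordRight {t : ℕ} (a : Fin t → Fin t → F) :
    MultilinearMap F (fun _ : Fin t => Fin t → F) (Matrix (Ix t) (Ix t) F) :=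
  (MultilinearMap.mkPiAlgebraFin F t (Matrix (Ix t) (Ix t) F)).compLinearMap fun k =>
    { toFun := fun b => pairOp (a k, b)
      map_add' := fun x y => by simp only [pairOp, annih_add, add_mul]
      map_smul' := fun c x => by simp only [pairOp, annih_smul, Matrix.smul_mul]; rfl }

lemma det_of_eq_zero {t : ℕ} {v : Fin t → Fin t → F} {i j : Fin t} (h : v i = v j)
    (hij : i ≠ j) : (Matrix.of v).det = 0 :=
  Matrix.det_zero_of_row_eq hij h

/-- The supertrace of words of length `t`, as an alternating function of the created vectors. -/
noncomputable def strLeft {t : ℕ} (b : Fin t → Fin t → F) :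
    (Fin t → F) [⋀^Fin t]→ₗ[F] F :=
  { (str (F := F)).compMultilinearMap (wordLeft b) with
    map_eq_zero_of_eq' := fun v i j h hij => by
      obtain ⟨u, hu, h⟩ := exists_orthogonal_of_det v (det_of_eq_zero h hij)
      change str (word v b) = 0
      rw [word_eq_map]
      refine str_prod_eq_zero_left _ hu fun p hp => ?_
      obtain ⟨k, rfl⟩ := List.mem_ofFn.mp hp
      exact h k }

/-- The supertrace of words of length `t`, as an alternating function of the annihilated
covectors. -/
noncomputable def strRight {t : ℕ} (a : Fin t → Fin t → F) :
    (Fin t → F) [⋀^Fin t]→ₗ[F] F :=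
  { (str (F := F)).compMultilinearMap (wordRight a) with
    map_eq_zero_of_eq' := fun v i j h hij => by
      obtain ⟨u, hu, h⟩ := exists_orthogonal_of_det v (det_of_eq_zero h hij)
      change str (word a v) = 0
      rw [word_eq_map]
      refine str_prod_eq_zero_right _ hu fun p hp => ?_
      obtain ⟨k, rfl⟩ := List.mem_ofFn.mp hp
      exact h k }

/-- The operators of the basis pairs of the first modes do not see the last mode. -/
lemma pairOp_single_castSucc {t : ℕ} (i : Fin t) :
    pairOp (t := t + 1) ((Pi.single i.castSucc 1 : Fin (t + 1) → F), Pi.single i.castSucc 1) =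
      (blocks (pairOp ((Pi.single i 1 : Fin t → F), Pi.single i 1)) 0 0
        (pairOp ((Pi.single i 1 : Fin t → F), Pi.single i 1))) := by
  have h1 : (fun j : Fin t => (Pi.single i.castSucc (1 : F) : Fin (t + 1) → F) j.castSucc) =
      Pi.single i 1 := by
    ext j; simp [Pi.single_apply]
  have h2 : (Pi.single i.castSucc (1 : F) : Fin (t + 1) → F) (Fin.last t) = 0 := by
    rw [Pi.single_apply, if_neg (Fin.castSucc_lt_last i).ne']
  simp only [pairOp, annih, create, cliff, h1, h2, zero_smul, Pi.zero_apply]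
  rw [blocks_mul]
  simp only [mul_zero, zero_mul, add_zero, zero_add, neg_mul_neg]
  rfl

/-- The operator of the last basis pair projects to the states whose last mode is unoccupied. -/
lemma pairOp_single_last {t : ℕ} :
    pairOp (t := t + 1) ((Pi.single (Fin.last t) 1 : Fin (t + 1) → F), Pi.single (Fin.last t) 1) =
      (blocks (1 : Matrix (Ix t) (Ix t) F) 0 0 0) := by
  have h1 : (fun j : Fin t => (Pi.single (Fin.last t) (1 : F) : Fin (t + 1) → F) j.castSucc) =
      0 := by
    ext j
    simp only [Pi.single_apply, Pi.zero_apply, if_neg (Fin.castSucc_lt_last j).ne]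
  have h0 : cliff t (0 : F) 0 0 = 0 := by simpa using cliff_smul t (0 : F) 0 0 0
  have h0' : cliff t (0 : F) 0 (fun _ => 0) = 0 := h0
  have h0'' : cliff t (0 : F) (fun _ => 0) 0 = 0 := h0
  simp only [pairOp, annih, create, cliff, h1, Pi.single_eq_same, one_smul, Pi.zero_apply,
    zero_smul, h0', h0'']
  rw [blocks_mul]
  simp

/-- The word of all basis pairs is the projector to the vacuum. -/
theorem str_word_basis (t : ℕ) :
    str (word (fun k => (Pi.single k 1 : Fin t → F)) (fun k => Pi.single k 1)) = 1 := by
  induction t with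
  | zero =>
    simp only [word, List.ofFn_zero, List.prod_nil, str_apply, mul_one, parity, cliff, one_smul,
      Matrix.trace_one]
    exact Nat.cast_one
  | succ t ih =>
    -- A word without the last pair acts on both halves; the last pair keeps the unoccupied half.
    have key : ∀ l : List (Fin t), (l.map fun i => pairOp (t := t + 1)
        ((Pi.single i.castSucc 1 : Fin (t + 1) → F), Pi.single i.castSucc 1)).prod =
        (blocks (l.map fun i => pairOp ((Pi.single i 1 : Fin t → F),
          Pi.single i 1)).prod 0 0 (l.map fun i => pairOp ((Pi.single i 1 : Fin t → F),
          Pi.single i 1)).prod) := by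
      intro l
      induction l with
      | nil => exact blocks_one t
      | cons i l ihl =>
        rw [List.map_cons, List.prod_cons, ihl, pairOp_single_castSucc, blocks_mul]
        simp
    have h : word (fun k => (Pi.single k 1 : Fin (t + 1) → F)) (fun k => Pi.single k 1) =
        (blocks (word (fun k => (Pi.single k 1 : Fin t → F)) (fun k => Pi.single k 1))
          0 0 0) := by
      rw [word, List.ofFn_succ', List.prod_concat, pairOp_single_last]
      have := key (List.finRange t)
      rw [← List.ofFn_eq_map, ← List.ofFn_eq_map] at this
      rw [this, blocks_mul]
      simp [word]
    rw [h, str_apply]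
    simp only [parity, cliff, Pi.zero_apply, zero_smul]
    rw [blocks_mul, trace_blocks]
    simp only [mul_zero, add_zero, Matrix.trace_zero]
    exact ih

/-- Berezin integration: the supertrace of a word of length `t` is the product of the determinants
of the two families of vectors. -/
theorem str_word {t : ℕ} (a b : Fin t → Fin t → F) :
    str (word a b) = (Matrix.of a).det * (Matrix.of b).det := by
  have h1 : ∀ b : Fin t → Fin t → F,
      str (word a b) = str (word (fun k => Pi.single k 1) b) * (Matrix.of a).det := by
    intro b
    have := congrArg (fun f => f a) (AlternatingMap.eq_smul_basis_det (Pi.basisFun F (Fin t))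
      (strLeft b))
    simp only [AlternatingMap.smul_apply, Pi.basisFun_det_apply, smul_eq_mul] at this
    refine this.trans ?_
    congr 1
    change str (word (fun k => Pi.basisFun F (Fin t) k) b) = _
    simp only [Pi.basisFun_apply]
  have h2 : str (word (fun k => (Pi.single k 1 : Fin t → F)) b) = (Matrix.of b).det := by
    have := congrArg (fun f => f b) (AlternatingMap.eq_smul_basis_det (Pi.basisFun F (Fin t))
      (strRight fun k => Pi.single k 1))
    simp only [AlternatingMap.smul_apply, Pi.basisFun_det_apply, smul_eq_mul] at this
    refine this.trans ?_
    change str (word (fun k => (Pi.single k 1 : Fin t → F)) (fun k => Pi.basisFun F (Fin t) k)) * _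
      = _
    simp only [Pi.basisFun_apply]
    rw [str_word_basis, one_mul]
  rw [h1, h2, mul_comm]

end Fock

/-! ### Bordered determinants -/

namespace Fock

variable {F : Type*} [Field F]

/-- The determinant of `M`, bordered by the columns `a k` and the rows `-b k`. -/
def bordered {t d : ℕ} (M : Matrix (Fin t) (Fin t) F) (a b : Fin d → Fin t → F) : F :=
  (Matrix.fromBlocks M (Matrix.of fun i k => a k i) (Matrix.of fun k j => -b k j) 0).det

/-- A rank one update of a matrix, expanded by bordering. -/
lemma det_add_vecMulVec {p : Type*} [Fintype p] [DecidableEq p] (N : Matrix p p F) (u v : p → F) :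
    (N + Matrix.vecMulVec u v).det = N.det +
      (Matrix.fromBlocks N (Matrix.of fun i (_ : Fin 1) => u i)
        (Matrix.of fun (_ : Fin 1) j => -v j) 0).det := by
  set X : Matrix (p ⊕ Fin 1) (p ⊕ Fin 1) F := Matrix.fromBlocks N
    (Matrix.of fun i (_ : Fin 1) => u i) (Matrix.of fun (_ : Fin 1) j => -v j) 0
  have h1 : (N + Matrix.vecMulVec u v).det = (Matrix.fromBlocks N
      (Matrix.of fun i (_ : Fin 1) => u i) (Matrix.of fun (_ : Fin 1) j => -v j) 1).det := by
    rw [Matrix.det_fromBlocks_one₂₂]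
    congr 1
    ext i j
    simp [Matrix.mul_apply, Matrix.vecMulVec_apply]
  have h2 : Matrix.fromBlocks N (Matrix.of fun i (_ : Fin 1) => u i)
      (Matrix.of fun (_ : Fin 1) j => -v j) 1 =
      X.updateCol (Sum.inr 0)
        (Sum.elim u (0 : Fin 1 → F) + Sum.elim (0 : p → F) (1 : Fin 1 → F)) := by
    ext (i | i) (j | j) <;> simp [X, Fin.eq_zero]
  have h3 : X.updateCol (Sum.inr 0) (Sum.elim u 0) = X := by
    ext (i | i) (j | j) <;> simp [X, Fin.eq_zero]
  have h4 : X.updateCol (Sum.inr 0) (Sum.elim 0 1) = Matrix.fromBlocks N 0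
      (Matrix.of fun (_ : Fin 1) j => -v j) 1 := by
    ext (i | i) (j | j) <;> simp [X, Fin.eq_zero]
  rw [h1, h2, Matrix.det_updateCol_add, h3, h4, Matrix.det_fromBlocks_zero₁₂, Matrix.det_one,
    mul_one, add_comm]

/-- A rank one update either does not contribute, or borders the matrix once more. -/
theorem bordered_add_vecMulVec {t d : ℕ} (M : Matrix (Fin t) (Fin t) F) (a b : Fin d → Fin t → F)
    (u v : Fin t → F) :
    bordered (M + Matrix.vecMulVec u v) a b = bordered M a b +
      bordered M (Fin.snoc (α := fun _ => Fin t → F) a u)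
        (Fin.snoc (α := fun _ => Fin t → F) b v) := by
  have h1 : Matrix.fromBlocks (M + Matrix.vecMulVec u v) (Matrix.of fun i k => a k i)
      (Matrix.of fun k j => -b k j) 0 = Matrix.fromBlocks M (Matrix.of fun i k => a k i)
      (Matrix.of fun k j => -b k j) 0 + Matrix.vecMulVec (Sum.elim u (0 : Fin d → F))
        (Sum.elim v (0 : Fin d → F)) := by
    ext (i | i) (j | j) <;> simp [Matrix.vecMulVec_apply]
  let e : (Fin t ⊕ Fin d) ⊕ Fin 1 ≃ Fin t ⊕ Fin (d + 1) :=
    (Equiv.sumAssoc _ _ _).trans (Equiv.sumCongr (Equiv.refl _) finSumFinEquiv)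
  have hc : ∀ k : Fin d, Fin.castAdd 1 k = k.castSucc := fun _ => rfl
  have hl : ∀ k : Fin 1, Fin.natAdd d k = Fin.last d := fun k => by
    rw [Fin.eq_zero k]; rfl
  unfold bordered
  rw [h1, det_add_vecMulVec, ← Matrix.det_submatrix_equiv_self e]
  congr 2
  ext ((i | i) | i) ((j | j) | j) <;> simp [e, hc, hl]

lemma det_antidiagonal {t : ℕ} (A B : Matrix (Fin t) (Fin t) F) :
    (Matrix.fromBlocks 0 A (-B) 0).det = A.det * B.det := by
  have h : Matrix.fromBlocks 0 A (-B) 0 = Matrix.fromBlocks A 0 0 B *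
      (Matrix.fromBlocks 1 1 0 1 * Matrix.fromBlocks 1 0 (-1) 1 * Matrix.fromBlocks 1 1 0 1) := by
    simp [Matrix.fromBlocks_multiply]
  rw [h]
  simp

/-- Unless the border has width `t`, the rows through one of the two zero blocks are linearly
dependent. -/
theorem bordered_zero {t d : ℕ} (a b : Fin d → Fin t → F) (h : d ≠ t) : bordered 0 a b = 0 := by
  rcases lt_or_gt_of_ne h with h | h
  · obtain ⟨u, hu, ha⟩ := exists_orthogonal h a
    refine Matrix.exists_vecMul_eq_zero_iff.mp ⟨Sum.elim u 0, fun h0 => hu ?_, ?_⟩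
    · ext i
      exact congrFun h0 (Sum.inl i)
    · ext (i | i)
      · simp [Matrix.vecMul, dotProduct]
      · simpa [Matrix.vecMul, dotProduct] using ha i
  · obtain ⟨u, hu, hb⟩ := exists_orthogonal h fun j k => b k j
    refine Matrix.exists_vecMul_eq_zero_iff.mp ⟨Sum.elim 0 u, fun h0 => hu ?_, ?_⟩
    · ext i
      exact congrFun h0 (Sum.inr i)
    · ext (i | i)
      · simpa [Matrix.vecMul, dotProduct] using hb i
      · simp [Matrix.vecMul, dotProduct]

theorem bordered_zero_self {t : ℕ} (a b : Fin t → Fin t → F) :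
    bordered 0 a b = (Matrix.of a).det * (Matrix.of b).det := by
  rw [← Matrix.det_transpose (Matrix.of a), ← det_antidiagonal]
  rfl

lemma word_snoc {t d : ℕ} (a b : Fin d → Fin t → F) (u v : Fin t → F) :
    word (Fin.snoc (α := fun _ => Fin t → F) a u) (Fin.snoc (α := fun _ => Fin t → F) b v) =
      word a b * pairOp (u, v) := by
  rw [word, List.ofFn_succ', List.prod_concat]
  simp [word]

/-- The factor `1 + h E`, where `E` is the operator of a pair and `h` the formal variable that
counts pairs. -/
noncomputable def pairFactor {t : ℕ} (p : (Fin t → F) × (Fin t → F)) :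
    Polynomial (Matrix (Ix t) (Ix t) F) :=
  1 + Polynomial.monomial 1 (pairOp p)

/-- Both sides satisfy the same recursion: a factor `1 + h E` either does not contribute or prolongs
the word, and a rank one update of a matrix either does not contribute or borders it. -/
theorem str_coeff_word {t : ℕ} (r : List ((Fin t → F) × (Fin t → F))) {d : ℕ}
    (a b : Fin d → Fin t → F) :
    str ((Polynomial.monomial d (word a b) * (r.map pairFactor).prod).coeff t) =
      bordered (r.map fun p => Matrix.vecMulVec p.1 p.2).sum a b := by
  induction r generalizing d with
  | nil =>
    simp only [List.map_nil, List.prod_nil, mul_one, List.sum_nil, Polynomial.coeff_monomial]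
    split_ifs with h
    · subst h
      rw [str_word, bordered_zero_self]
    · rw [map_zero, bordered_zero a b h]
  | cons p r ih =>
    rw [List.map_cons, List.prod_cons, List.map_cons, List.sum_cons, add_comm,
      bordered_add_vecMulVec, ← ih, ← ih, word_snoc, pairFactor, add_mul, one_mul, mul_add,
      ← mul_assoc, Polynomial.monomial_mul_monomial, Polynomial.coeff_add, map_add]

/-! ### The sieve -/

section Sieve

variable {t n z : ℕ} (A : Matrix (Fin t ⊕ (Fin n ⊕ Fin z)) (Fin t ⊕ (Fin n ⊕ Fin z)) F)
  (ρ : Fin n ⊕ Fin z → F)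

/-- The pair of an element of `T`, `V` or `Z`. Its first component is the part of its column of `A`
in `T`, for `V ∪ Z` multiplied by the entry of `ρ`. -/
def elementPair : Fin t ⊕ (Fin n ⊕ Fin z) → (Fin t → F) × (Fin t → F)
  | .inl i => (fun j => A (.inl j) (.inl i), Pi.single i 1)
  | .inr v => (ρ v • fun j => A (.inl j) (.inr v), fun j => A (.inl j) (.inr v))

/-- The contribution of the set `X ⊆ V ∪ Z`. -/
noncomputable def contribution (X : Finset (Fin n ⊕ Fin z)) : F :=
  (DeltaMatroid.principal A ((Finset.univ : Finset (Fin t)).disjSum X)).det * ∏ v ∈ X, ρ v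

variable {A}

/-- Bordering `A[T]` with the pairs of distinct elements of `V ∪ Z` gives, by skew-symmetry and
since `A[V ∪ Z] = 0`, a principal submatrix of `A` with scaled columns. A repeated element gives two
equal rows. -/
theorem bordered_elements (hA : DeltaMatroid.IsSparse A) {d : ℕ} (l : Fin d → Fin n ⊕ Fin z) :
    bordered (∑ i, Matrix.vecMulVec (elementPair A ρ (.inl i)).1 (elementPair A ρ (.inl i)).2)
      (fun k => (elementPair A ρ (.inr (l k))).1) (fun k => (elementPair A ρ (.inr (l k))).2) =
    if Function.Injective l then contribution A ρ (univ.image l) else 0 := by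
  have hB : ∑ i, Matrix.vecMulVec (elementPair A ρ (.inl i)).1 (elementPair A ρ (.inl i)).2 =
      Matrix.of fun i j => A (.inl i) (.inl j) := by
    ext i j
    simp [Matrix.sum_apply, Matrix.vecMulVec_apply, elementPair, Pi.single_apply]
  rw [hB]
  split_ifs with hl
  · obtain ⟨e, he⟩ : ∃ e : Fin t ⊕ Fin d ≃ ((Finset.univ : Finset (Fin t)).disjSum (univ.image l) :
        Finset (Fin t ⊕ (Fin n ⊕ Fin z))), ∀ x, (e x).val = Sum.map id l x := by
      refine ⟨Equiv.ofBijective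
        (fun x => ⟨Sum.map id l x, by rcases x with x | x <;> simp⟩) ⟨fun x y h => ?_, ?_⟩,
        fun x => rfl⟩
      · have h' : Sum.map id l x = Sum.map id l y := congrArg Subtype.val h
        exact (Function.injective_id.sumMap hl) h'
      · rintro ⟨x | x, hx⟩
        · exact ⟨.inl x, rfl⟩
        · simp only [inr_mem_disjSum, mem_image, mem_univ, true_and] at hx
          obtain ⟨k, rfl⟩ := hx
          exact ⟨.inr k, rfl⟩
    have h1 : Matrix.fromBlocks (Matrix.of fun i j => A (.inl i) (.inl j))
        (Matrix.of fun i k => (elementPair A ρ (.inr (l k))).1 i)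
        (Matrix.of fun k j => -(elementPair A ρ (.inr (l k))).2 j) 0 =
        Matrix.of fun x y => Sum.elim (1 : Fin t → F) (fun k => ρ (l k)) y *
          ((DeltaMatroid.principal A
            ((Finset.univ : Finset (Fin t)).disjSum (univ.image l))).submatrix e e) x y := by
      ext (i | i) (j | j)
      · simp [he, DeltaMatroid.principal]
      · simp [he, DeltaMatroid.principal, elementPair]
      · have := congrFun (congrFun hA.1.1 (.inr (l i))) (.inl j)
        simp only [Matrix.transpose_apply, Matrix.neg_apply] at this
        simp [he, DeltaMatroid.principal, elementPair, this]
      · simp [he, DeltaMatroid.principal, hA.2]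
    rw [bordered, h1, Matrix.det_mul_row, Matrix.det_submatrix_equiv_self, contribution,
      Fintype.prod_sum_type, Finset.prod_image fun x _ y _ h => hl h, mul_comm]
    simp
  · simp only [Function.Injective, not_forall] at hl
    obtain ⟨i, j, hij, hne⟩ := hl
    exact Matrix.det_zero_of_row_eq (i := Sum.inr i) (j := Sum.inr j) (by simpa using hne)
      (by ext (x | x) <;> simp [hij])

/-- Each rank one update by an element of `Z` sums over not choosing or choosing this element. -/
theorem bordered_add_elements (hA : DeltaMatroid.IsSparse A) (s : Finset (Fin z)) {d : ℕ}
    (l : Fin d → Fin n ⊕ Fin z) (hs : ∀ k, ∀ j ∈ s, l k ≠ .inr j) :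
    bordered (∑ i, Matrix.vecMulVec (elementPair A ρ (.inl i)).1 (elementPair A ρ (.inl i)).2 +
        ∑ j ∈ s, Matrix.vecMulVec (elementPair A ρ (.inr (.inr j))).1
          (elementPair A ρ (.inr (.inr j))).2)
      (fun k => (elementPair A ρ (.inr (l k))).1) (fun k => (elementPair A ρ (.inr (l k))).2) =
    if Function.Injective l then
      ∑ Y ∈ s.powerset, contribution A ρ (univ.image l ∪ Y.map .inr) else 0 := by
  induction s using Finset.induction_on generalizing d with
  | empty => simp [bordered_elements ρ hA]
  | insert j s hj ih =>
    have hsnoc : ∀ f : Fin n ⊕ Fin z → Fin t → F,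
        (Fin.snoc (α := fun _ => Fin t → F) (fun k => f (l k)) (f (.inr j))) =
        fun k => f (Fin.snoc (α := fun _ => Fin n ⊕ Fin z) l (.inr j) k) := by
      intro f
      ext k : 1
      refine Fin.lastCases ?_ (fun k => ?_) k <;> simp
    have hjl : ∀ k, l k ≠ .inr j := fun k => hs k j (mem_insert_self _ _)
    have hinj : Function.Injective (Fin.snoc (α := fun _ => Fin n ⊕ Fin z) l (.inr j)) ↔
        Function.Injective l := by
      rw [Fin.snoc_injective_iff]
      simp [hjl]
    have himg : univ.image (Fin.snoc (α := fun _ => Fin n ⊕ Fin z) l (.inr j)) =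
        insert (.inr j) (univ.image l) := by
      ext x
      simp only [mem_image, mem_univ, true_and, mem_insert, Fin.exists_fin_succ',
        Fin.snoc_castSucc, Fin.snoc_last]
      tauto
    rw [sum_insert hj, add_comm (Matrix.vecMulVec _ _), ← add_assoc, bordered_add_vecMulVec,
      hsnoc fun v => (elementPair A ρ (.inr v)).1, hsnoc fun v => (elementPair A ρ (.inr v)).2,
      ih l fun k j' hj' => hs k j' (mem_insert_of_mem hj'), ih]
    · simp only [hinj]
      split_ifs
      · rw [sum_powerset_insert hj, himg]
        congr 1
        refine sum_congr rfl fun Y _ => ?_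
        congr 1
        ext x
        simp only [mem_union, mem_insert, mem_map]
        constructor
        · rintro ((rfl | h) | ⟨y, hy, rfl⟩)
          · exact .inr ⟨j, .inl rfl, rfl⟩
          · exact .inl h
          · exact .inr ⟨y, .inr hy, rfl⟩
        · rintro (h | ⟨y, rfl | hy, rfl⟩)
          · exact .inl (.inr h)
          · exact .inl (.inl rfl)
          · exact .inr ⟨y, hy, rfl⟩
      · simp
    · intro k j' hj'
      refine Fin.lastCases ?_ (fun k => ?_) k
      · simp only [Fin.snoc_last, ne_eq, Sum.inr.injEq]
        rintro rfl
        exact hj hj'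
      · simpa using hs k j' (mem_insert_of_mem hj')

/-- The value of the sieved polynomial at a monomial. -/
noncomputable def sievedMonomial (A : Matrix (Fin t ⊕ (Fin n ⊕ Fin z)) (Fin t ⊕ (Fin n ⊕ Fin z)) F)
    (ρ : Fin n ⊕ Fin z → F) (m : Fin n →₀ ℕ) : F :=
  if ∀ i, m i ≤ 1 then ∑ Y : Finset (Fin z), contribution A ρ (m.support.disjSum Y) else 0

/-- The sieved value, as a linear function of the polynomial. -/
noncomputable def sievedLinear (A : Matrix (Fin t ⊕ (Fin n ⊕ Fin z)) (Fin t ⊕ (Fin n ⊕ Fin z)) F)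
    (ρ : Fin n ⊕ Fin z → F) : MvPolynomial (Fin n) F →ₗ[F] F :=
  (MvPolynomial.basisMonomials (Fin n) F).constr F (sievedMonomial A ρ)

lemma sievedLinear_monomial (m : Fin n →₀ ℕ) :
    sievedLinear A ρ (MvPolynomial.monomial m 1) = sievedMonomial A ρ m := by
  have := (MvPolynomial.basisMonomials (Fin n) F).constr_basis F (sievedMonomial A ρ) m
  rwa [MvPolynomial.coe_basisMonomials] at this

lemma sievedLinear_apply (P : MvPolynomial (Fin n) F) : sievedLinear A ρ P = sieved A P ρ := by
  conv_lhs => rw [P.as_sum, map_sum]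
  rw [sieved, sum_filter]
  refine sum_congr rfl fun m _ => ?_
  have : MvPolynomial.monomial m (P.coeff m) = P.coeff m • MvPolynomial.monomial m 1 := by
    rw [MvPolynomial.smul_monomial, smul_eq_mul, mul_one]
  rw [this, map_smul, sievedLinear_monomial, sievedMonomial, smul_eq_mul]
  split_ifs
  · rw [mul_sum]
    refine sum_congr rfl fun Y _ => ?_
    rw [contribution, prod_disjSum]
    ring
  · rw [mul_zero]

variable (A)

/-- The pairs of a polynomial in commuting variables and of an operator polynomial that arise from
the same noncommutative polynomial, by substituting the variables and the operators `h E_v`. -/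
noncomputable def liftings :
    Subalgebra F (MvPolynomial (Fin n) F × Polynomial (Matrix (Ix t) (Ix t) F)) :=
  Algebra.adjoin F (Set.range fun v : Fin n =>
    (MvPolynomial.X v, Polynomial.monomial 1 (pairOp (elementPair A ρ (.inr (.inl v))))))

variable {A}

/-- The operators do not commute, but the sieve cannot tell: on a lifting of `P` it returns the
sieved value of `P`. -/
theorem str_coeff_lifting (hA : DeltaMatroid.IsSparse A)
    (r : List ((Fin t → F) × (Fin t → F)))
    (hr : (r.map fun p => Matrix.vecMulVec p.1 p.2).sum =
      ∑ i, Matrix.vecMulVec (elementPair A ρ (.inl i)).1 (elementPair A ρ (.inl i)).2 +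
        ∑ j, Matrix.vecMulVec (elementPair A ρ (.inr (.inr j))).1
          (elementPair A ρ (.inr (.inr j))).2)
    {P : MvPolynomial (Fin n) F} {M : Polynomial (Matrix (Ix t) (Ix t) F)}
    (h : (P, M) ∈ liftings A ρ) :
    str ((M * (r.map pairFactor).prod).coeff t) = sieved A P ρ := by
  have key : ∀ x ∈ liftings A ρ,
      str ((x.2 * (r.map pairFactor).prod).coeff t) = sievedLinear A ρ x.1 := by
    intro x hx
    rw [liftings, ← Subalgebra.mem_toSubmodule, Algebra.adjoin_eq_span] at hx
    induction hx using Submodule.span_induction with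
    | zero => simp
    | add x y _ _ hx hy => simp only [Prod.snd_add, Prod.fst_add, add_mul, Polynomial.coeff_add,
        map_add, hx, hy]
    | smul c x _ hx => simp only [Prod.smul_snd, Prod.smul_fst, smul_mul_assoc,
        Polynomial.coeff_smul, map_smul, hx]
    | mem x hx =>
      -- The liftings are spanned by the pairs of a monomial and a word in its variables.
      have hword : ∃ (d : ℕ) (l : Fin d → Fin n),
          x = (MvPolynomial.monomial (∑ k, Finsupp.single (l k) 1) 1, Polynomial.monomial d
            (word (fun k => (elementPair A ρ (.inr (.inl (l k)))).1)
              (fun k => (elementPair A ρ (.inr (.inl (l k)))).2))) := by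
        induction hx using Submonoid.closure_induction_right with
        | one => exact ⟨0, Fin.elim0, by simp [word]; rfl⟩
        | mul_right x _ y hy ih =>
          obtain ⟨d, l, rfl⟩ := ih
          obtain ⟨v, rfl⟩ := hy
          refine ⟨d + 1, Fin.snoc (α := fun _ => Fin n) l v, ?_⟩
          have hsnoc : ∀ f : Fin n → Fin t → F,
              (fun k => f (Fin.snoc (α := fun _ => Fin n) l v k)) =
              (Fin.snoc (α := fun _ => Fin t → F) (fun k => f (l k)) (f v)) := by
            intro f
            ext k : 1
            refine Fin.lastCases ?_ (fun k => ?_) k <;> simp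
          rw [hsnoc fun v => (elementPair A ρ (.inr (.inl v))).1,
            hsnoc fun v => (elementPair A ρ (.inr (.inl v))).2, word_snoc, Prod.mk_mul_mk,
            Polynomial.monomial_mul_monomial, Fin.sum_univ_castSucc, MvPolynomial.X,
            MvPolynomial.monomial_mul]
          simp
      obtain ⟨d, l, rfl⟩ := hword
      simp only
      rw [sievedLinear_monomial, str_coeff_word, hr, bordered_add_elements ρ hA univ
        (fun k => .inl (l k)) (by simp), sievedMonomial]
      have hm : ∀ i, (∑ k, Finsupp.single (l k) 1 : Fin n →₀ ℕ) i = #{k | l k = i} := by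
        intro i
        simp [Finsupp.finsetSum_apply, Finsupp.single_apply, Finset.sum_boole]
      have hinj : (∀ i, (∑ k, Finsupp.single (l k) 1 : Fin n →₀ ℕ) i ≤ 1) ↔
          Function.Injective fun k => (Sum.inl (l k) : Fin n ⊕ Fin z) := by
        simp only [hm, card_le_one, mem_filter, mem_univ, true_and]
        constructor
        · intro h x y hxy
          exact h (l y) x (Sum.inl_injective hxy) y rfl
        · intro h i x hx y hy
          exact h (congrArg Sum.inl (hx.trans hy.symm))
      simp only [hinj, powerset_univ]
      refine if_congr Iff.rfl (sum_congr rfl fun Y _ => ?_) rfl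
      congr 1
      ext (x | x)
      · simp [hm, Finset.card_eq_zero, Finset.filter_eq_empty_iff]
      · simp
  rw [key _ h, sievedLinear_apply]

end Sieve

end Fock

namespace Prog

/-! ### Shifted programs -/

/-- The program with all names of registers and arrays increased by `k`. -/
def shift (k : ℕ) : Prog → Prog
  | natConst x c => natConst (x + k) c
  | natAdd x y z => natAdd (x + k) (y + k) (z + k)
  | natSub x y z => natSub (x + k) (y + k) (z + k)
  | natLoad x a y => natLoad (x + k) (a + k) (y + k)
  | natStore a y x => natStore (a + k) (y + k) (x + k)
  | fldZero x => fldZero (x + k)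
  | fldOne x => fldOne (x + k)
  | fldAdd x y z => fldAdd (x + k) (y + k) (z + k)
  | fldSub x y z => fldSub (x + k) (y + k) (z + k)
  | fldMul x y z => fldMul (x + k) (y + k) (z + k)
  | fldInv x y => fldInv (x + k) (y + k)
  | fldLoad x a y => fldLoad (x + k) (a + k) (y + k)
  | fldStore a y x => fldStore (a + k) (y + k) (x + k)
  | seq p q => seq (shift k p) (shift k q)
  | natIf x p q => natIf (x + k) (shift k p) (shift k q)
  | fldIf x p q => fldIf (x + k) (shift k p) (shift k q)
  | .while x p => .while (x + k) (shift k p)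

/-- The program may assign to the natural number register. -/
def WritesNat (r : ℕ) : Prog → Prop
  | natConst x _ => x = r
  | natAdd x _ _ => x = r
  | natSub x _ _ => x = r
  | natLoad x _ _ => x = r
  | seq p q => WritesNat r p ∨ WritesNat r q
  | natIf _ p q => WritesNat r p ∨ WritesNat r q
  | fldIf _ p q => WritesNat r p ∨ WritesNat r q
  | .while _ p => WritesNat r p
  | _ => False

/-- The program may store to the array of natural numbers. -/
def WritesNatArr (r : ℕ) : Prog → Prop
  | natStore a _ _ => a = r
  | seq p q => WritesNatArr r p ∨ WritesNatArr r q
  | natIf _ p q => WritesNatArr r p ∨ WritesNatArr r q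
  | fldIf _ p q => WritesNatArr r p ∨ WritesNatArr r q
  | .while _ p => WritesNatArr r p
  | _ => False

/-- The program may assign to the field register. -/
def WritesFld (r : ℕ) : Prog → Prop
  | fldZero x => x = r
  | fldOne x => x = r
  | fldAdd x _ _ => x = r
  | fldSub x _ _ => x = r
  | fldMul x _ _ => x = r
  | fldInv x _ => x = r
  | fldLoad x _ _ => x = r
  | seq p q => WritesFld r p ∨ WritesFld r q
  | natIf _ p q => WritesFld r p ∨ WritesFld r q
  | fldIf _ p q => WritesFld r p ∨ WritesFld r q
  | .while _ p => WritesFld r p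
  | _ => False

/-- The program may store to the field array. -/
def WritesFldArr (r : ℕ) : Prog → Prop
  | fldStore a _ _ => a = r
  | seq p q => WritesFldArr r p ∨ WritesFldArr r q
  | natIf _ p q => WritesFldArr r p ∨ WritesFldArr r q
  | fldIf _ p q => WritesFldArr r p ∨ WritesFldArr r q
  | .while _ p => WritesFldArr r p
  | _ => False

end Prog

namespace Memory

variable {F : Type*}

/-- The part of the memory with names from `k` on, with `k` subtracted from the names. -/
def view (k : ℕ) (σ : Memory F) : Memory F where
  nat x := σ.nat (x + k)
  natArr a := σ.natArr (a + k)
  fld x := σ.fld (x + k)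
  fldArr a := σ.fldArr (a + k)

lemma view_setNat (k : ℕ) (σ : Memory F) (x v : ℕ) :
    view k (σ.setNat (x + k) v) = (view k σ).setNat x v := by
  simp only [view, setNat, mk.injEq, and_true]
  ext y
  simp [Function.update_apply]

lemma view_setFld (k : ℕ) (σ : Memory F) (x : ℕ) (v : F) :
    view k (σ.setFld (x + k) v) = (view k σ).setFld x v := by
  simp only [view, setFld, mk.injEq, and_true, true_and]
  ext y
  simp [Function.update_apply]

lemma view_setNatArr (k : ℕ) (σ : Memory F) (a j v : ℕ) :
    view k (σ.setNatArr (a + k) j v) = (view k σ).setNatArr a j v := by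
  simp only [view, setNatArr, mk.injEq, and_true, true_and]
  ext y
  simp only [Function.update_apply, Nat.add_right_cancel_iff]

lemma view_setFldArr (k : ℕ) (σ : Memory F) (a j : ℕ) (v : F) :
    view k (σ.setFldArr (a + k) j v) = (view k σ).setFldArr a j v := by
  simp only [view, setFldArr, mk.injEq, true_and]
  ext y
  simp only [Function.update_apply, Nat.add_right_cancel_iff]

end Memory

namespace Prog

variable {F : Type*} [Field F]

/-- A shifted program acts on the view from `k` on as the original program. -/
theorem exec_shift (k : ℕ) {p : Prog} {τ τ' : Memory F} {c : ℕ} (h : Exec p τ τ' c) :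
    ∀ σ : Memory F, σ.view k = τ → ∃ σ', Exec (p.shift k) σ σ' c ∧ σ'.view k = τ' := by
  induction h with
  | natConst _ x c => rintro σ rfl; exact ⟨_, .natConst σ _ _, σ.view_setNat k _ _⟩
  | natAdd _ x y z => rintro σ rfl; exact ⟨_, .natAdd σ _ _ _, σ.view_setNat k _ _⟩
  | natSub _ x y z => rintro σ rfl; exact ⟨_, .natSub σ _ _ _, σ.view_setNat k _ _⟩
  | natLoad _ x a y => rintro σ rfl; exact ⟨_, .natLoad σ _ _ _, σ.view_setNat k _ _⟩
  | natStore _ a y x => rintro σ rfl; exact ⟨_, .natStore σ _ _ _, σ.view_setNatArr k _ _ _⟩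
  | fldZero _ x => rintro σ rfl; exact ⟨_, .fldZero σ _, σ.view_setFld k _ _⟩
  | fldOne _ x => rintro σ rfl; exact ⟨_, .fldOne σ _, σ.view_setFld k _ _⟩
  | fldAdd _ x y z => rintro σ rfl; exact ⟨_, .fldAdd σ _ _ _, σ.view_setFld k _ _⟩
  | fldSub _ x y z => rintro σ rfl; exact ⟨_, .fldSub σ _ _ _, σ.view_setFld k _ _⟩
  | fldMul _ x y z => rintro σ rfl; exact ⟨_, .fldMul σ _ _ _, σ.view_setFld k _ _⟩
  | fldInv _ x y => rintro σ rfl; exact ⟨_, .fldInv σ _ _, σ.view_setFld k _ _⟩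
  | fldLoad _ x a y => rintro σ rfl; exact ⟨_, .fldLoad σ _ _ _, σ.view_setFld k _ _⟩
  | fldStore _ a y x => rintro σ rfl; exact ⟨_, .fldStore σ _ _ _, σ.view_setFldArr k _ _ _⟩
  | seq _ _ ih1 ih2 =>
    intro σ hσ
    obtain ⟨σ1, e1, h1⟩ := ih1 σ hσ
    obtain ⟨σ2, e2, h2⟩ := ih2 σ1 h1
    exact ⟨σ2, .seq e1 e2, h2⟩
  | natIf_true hx _ ih =>
    rintro σ rfl
    obtain ⟨σ1, e1, h1⟩ := ih σ rfl
    exact ⟨σ1, .natIf_true hx e1, h1⟩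
  | natIf_false hx _ ih =>
    rintro σ rfl
    obtain ⟨σ1, e1, h1⟩ := ih σ rfl
    exact ⟨σ1, .natIf_false hx e1, h1⟩
  | fldIf_true hx _ ih =>
    rintro σ rfl
    obtain ⟨σ1, e1, h1⟩ := ih σ rfl
    exact ⟨σ1, .fldIf_true hx e1, h1⟩
  | fldIf_false hx _ ih =>
    rintro σ rfl
    obtain ⟨σ1, e1, h1⟩ := ih σ rfl
    exact ⟨σ1, .fldIf_false hx e1, h1⟩
  | while_true hx _ _ ih1 ih2 =>
    rintro σ rfl
    obtain ⟨σ1, e1, h1⟩ := ih1 σ rfl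
    obtain ⟨σ2, e2, h2⟩ := ih2 σ1 h1
    exact ⟨σ2, .while_true hx e1 e2, h2⟩
  | while_false hx =>
    rintro σ rfl
    exact ⟨σ, .while_false hx, rfl⟩

lemma WritesNat.le_of_shift {k r : ℕ} {p : Prog} (h : (p.shift k).WritesNat r) : k ≤ r := by
  induction p with
  | seq p q ih1 ih2 => exact h.elim ih1 ih2
  | natIf x p q ih1 ih2 => exact h.elim ih1 ih2
  | fldIf x p q ih1 ih2 => exact h.elim ih1 ih2
  | _ =>
    first
    | (simp only [shift, WritesNat] at h <;> omega)
    | (rename_i ih; exact ih h)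

lemma WritesNatArr.le_of_shift {k r : ℕ} {p : Prog} (h : (p.shift k).WritesNatArr r) :
    k ≤ r := by
  induction p with
  | seq p q ih1 ih2 => exact h.elim ih1 ih2
  | natIf x p q ih1 ih2 => exact h.elim ih1 ih2
  | fldIf x p q ih1 ih2 => exact h.elim ih1 ih2
  | _ =>
    first
    | (simp only [shift, WritesNatArr] at h <;> omega)
    | (rename_i ih; exact ih h)

lemma WritesFldArr.le_of_shift {k r : ℕ} {p : Prog} (h : (p.shift k).WritesFldArr r) :
    k ≤ r := by
  induction p with
  | seq p q ih1 ih2 => exact h.elim ih1 ih2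
  | natIf x p q ih1 ih2 => exact h.elim ih1 ih2
  | fldIf x p q ih1 ih2 => exact h.elim ih1 ih2
  | _ =>
    first
    | (simp only [shift, WritesFldArr] at h <;> omega)
    | (rename_i ih; exact ih h)

/-! ### Total correctness with time bounds -/

section Agree

variable {F : Type*}

/-- The memories agree outside of what the program may write. -/
structure Agree (p : Prog) (σ τ : Memory F) : Prop where
  nat : ∀ r, ¬p.WritesNat r → τ.nat r = σ.nat r
  natArr : ∀ r, ¬p.WritesNatArr r → τ.natArr r = σ.natArr r
  fld : ∀ r, ¬p.WritesFld r → τ.fld r = σ.fld r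
  fldArr : ∀ r, ¬p.WritesFldArr r → τ.fldArr r = σ.fldArr r

theorem Agree.refl (p : Prog) (σ : Memory F) : Agree p σ σ :=
  ⟨fun _ _ => rfl, fun _ _ => rfl, fun _ _ => rfl, fun _ _ => rfl⟩

theorem Agree.trans {p : Prog} {σ τ υ : Memory F} (h : Agree p σ τ) (h' : Agree p τ υ) :
    Agree p σ υ :=
  ⟨fun r hr => (h'.nat r hr).trans (h.nat r hr), fun r hr => (h'.natArr r hr).trans (h.natArr r hr),
    fun r hr => (h'.fld r hr).trans (h.fld r hr),
    fun r hr => (h'.fldArr r hr).trans (h.fldArr r hr)⟩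

/-- Agreement outside of what `p` may write implies agreement outside of what `q` may write, if `q`
may write all that `p` may write. -/
theorem Agree.mono {p q : Prog} {σ τ : Memory F} (h : Agree p σ τ)
    (h1 : ∀ r, p.WritesNat r → q.WritesNat r) (h2 : ∀ r, p.WritesNatArr r → q.WritesNatArr r)
    (h3 : ∀ r, p.WritesFld r → q.WritesFld r) (h4 : ∀ r, p.WritesFldArr r → q.WritesFldArr r) :
    Agree q σ τ :=
  ⟨fun r hr => h.nat r (mt (h1 r) hr), fun r hr => h.natArr r (mt (h2 r) hr),
    fun r hr => h.fld r (mt (h3 r) hr), fun r hr => h.fldArr r (mt (h4 r) hr)⟩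

lemma agree_setNat {p : Prog} (σ : Memory F) {x : ℕ} (v : ℕ) (h : p.WritesNat x) :
    Agree p σ (σ.setNat x v) :=
  ⟨fun r hr => Function.update_of_ne (fun he => hr (by rw [he]; exact h)) _ _, fun _ _ => rfl,
    fun _ _ => rfl, fun _ _ => rfl⟩

lemma agree_setFld {p : Prog} (σ : Memory F) {x : ℕ} (v : F) (h : p.WritesFld x) :
    Agree p σ (σ.setFld x v) :=
  ⟨fun _ _ => rfl, fun _ _ => rfl,
    fun r hr => Function.update_of_ne (fun he => hr (by rw [he]; exact h)) _ _, fun _ _ => rfl⟩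

lemma agree_setNatArr {p : Prog} (σ : Memory F) {a : ℕ} (j v : ℕ) (h : p.WritesNatArr a) :
    Agree p σ (σ.setNatArr a j v) :=
  ⟨fun _ _ => rfl, fun r hr => Function.update_of_ne (fun he => hr (by rw [he]; exact h)) _ _,
    fun _ _ => rfl, fun _ _ => rfl⟩

lemma agree_setFldArr {p : Prog} (σ : Memory F) {a : ℕ} (j : ℕ) (v : F) (h : p.WritesFldArr a) :
    Agree p σ (σ.setFldArr a j v) :=
  ⟨fun _ _ => rfl, fun _ _ => rfl, fun _ _ => rfl,
    fun r hr => Function.update_of_ne (fun he => hr (by rw [he]; exact h)) _ _⟩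

end Agree

variable {F : Type*} [Field F]

/-- A program changes only what it may write. -/
theorem agree_of_exec {p : Prog} {σ τ : Memory F} {c : ℕ} (h : Exec p σ τ c) : Agree p σ τ := by
  induction h with
  | natConst σ x c => exact agree_setNat σ _ rfl
  | natAdd σ x y z => exact agree_setNat σ _ rfl
  | natSub σ x y z => exact agree_setNat σ _ rfl
  | natLoad σ x a y => exact agree_setNat σ _ rfl
  | natStore σ a y x => exact agree_setNatArr σ _ _ rfl
  | fldZero σ x => exact agree_setFld σ _ rfl
  | fldOne σ x => exact agree_setFld σ _ rfl
  | fldAdd σ x y z => exact agree_setFld σ _ rfl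
  | fldSub σ x y z => exact agree_setFld σ _ rfl
  | fldMul σ x y z => exact agree_setFld σ _ rfl
  | fldInv σ x y => exact agree_setFld σ _ rfl
  | fldLoad σ x a y => exact agree_setFld σ _ rfl
  | fldStore σ a y x => exact agree_setFldArr σ _ _ rfl
  | seq _ _ ih1 ih2 =>
    exact (ih1.mono (fun _ => Or.inl) (fun _ => Or.inl) (fun _ => Or.inl) (fun _ => Or.inl)).trans
      (ih2.mono (fun _ => Or.inr) (fun _ => Or.inr) (fun _ => Or.inr) (fun _ => Or.inr))
  | natIf_true _ _ ih =>
    exact ih.mono (fun _ => Or.inl) (fun _ => Or.inl) (fun _ => Or.inl) (fun _ => Or.inl)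
  | natIf_false _ _ ih =>
    exact ih.mono (fun _ => Or.inr) (fun _ => Or.inr) (fun _ => Or.inr) (fun _ => Or.inr)
  | fldIf_true _ _ ih =>
    exact ih.mono (fun _ => Or.inl) (fun _ => Or.inl) (fun _ => Or.inl) (fun _ => Or.inl)
  | fldIf_false _ _ ih =>
    exact ih.mono (fun _ => Or.inr) (fun _ => Or.inr) (fun _ => Or.inr) (fun _ => Or.inr)
  | while_true _ _ _ ih1 ih2 =>
    exact Agree.trans (ih1.mono (fun _ h => h) (fun _ h => h) (fun _ h => h) (fun _ h => h)) ih2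
  | while_false _ => exact .refl _ _

/-- Total correctness with a time bound: started in `σ`, the program `p` halts in a memory that
satisfies `Q`, after `k` units of time. The unit is the largest cost of an instruction that operates
on natural numbers up to `B`. -/
def Runs (B : ℕ) (p : Prog) (σ : Memory F) (k : ℕ) (Q : Memory F → Prop) : Prop :=
  ∃ σ' c, Exec p σ σ' c ∧ c ≤ k * (1 + 2 * B.size) ∧ Q σ'

variable {B : ℕ}

theorem Runs.mono {p : Prog} {σ : Memory F} {k k' : ℕ} {Q Q' : Memory F → Prop}
    (h : Runs B p σ k Q) (hk : k ≤ k') (hQ : ∀ τ, Agree p σ τ → Q τ → Q' τ) :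
    Runs B p σ k' Q' := by
  obtain ⟨σ', c, e, hc, hq⟩ := h
  exact ⟨σ', c, e, hc.trans (Nat.mul_le_mul_right _ hk), hQ _ (agree_of_exec e) hq⟩

/-- The rule for sequences. The second part may use that the first one changes only what it may
write. -/
theorem Runs.seq {p q : Prog} {σ : Memory F} {k l : ℕ} {Q R : Memory F → Prop}
    (hp : Runs B p σ k Q) (hq : ∀ τ, Agree p σ τ → Q τ → Runs B q τ l R) :
    Runs B (.seq p q) σ (k + l) R := by
  obtain ⟨σ', c, e, hc, h⟩ := hp
  obtain ⟨σ'', d, e', hd, h'⟩ := hq σ' (agree_of_exec e) h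
  exact ⟨σ'', c + d, .seq e e', by rw [add_mul]; exact add_le_add hc hd, h'⟩

theorem Runs.natIf {x : ℕ} {p q : Prog} {σ : Memory F} {k : ℕ} {Q : Memory F → Prop}
    (hx : σ.nat x ≤ B) (hp : σ.nat x ≠ 0 → Runs B p σ k Q) (hq : σ.nat x = 0 → Runs B q σ k Q) :
    Runs B (.natIf x p q) σ (k + 1) Q := by
  have := Nat.size_le_size hx
  by_cases h : σ.nat x = 0
  · obtain ⟨σ', c, e, hc, h'⟩ := hq h
    exact ⟨σ', _, .natIf_false h e, by rw [add_mul]; omega, h'⟩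
  · obtain ⟨σ', c, e, hc, h'⟩ := hp h
    exact ⟨σ', _, .natIf_true h e, by rw [add_mul]; omega, h'⟩

/-- The weakest precondition of a program without loops: the natural numbers that it meets are at
most `B`, and it ends in a memory that satisfies `Q`. -/
def wp (B : ℕ) : Prog → (Memory F → Prop) → Memory F → Prop
  | natConst x c, Q, σ => c ≤ B ∧ Q (σ.setNat x c)
  | natAdd x y z, Q, σ => σ.nat y ≤ B ∧ σ.nat z ≤ B ∧ Q (σ.setNat x (σ.nat y + σ.nat z))
  | natSub x y z, Q, σ => σ.nat y ≤ B ∧ σ.nat z ≤ B ∧ Q (σ.setNat x (σ.nat y - σ.nat z))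
  | natLoad x a y, Q, σ => σ.nat y ≤ B ∧ σ.natArr a (σ.nat y) ≤ B ∧
      Q (σ.setNat x (σ.natArr a (σ.nat y)))
  | natStore a y x, Q, σ => σ.nat y ≤ B ∧ σ.nat x ≤ B ∧ Q (σ.setNatArr a (σ.nat y) (σ.nat x))
  | fldZero x, Q, σ => Q (σ.setFld x 0)
  | fldOne x, Q, σ => Q (σ.setFld x 1)
  | fldAdd x y z, Q, σ => Q (σ.setFld x (σ.fld y + σ.fld z))
  | fldSub x y z, Q, σ => Q (σ.setFld x (σ.fld y - σ.fld z))
  | fldMul x y z, Q, σ => Q (σ.setFld x (σ.fld y * σ.fld z))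
  | fldInv x y, Q, σ => Q (σ.setFld x (σ.fld y)⁻¹)
  | fldLoad x a y, Q, σ => σ.nat y ≤ B ∧ Q (σ.setFld x (σ.fldArr a (σ.nat y)))
  | fldStore a y x, Q, σ => σ.nat y ≤ B ∧ Q (σ.setFldArr a (σ.nat y) (σ.fld x))
  | seq p q, Q, σ => wp B p (wp B q Q) σ
  | natIf x p q, Q, σ => σ.nat x ≤ B ∧ (σ.nat x ≠ 0 → wp B p Q σ) ∧ (σ.nat x = 0 → wp B q Q σ)
  | fldIf x p q, Q, σ => (σ.fld x ≠ 0 → wp B p Q σ) ∧ (σ.fld x = 0 → wp B q Q σ)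
  | .while _ _, _, _ => False

/-- The number of instructions, which bounds the time of a program without loops. -/
def length : Prog → ℕ
  | seq p q => length p + length q
  | natIf _ p q => length p + length q + 1
  | fldIf _ p q => length p + length q + 1
  | _ => 1

/-- Each instruction takes at most one unit of time, if the natural numbers that it meets are at
most `B`. -/
theorem runs_of_wp {p : Prog} {σ : Memory F} {Q : Memory F → Prop} (h : wp B p Q σ) :
    Runs B p σ p.length Q := by
  induction p generalizing σ Q with
  | natConst x c =>
    have := Nat.size_le_size h.1
    exact ⟨_, _, .natConst σ x c, by simp only [length]; omega, h.2⟩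
  | natAdd x y z =>
    have := Nat.size_le_size h.1
    have := Nat.size_le_size h.2.1
    exact ⟨_, _, .natAdd σ x y z, by simp only [length]; omega, h.2.2⟩
  | natSub x y z =>
    have := Nat.size_le_size h.1
    have := Nat.size_le_size h.2.1
    exact ⟨_, _, .natSub σ x y z, by simp only [length]; omega, h.2.2⟩
  | natLoad x a y =>
    have := Nat.size_le_size h.1
    have := Nat.size_le_size h.2.1
    exact ⟨_, _, .natLoad σ x a y, by simp only [length]; omega, h.2.2⟩
  | natStore a y x =>
    have := Nat.size_le_size h.1
    have := Nat.size_le_size h.2.1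
    exact ⟨_, _, .natStore σ a y x, by simp only [length]; omega, h.2.2⟩
  | fldZero x => exact ⟨_, _, .fldZero σ x, by simp only [length]; omega, h⟩
  | fldOne x => exact ⟨_, _, .fldOne σ x, by simp only [length]; omega, h⟩
  | fldAdd x y z => exact ⟨_, _, .fldAdd σ x y z, by simp only [length]; omega, h⟩
  | fldSub x y z => exact ⟨_, _, .fldSub σ x y z, by simp only [length]; omega, h⟩
  | fldMul x y z => exact ⟨_, _, .fldMul σ x y z, by simp only [length]; omega, h⟩
  | fldInv x y => exact ⟨_, _, .fldInv σ x y, by simp only [length]; omega, h⟩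
  | fldLoad x a y =>
    have := Nat.size_le_size h.1
    exact ⟨_, _, .fldLoad σ x a y, by simp only [length]; omega, h.2⟩
  | fldStore a y x =>
    have := Nat.size_le_size h.1
    exact ⟨_, _, .fldStore σ a y x, by simp only [length]; omega, h.2⟩
  | seq p q ihp ihq => exact (ihp h).seq fun τ _ hτ => ihq hτ
  | natIf x p q ihp ihq =>
    exact Runs.natIf h.1 (fun hx => (ihp (h.2.1 hx)).mono (Nat.le_add_right _ _) fun _ _ => id)
      fun hx => (ihq (h.2.2 hx)).mono (Nat.le_add_left _ _) fun _ _ => id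
  | fldIf x p q ihp ihq =>
    by_cases hx : σ.fld x = 0
    · obtain ⟨σ', c, e, hc, h'⟩ := ihq (h.2 hx)
      exact ⟨σ', _, .fldIf_false hx e, by simp only [length, add_mul]; omega, h'⟩
    · obtain ⟨σ', c, e, hc, h'⟩ := ihp (h.1 hx)
      exact ⟨σ', _, .fldIf_true hx e, by simp only [length, add_mul]; omega, h'⟩
  | _ => exact h.elim

/-- For `i` from `0` to the content of register `n` minus one. The register `9` is the scratch
register of all loops. -/
def forLoop (i n : ℕ) (p : Prog) : Prog :=
  .seq (natConst i 0) (.seq (natSub 9 n i)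
    (.while 9 (.seq p (.seq (natConst 9 1) (.seq (natAdd i i 9) (natSub 9 n i))))))

/-- The rule for loops. The invariant may refer to the memory, but not to the loop registers. -/
theorem Runs.forLoop {i n k len : ℕ} {p : Prog} {σ : Memory F} (I : ℕ → Memory F → Prop)
    (hn : σ.nat n = len) (hlen : len < B) (hi : i ≠ 9) (hn9 : n ≠ 9) (hin : i ≠ n)
    (hpi : ¬p.WritesNat i) (hpn : ¬p.WritesNat n)
    (hI : ∀ j τ x v, x = i ∨ x = 9 → I j τ → I j (τ.setNat x v)) (h0 : I 0 σ)
    (step : ∀ j < len, ∀ τ, τ.nat i = j → Agree (Prog.forLoop i n p) σ τ → I j τ →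
      Runs B p τ k (I (j + 1))) :
    Runs B (Prog.forLoop i n p) σ (len * (k + 4) + 3) (I len) := by
  have hw9 : (Prog.forLoop i n p).WritesNat 9 := Or.inr (Or.inl rfl)
  have hwi : (Prog.forLoop i n p).WritesNat i := Or.inl rfl
  have hsize : ∀ v, v ≤ B → v.size ≤ B.size := fun v => Nat.size_le_size
  -- At the test of the loop, register `9` holds the number `r` of the remaining rounds.
  have main : ∀ r j τ, j + r = len → τ.nat i = j → τ.nat 9 = r →
      Agree (Prog.forLoop i n p) σ τ → I j τ →
      Runs B (.while 9 (.seq p (.seq (natConst 9 1) (.seq (natAdd i i 9) (natSub 9 n i))))) τ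
        (r * (k + 4) + 1) (I len) := by
    intro r
    induction r with
    | zero =>
      intro j τ hj hτi hτ9 hag hIj
      refine ⟨τ, _, .while_false hτ9, by omega, ?_⟩
      rwa [show len = j by omega]
    | succ r ih =>
      intro j τ hj hτi hτ9 hag hIj
      obtain ⟨τ1, c, e, hc, h1⟩ := step j (by omega) τ hτi hag hIj
      have ag1 := agree_of_exec e
      have hτ1i : τ1.nat i = j := (ag1.nat i hpi).trans hτi
      have hwn : ¬(Prog.forLoop i n p).WritesNat n := by
        simp only [Prog.forLoop, WritesNat]
        tauto
      have hτ1n : τ1.nat n = len := ((ag1.nat n hpn).trans (hag.nat n hwn)).trans hn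
      have ag2 : Agree (Prog.forLoop i n p) σ τ1 := hag.trans (ag1.mono
        (fun _ h => Or.inr (Or.inr (Or.inl h))) (fun _ h => Or.inr (Or.inr (Or.inl h)))
        (fun _ h => Or.inr (Or.inr (Or.inl h))) (fun _ h => Or.inr (Or.inr (Or.inl h))))
      let τ2 := τ1.setNat 9 1
      let τ3 := τ2.setNat i (j + 1)
      let τ4 := τ3.setNat 9 r
      have e2 : Exec (natConst 9 1) τ1 τ2 (1 + (1 : ℕ).size) := .natConst _ _ _
      have hτ2i : τ2.nat i = j := by simp [τ2, Memory.setNat, hi, hτ1i]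
      have hτ29 : τ2.nat 9 = 1 := by simp [τ2, Memory.setNat]
      have e3 : Exec (natAdd i i 9) τ2 τ3 (1 + (τ2.nat i).size + (τ2.nat 9).size) := by
        have := Exec.natAdd τ2 i i 9
        rwa [show τ2.setNat i (τ2.nat i + τ2.nat 9) = τ3 by rw [hτ2i, hτ29]] at this
      have hτ3i : τ3.nat i = j + 1 := by simp [τ3, Memory.setNat]
      have hτ3n : τ3.nat n = len := by
        simp [τ3, τ2, Memory.setNat, hin.symm, hn9, hτ1n]
      have e4 : Exec (natSub 9 n i) τ3 τ4 (1 + (τ3.nat n).size + (τ3.nat i).size) := by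
        have := Exec.natSub τ3 9 n i
        rwa [show τ3.setNat 9 (τ3.nat n - τ3.nat i) = τ4 by
          rw [hτ3i, hτ3n, show len - (j + 1) = r by omega]] at this
      obtain ⟨τ', d, e', hd, hI'⟩ := ih (j + 1) τ4 (by omega)
        (by simp [τ4, Memory.setNat, hi, hτ3i])
        (by simp [τ4, Memory.setNat])
        (((ag2.trans (agree_setNat _ _ hw9)).trans (agree_setNat _ _ hwi)).trans
          (agree_setNat _ _ hw9))
        (hI _ _ _ _ (.inr rfl) (hI _ _ _ _ (.inl rfl) (hI _ _ _ _ (.inr rfl) h1)))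
      refine ⟨τ', _, .while_true (by omega) (.seq e (.seq e2 (.seq e3 e4))) e', ?_, hI'⟩
      rw [hτ2i, hτ29, hτ3i, hτ3n, hτ9]
      have := hsize 1 (by omega)
      have := hsize j (by omega)
      have := hsize (j + 1) (by omega)
      have := hsize len (by omega)
      have := hsize (r + 1) (by omega)
      have : ((r + 1) * (k + 4) + 1) * (1 + 2 * B.size) = k * (1 + 2 * B.size) +
        (r * (k + 4) + 1) * (1 + 2 * B.size) + 4 * (1 + 2 * B.size) := by ring
      omega
  let σ1 := σ.setNat i 0
  let σ2 := σ1.setNat 9 len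
  have e1 : Exec (natConst i 0) σ σ1 (1 + (0 : ℕ).size) := .natConst _ _ _
  have e2 : Exec (natSub 9 n i) σ1 σ2 (1 + (σ1.nat n).size + (σ1.nat i).size) := by
    have := Exec.natSub σ1 9 n i
    rwa [show σ1.setNat 9 (σ1.nat n - σ1.nat i) = σ2 by
      simp [σ2, σ1, Memory.setNat, hin.symm, hn]] at this
  obtain ⟨τ', d, e', hd, hI'⟩ := main len 0 σ2 (by omega)
    (by simp [σ2, σ1, Memory.setNat, hi]) (by simp [σ2, Memory.setNat])
    ((agree_setNat _ _ hwi).trans (agree_setNat _ _ hw9))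
    (hI _ _ _ _ (.inr rfl) (hI _ _ _ _ (.inl rfl) h0))
  refine ⟨τ', _, .seq e1 (.seq e2 e'), ?_, hI'⟩
  have h1 : σ1.nat n = len := by simp [σ1, Memory.setNat, hin.symm, hn]
  have h2 : σ1.nat i = 0 := by simp [σ1, Memory.setNat]
  rw [h1, h2]
  have := hsize 0 (by omega)
  have := hsize len (by omega)
  have : (len * (k + 4) + 3) * (1 + 2 * B.size) =
    (len * (k + 4) + 1) * (1 + 2 * B.size) + 2 * (1 + 2 * B.size) := by ring
  omega

end Prog

/-! ### Reading after writing -/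

section Simp

variable {F : Type*} (σ : Memory F)

namespace Memory

@[simp] lemma nat_setNat (x v y : ℕ) :
    (σ.setNat x v).nat y = if y = x then v else σ.nat y := Function.update_apply _ _ _ _
@[simp] lemma natArr_setNat (x v : ℕ) : (σ.setNat x v).natArr = σ.natArr := rfl
@[simp] lemma fld_setNat (x v : ℕ) : (σ.setNat x v).fld = σ.fld := rfl
@[simp] lemma fldArr_setNat (x v : ℕ) : (σ.setNat x v).fldArr = σ.fldArr := rfl
@[simp] lemma nat_setFld (x : ℕ) (v : F) : (σ.setFld x v).nat = σ.nat := rfl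
@[simp] lemma natArr_setFld (x : ℕ) (v : F) : (σ.setFld x v).natArr = σ.natArr := rfl
@[simp] lemma fld_setFld (x : ℕ) (v : F) (y : ℕ) :
    (σ.setFld x v).fld y = if y = x then v else σ.fld y := Function.update_apply _ _ _ _
@[simp] lemma fldArr_setFld (x : ℕ) (v : F) : (σ.setFld x v).fldArr = σ.fldArr := rfl
@[simp] lemma nat_setNatArr (a j v : ℕ) : (σ.setNatArr a j v).nat = σ.nat := rfl
@[simp] lemma natArr_setNatArr (a j v b : ℕ) : (σ.setNatArr a j v).natArr b =
    if b = a then Function.update (σ.natArr a) j v else σ.natArr b := Function.update_apply _ _ _ _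
@[simp] lemma nat_setFldArr (a j : ℕ) (v : F) : (σ.setFldArr a j v).nat = σ.nat := rfl
@[simp] lemma fld_setFldArr (a j : ℕ) (v : F) : (σ.setFldArr a j v).fld = σ.fld := rfl
@[simp] lemma fldArr_setFldArr (a j : ℕ) (v : F) (b : ℕ) : (σ.setFldArr a j v).fldArr b =
    if b = a then Function.update (σ.fldArr a) j v else σ.fldArr b := Function.update_apply _ _ _ _

end Memory

end Simp

/-- First the program on the left, then the program on the right. -/
infixr:67 " ⨾ " => Prog.seq

/-! ### Matrices in memory -/

namespace Fock

/-- The position of a basis vector in the enumeration of the basis by binary numbers. -/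
def ixEquiv : (t : ℕ) → Ix t ≃ Fin (2 ^ t)
  | 0 => (Equiv.ofUnique Unit (Fin 1))
  | t + 1 => (Equiv.sumCongr (ixEquiv t) (ixEquiv t)).trans
      (finSumFinEquiv.trans (finCongr (by rw [pow_succ, mul_two])))

/-- The number of a basis vector; the last mode is the most significant bit. -/
def pos {t : ℕ} (a : Ix t) : ℕ := (ixEquiv t a).val

lemma pos_lt {t : ℕ} (a : Ix t) : pos a < 2 ^ t := (ixEquiv t a).isLt

lemma pos_injective {t : ℕ} : Function.Injective (pos (t := t)) :=
  fun _ _ h => (ixEquiv t).injective (Fin.ext h)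

lemma pos_inl {t : ℕ} (a : Ix t) : pos (t := t + 1) (Sum.inl a : Ix t ⊕ Ix t) = pos a := rfl

lemma pos_inr {t : ℕ} (a : Ix t) : pos (t := t + 1) (Sum.inr a : Ix t ⊕ Ix t) = 2 ^ t + pos a := rfl

variable {F : Type*}

/-- The matrix stored row by row in the block number `q` of an array. -/
def slot (t : ℕ) (f : ℕ → F) (q : ℕ) : Matrix (Ix t) (Ix t) F :=
  fun a b => f (q * (2 ^ t * 2 ^ t) + (pos a * 2 ^ t + pos b))

lemma offset_lt {t : ℕ} (a b : Ix t) : pos a * 2 ^ t + pos b < 2 ^ t * 2 ^ t := by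
  have h1 := pos_lt b
  have h2 : (pos a + 1) * 2 ^ t ≤ 2 ^ t * 2 ^ t := Nat.mul_le_mul_right _ (pos_lt a)
  rw [add_mul, one_mul] at h2
  omega

/-- Only the slot `d` changes if the block of its addresses is overwritten. -/
lemma slot_ite (t : ℕ) (f g : ℕ → F) (d q : ℕ) :
    slot t (fun x => if d * (2 ^ t * 2 ^ t) ≤ x ∧ x < d * (2 ^ t * 2 ^ t) + 2 ^ t * 2 ^ t then g x
      else f x) q = if q = d then slot t g d else slot t f q := by
  ext a b
  have h := offset_lt a b
  rcases lt_trichotomy q d with hq | rfl | hq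
  · have : (q + 1) * (2 ^ t * 2 ^ t) ≤ d * (2 ^ t * 2 ^ t) := Nat.mul_le_mul_right _ hq
    rw [add_mul, one_mul] at this
    rw [if_neg hq.ne]
    simp only [slot]
    rw [if_neg (by omega)]
  · simp only [slot, if_true]
    rw [if_pos (by omega)]
  · have : (d + 1) * (2 ^ t * 2 ^ t) ≤ q * (2 ^ t * 2 ^ t) := Nat.mul_le_mul_right _ hq
    rw [add_mul, one_mul] at this
    rw [if_neg hq.ne']
    simp only [slot]
    rw [if_neg (by omega)]

end Fock

namespace Prog

open Fock

/-! ### Conventions for the memory -/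

/- The input and the numbers computed from it at the beginning are in the registers below `9` for
natural numbers, in the arrays below `64` of natural numbers, and in the field arrays below `3`; up
to the final answer, the other parts of the program leave these alone. Register `9` controls the
loops. The field array `3` is divided into slots of `4 ^ t` entries, one for each matrix; the
registers `15`, `16` and `17` hold the numbers of the slots for an operation. Names from `64` on
belong to the program that multiplies matrices. -/

/-- The memories agree on the input and on the numbers computed from it at the beginning. -/
structure Stable {F : Type*} (σ τ : Memory F) : Prop where
  nat : ∀ r < 9, τ.nat r = σ.nat r
  natArr : ∀ r < 64, τ.natArr r = σ.natArr r
  fldArr : ∀ r < 3, τ.fldArr r = σ.fldArr r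

theorem Stable.trans {F : Type*} {σ τ υ : Memory F} (h : Stable σ τ) (h' : Stable τ υ) :
    Stable σ υ :=
  ⟨fun r hr => (h'.nat r hr).trans (h.nat r hr), fun r hr => (h'.natArr r hr).trans (h.natArr r hr),
    fun r hr => (h'.fldArr r hr).trans (h.fldArr r hr)⟩

/-- The program writes neither the input nor the numbers computed from it at the beginning. -/
def IsLocal (p : Prog) : Prop :=
  (∀ r < 9, ¬p.WritesNat r) ∧ (∀ r < 64, ¬p.WritesNatArr r) ∧ ∀ r < 3, ¬p.WritesFldArr r

theorem IsLocal.stable {F : Type*} {p : Prog} (h : p.IsLocal) {σ τ : Memory F}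
    (ag : Agree p σ τ) : Stable σ τ :=
  ⟨fun r hr => ag.nat r (h.1 r hr), fun r hr => ag.natArr r (h.2.1 r hr),
    fun r hr => ag.fldArr r (h.2.2 r hr)⟩

lemma isLocal_seq {p q : Prog} (hp : p.IsLocal) (hq : q.IsLocal) : (p ⨾ q).IsLocal :=
  ⟨fun r hr => not_or.mpr ⟨hp.1 r hr, hq.1 r hr⟩, fun r hr => not_or.mpr ⟨hp.2.1 r hr, hq.2.1 r hr⟩,
    fun r hr => not_or.mpr ⟨hp.2.2 r hr, hq.2.2 r hr⟩⟩

lemma isLocal_natIf {x : ℕ} {p q : Prog} (hp : p.IsLocal) (hq : q.IsLocal) :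
    (natIf x p q).IsLocal :=
  isLocal_seq hp hq

lemma isLocal_forLoop {i n : ℕ} {p : Prog} (hi : 9 ≤ i) (hp : p.IsLocal) :
    (forLoop i n p).IsLocal := by
  refine ⟨fun r hr h => ?_, fun r hr h => ?_, fun r hr h => ?_⟩
  · have := hp.1 r hr
    simp only [forLoop, WritesNat] at h
    rcases h with h | h | h | h | h | h <;> first | omega | exact this h
  · have := hp.2.1 r hr
    simp only [forLoop, WritesNatArr] at h
    tauto
  · have := hp.2.2 r hr
    simp only [forLoop, WritesFldArr] at h
    tauto

lemma isLocal_shift (p : Prog) : (p.shift 64).IsLocal :=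
  ⟨fun _ hr h => absurd h.le_of_shift (by omega), fun _ hr h => absurd h.le_of_shift (by omega),
    fun _ hr h => absurd h.le_of_shift (by omega)⟩

lemma not_writesNat_shift (p : Prog) {r : ℕ} (hr : r < 64) : ¬(p.shift 64).WritesNat r :=
  fun h => absurd h.le_of_shift (by omega)

lemma not_writesFldArr_shift (p : Prog) {r : ℕ} (hr : r < 64) : ¬(p.shift 64).WritesFldArr r :=
  fun h => absurd h.le_of_shift (by omega)

lemma isLocal_natConst {x c : ℕ} (h : 9 ≤ x) : (natConst x c).IsLocal :=
  ⟨fun _ hr hx => by simp only [WritesNat] at hx; omega, fun _ _ => id, fun _ _ => id⟩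

lemma isLocal_natAdd {x y z : ℕ} (h : 9 ≤ x) : (natAdd x y z).IsLocal :=
  ⟨fun _ hr hx => by simp only [WritesNat] at hx; omega, fun _ _ => id, fun _ _ => id⟩

lemma isLocal_natSub {x y z : ℕ} (h : 9 ≤ x) : (natSub x y z).IsLocal :=
  ⟨fun _ hr hx => by simp only [WritesNat] at hx; omega, fun _ _ => id, fun _ _ => id⟩

lemma isLocal_natLoad {x y z : ℕ} (h : 9 ≤ x) : (natLoad x y z).IsLocal :=
  ⟨fun _ hr hx => by simp only [WritesNat] at hx; omega, fun _ _ => id, fun _ _ => id⟩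

lemma isLocal_fldStore {a y x : ℕ} (h : 3 ≤ a) : (fldStore a y x).IsLocal :=
  ⟨fun _ _ => id, fun _ _ => id, fun _ hr hx => by simp only [WritesFldArr] at hx; omega⟩

lemma isLocal_fldZero (x : ℕ) : (fldZero x).IsLocal := ⟨fun _ _ => id, fun _ _ => id, fun _ _ => id⟩

lemma isLocal_fldOne (x : ℕ) : (fldOne x).IsLocal := ⟨fun _ _ => id, fun _ _ => id, fun _ _ => id⟩

lemma isLocal_fldAdd (x y z : ℕ) : (fldAdd x y z).IsLocal :=
  ⟨fun _ _ => id, fun _ _ => id, fun _ _ => id⟩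

lemma isLocal_fldMul (x y z : ℕ) : (fldMul x y z).IsLocal :=
  ⟨fun _ _ => id, fun _ _ => id, fun _ _ => id⟩

lemma isLocal_fldLoad (x a y : ℕ) : (fldLoad x a y).IsLocal :=
  ⟨fun _ _ => id, fun _ _ => id, fun _ _ => id⟩

variable {F : Type*} [Field F] {B : ℕ}

/-- The rule for a first part, with the time for both parts given. -/
theorem Runs.andThen {p q : Prog} {σ : Memory F} {k K : ℕ} {Q R : Memory F → Prop}
    (hp : Runs B p σ k Q) (hk : k ≤ K)
    (hq : ∀ τ, Agree p σ τ → Q τ → Runs B q τ (K - k) R) : Runs B (p ⨾ q) σ K R :=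
  (hp.seq hq).mono (by omega) fun _ _ h => h

/-- The rule for a first instruction. -/
theorem Runs.cons {p q : Prog} {σ : Memory F} {K : ℕ} {R : Memory F → Prop} (hk : p.length ≤ K)
    (h : wp B p (fun τ => Runs B q τ (K - p.length) R) σ) : Runs B (p ⨾ q) σ K R :=
  (runs_of_wp h).andThen hk fun _ _ hτ => hτ

/-! ### Blocks of memory -/

/-- `x := y * z` for natural numbers, by repeated addition. -/
def mulReg (x y z : ℕ) : Prog := natConst x 0 ⨾ forLoop 10 y (natAdd x x z)

theorem runs_mulReg {x y z : ℕ} {σ : Memory F} {a b : ℕ} (ha : σ.nat y = a) (hb : σ.nat z = b)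
    (hab : a * b ≤ B) (haB : a < B) (hbB : b ≤ B) (hx : 10 < x) (hy : y ≠ 9 ∧ y ≠ 10)
    (hz : z ≠ 9 ∧ z ≠ 10) (hxy : x ≠ y) (hxz : x ≠ z) :
    Runs B (mulReg x y z) σ (5 * a + 4) (fun τ => τ.nat x = a * b) := by
  have h1 : Runs B (natConst x 0) σ 1 fun τ => τ.nat x = 0 :=
    runs_of_wp (by simp [wp])
  refine (h1.seq fun τ1 ag1 h1 => Runs.forLoop (B := B) (k := 1) (len := a)
    (fun j τ => τ.nat x = j * b) ?_ haB (by omega) hy.1 hy.2.symm ?_ ?_ ?_ ?_ ?_).mono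
      (by omega) fun _ _ h => h
  · rw [ag1.nat y (by simpa [WritesNat] using hxy), ha]
  · simp only [WritesNat]; omega
  · simp only [WritesNat]; omega
  · intro j τ r v hr h
    rw [Memory.nat_setNat, if_neg (by omega)]
    exact h
  · simpa using h1
  · intro j hj τ _ ag h
    have hzτ : τ.nat z = b := by
      rw [ag.nat z (by simp only [forLoop, WritesNat]; omega),
        ag1.nat z (by simpa [WritesNat] using hxz), hb]
    have : (j + 1) * b ≤ a * b := Nat.mul_le_mul_right _ hj
    rw [add_mul, one_mul] at this
    refine runs_of_wp ?_
    simp only [wp, Memory.nat_setNat, if_true, h, hzτ, add_mul, one_mul]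
    exact ⟨by omega, hbB, trivial⟩

/-- Clear the block that begins at the address in register `13`. -/
def zeroBlock (arr : ℕ) : Prog :=
  forLoop 11 6 (natAdd 12 13 11 ⨾ fldZero 2 ⨾ fldStore arr 12 2)

theorem runs_zeroBlock {arr : ℕ} {σ : Memory F} {b Q : ℕ} (hQ : σ.nat 6 = Q)
    (hb : σ.nat 13 = b) (hB : b + Q < B) :
    Runs B (zeroBlock arr) σ (7 * Q + 3) (fun τ => τ.fldArr arr =
      fun x => if b ≤ x ∧ x < b + Q then 0 else σ.fldArr arr x) := by
  refine (Runs.forLoop (B := B) (k := 3) (len := Q) (fun j τ => τ.fldArr arr =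
      fun x => if b ≤ x ∧ x < b + j then 0 else σ.fldArr arr x) hQ (by omega) (by omega) (by omega)
      (by omega) (by simp [WritesNat]) (by simp [WritesNat]) (fun _ _ _ _ _ h => h) ?_ ?_).mono
      (by omega) fun _ _ h => h
  · ext x
    rw [if_neg (by omega)]
  · intro j hj τ hτ ag h
    have h13 : τ.nat 13 = b := by rw [ag.nat 13 (by simp [forLoop, WritesNat]), hb]
    refine runs_of_wp ?_
    simp only [wp, Memory.nat_setNat, Memory.nat_setFld, Memory.fld_setFld, if_true, h13, hτ,
      Memory.fldArr_setFldArr, Memory.fldArr_setFld, Memory.fldArr_setNat, h]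
    refine ⟨by omega, by omega, by omega, ?_⟩
    ext x
    rw [Function.update_apply]
    by_cases hx : x = b + j
    · rw [if_pos hx, if_pos (by omega)]
    · rw [if_neg hx]
      exact if_congr (by omega) rfl rfl

/-- Add the multiple by the field register `1` of the block that begins at the address in register
`14` to the block that begins at the address in register `13`. -/
def axpyBlock (dst src : ℕ) : Prog :=
  forLoop 11 6 (natAdd 12 14 11 ⨾ fldLoad 2 src 12 ⨾ fldMul 2 1 2 ⨾ natAdd 12 13 11 ⨾
    fldLoad 3 dst 12 ⨾ fldAdd 2 3 2 ⨾ fldStore dst 12 2)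

theorem runs_axpyBlock {dst src : ℕ} {σ : Memory F} {b b' Q : ℕ} {c : F} (hQ : σ.nat 6 = Q)
    (hb : σ.nat 13 = b) (hb' : σ.nat 14 = b') (hc : σ.fld 1 = c) (hB : b + Q < B) (hB' : b' + Q < B)
    (hd : dst ≠ src ∨ b + Q ≤ b' ∨ b' + Q ≤ b) :
    Runs B (axpyBlock dst src) σ (11 * Q + 3) (fun τ => τ.fldArr dst =
      fun x => if b ≤ x ∧ x < b + Q then σ.fldArr dst x + c * σ.fldArr src (b' + (x - b))
        else σ.fldArr dst x) := by
  refine (Runs.forLoop (B := B) (k := 7) (len := Q) (fun j τ => τ.fldArr dst =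
      fun x => if b ≤ x ∧ x < b + j then σ.fldArr dst x + c * σ.fldArr src (b' + (x - b))
        else σ.fldArr dst x) hQ (by omega) (by omega) (by omega)
      (by omega) (by simp [WritesNat]) (by simp [WritesNat]) (fun _ _ _ _ _ h => h) ?_ ?_).mono
      (by omega) fun _ _ h => h
  · ext x
    rw [if_neg (by omega)]
  · intro j hj τ hτ ag h
    have h13 : τ.nat 13 = b := by rw [ag.nat 13 (by simp [forLoop, WritesNat]), hb]
    have h14 : τ.nat 14 = b' := by rw [ag.nat 14 (by simp [forLoop, WritesNat]), hb']
    have h1 : τ.fld 1 = c := by rw [ag.fld 1 (by simp [forLoop, WritesFld]), hc]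
    have hsrc : τ.fldArr src (b' + j) = σ.fldArr src (b' + j) := by
      by_cases hds : dst = src
      · subst hds
        rw [h]
        simp only
        rw [if_neg (by omega)]
      · rw [ag.fldArr src (by simpa [forLoop, WritesFldArr] using hds)]
    have hdst : τ.fldArr dst (b + j) = σ.fldArr dst (b + j) := by
      rw [h]
      simp only
      rw [if_neg (by omega)]
    refine runs_of_wp ?_
    simp only [wp, Memory.nat_setNat, Memory.nat_setFld, Memory.fld_setFld, Memory.fld_setNat,
      if_true, h13, h14, hτ, Memory.fldArr_setFldArr, Memory.fldArr_setFld, Memory.fldArr_setNat,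
      Nat.reduceEqDiff, if_false, OfNat.one_ne_ofNat, h1, hsrc, hdst]
    refine ⟨by omega, by omega, by omega, by omega, by omega, by omega, by omega, ?_⟩
    ext x
    rw [Function.update_apply, h]
    by_cases hx : x = b + j
    · subst hx
      rw [if_pos rfl, if_pos (by omega), Nat.add_sub_cancel_left]
    · rw [if_neg hx]
      exact if_congr (by omega) rfl rfl

end Prog

namespace Prog

open Fock

variable {F : Type*} [Field F] {B : ℕ}

/-! ### Operations on slots -/

/-- Clear the slot whose number is in register `15`. -/
def zeroSlot : Prog := mulReg 13 15 6 ⨾ zeroBlock 3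

/-- Add the multiple by the field register `1` of the slot whose number is in register `16` to the
slot whose number is in register `15`. -/
def addSlot : Prog := mulReg 13 15 6 ⨾ mulReg 14 16 6 ⨾ axpyBlock 3 3

lemma isLocal_mulReg {x y z : ℕ} (hx : 9 ≤ x) : (mulReg x y z).IsLocal :=
  isLocal_seq (isLocal_natConst hx) (isLocal_forLoop (by omega) (isLocal_natAdd hx))

lemma isLocal_zeroBlock {a : ℕ} (ha : 3 ≤ a) : (zeroBlock a).IsLocal :=
  isLocal_forLoop (by omega) (isLocal_seq (isLocal_natAdd (by omega))
    (isLocal_seq (isLocal_fldZero _) (isLocal_fldStore ha)))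

lemma isLocal_axpyBlock {a b : ℕ} (ha : 3 ≤ a) : (axpyBlock a b).IsLocal :=
  isLocal_forLoop (by omega) (isLocal_seq (isLocal_natAdd (by omega))
    (isLocal_seq (isLocal_fldLoad _ _ _) (isLocal_seq (isLocal_fldMul _ _ _)
      (isLocal_seq (isLocal_natAdd (by omega)) (isLocal_seq (isLocal_fldLoad _ _ _)
        (isLocal_seq (isLocal_fldAdd _ _ _) (isLocal_fldStore ha)))))))

lemma isLocal_zeroSlot : zeroSlot.IsLocal :=
  isLocal_seq (isLocal_mulReg (by omega)) (isLocal_zeroBlock le_rfl)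

lemma isLocal_addSlot : addSlot.IsLocal :=
  isLocal_seq (isLocal_mulReg (by omega)) (isLocal_seq (isLocal_mulReg (by omega))
    (isLocal_axpyBlock le_rfl))

/-- The bounds under which the programs are run: `L` bounds the number of slots, `B` the natural
numbers, and `W` the time for an operation on slots. -/
structure Bounds (t L B W : ℕ) : Prop where
  nat : L * (2 ^ t * 2 ^ t) + 4 < B
  size : 2 ^ t * 2 ^ t ≤ W
  slots : L ≤ W

section Bounds

variable {t L W : ℕ}

lemma Bounds.slot (hb : Bounds t L B W) {q : ℕ} (hq : q < L) :
    q * (2 ^ t * 2 ^ t) + 2 ^ t * 2 ^ t + 4 < B := by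
  have := Nat.mul_le_mul_right (2 ^ t * 2 ^ t) (Nat.succ_le_of_lt hq)
  have := hb.nat
  rw [Nat.succ_eq_add_one, add_mul, one_mul] at *
  omega

lemma Bounds.le (hb : Bounds t L B W) : L + 4 < B := by
  have : L * 1 ≤ L * (2 ^ t * 2 ^ t) :=
    Nat.mul_le_mul_left _ (Nat.mul_pos (by positivity) (by positivity))
  have := hb.nat
  omega

lemma Bounds.pos (hb : Bounds t L B W) : 1 ≤ W :=
  le_trans (Nat.mul_pos (by positivity) (by positivity)) hb.size

theorem runs_zeroSlot (hb : Bounds t L B W) {σ : Memory F} {d : ℕ}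
    (hQ : σ.nat 6 = 2 ^ t * 2 ^ t) (hd : σ.nat 15 = d) (hdL : d < L) :
    Runs B zeroSlot σ (20 * W) (fun τ => ∀ q, slot t (τ.fldArr 3) q =
      if q = d then 0 else slot t (σ.fldArr 3) q) := by
  have h1 := hb.slot hdL
  have h2 := hb.le
  have h3 := hb.pos
  have h4 := hb.size
  have h5 := hb.slots
  refine (runs_mulReg (B := B) hd hQ (by omega) (by omega) (by omega) (by omega) (by omega)
    (by omega) (by omega) (by omega)).andThen (by omega) fun τ1 ag1 h1 => ?_
  refine (runs_zeroBlock (B := B) (Q := 2 ^ t * 2 ^ t)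
    (by rw [ag1.nat 6 (by simp [mulReg, forLoop, WritesNat]), hQ]) h1 (by omega)).mono
    (by omega) fun τ ag hτ q => ?_
  rw [hτ, slot_ite, ag1.fldArr 3 (by simp [mulReg, forLoop, WritesFldArr])]
  split_ifs <;> rfl

theorem runs_addSlot (hb : Bounds t L B W) {σ : Memory F} {d q' : ℕ} {c : F}
    (hQ : σ.nat 6 = 2 ^ t * 2 ^ t) (hd : σ.nat 15 = d) (hs : σ.nat 16 = q') (hc : σ.fld 1 = c)
    (hdL : d < L) (hsL : q' < L) (hne : d ≠ q') :
    Runs B addSlot σ (40 * W) (fun τ => ∀ q, slot t (τ.fldArr 3) q =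
      if q = d then slot t (σ.fldArr 3) d + c • slot t (σ.fldArr 3) q'
      else slot t (σ.fldArr 3) q) := by
  have h1 := hb.slot hdL
  have h1' := hb.slot hsL
  have h2 := hb.le
  have h3 := hb.pos
  have h4 := hb.size
  have h5 := hb.slots
  have hdisj : d * (2 ^ t * 2 ^ t) + 2 ^ t * 2 ^ t ≤ q' * (2 ^ t * 2 ^ t) ∨
      q' * (2 ^ t * 2 ^ t) + 2 ^ t * 2 ^ t ≤ d * (2 ^ t * 2 ^ t) := by
    rcases lt_or_gt_of_ne hne with h | h
    · left
      simpa [add_mul] using Nat.mul_le_mul_right (2 ^ t * 2 ^ t) (Nat.succ_le_of_lt h)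
    · right
      simpa [add_mul] using Nat.mul_le_mul_right (2 ^ t * 2 ^ t) (Nat.succ_le_of_lt h)
  refine (runs_mulReg (B := B) hd hQ (by omega) (by omega) (by omega) (by omega) (by omega)
    (by omega) (by omega) (by omega)).andThen (by omega) fun τ1 ag1 h1 => ?_
  refine (runs_mulReg (B := B) (a := q') (b := 2 ^ t * 2 ^ t)
    (by rw [ag1.nat 16 (by simp [mulReg, forLoop, WritesNat]), hs])
    (by rw [ag1.nat 6 (by simp [mulReg, forLoop, WritesNat]), hQ])
    (by omega) (by omega) (by omega) (by omega) (by omega)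
    (by omega) (by omega) (by omega)).andThen (by omega) fun τ2 ag2 h2 => ?_
  refine (runs_axpyBlock (B := B) (b := d * (2 ^ t * 2 ^ t)) (b' := q' * (2 ^ t * 2 ^ t))
      (Q := 2 ^ t * 2 ^ t) (dst := 3) (src := 3) (c := c)
      (by rw [ag2.nat 6 (by simp [mulReg, forLoop, WritesNat]),
        ag1.nat 6 (by simp [mulReg, forLoop, WritesNat]), hQ])
      (by rw [ag2.nat 13 (by simp [mulReg, forLoop, WritesNat]), h1]) h2
      (by rw [ag2.fld 1 (by simp [mulReg, forLoop, WritesFld]),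
        ag1.fld 1 (by simp [mulReg, forLoop, WritesFld]), hc]) (by omega) (by omega)
      (.inr hdisj)).mono (by omega) fun τ ag hτ q => ?_
  rw [hτ, slot_ite, ag2.fldArr 3 (by simp [mulReg, forLoop, WritesFldArr]),
    ag1.fldArr 3 (by simp [mulReg, forLoop, WritesFldArr])]
  refine if_congr Iff.rfl ?_ rfl
  ext a b
  simp [slot]

/-- The program multiplies matrices of size `N` in time `M`. -/
def Multiplies (F : Type*) [Field F] (p : Prog) (N M : ℕ) : Prop :=
  ∀ (A B : Matrix (Fin N) (Fin N) F) (σ : Memory F), σ.nat 0 = N →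
    (∀ a b : Fin N, σ.fldArr 0 (a * N + b) = A a b) →
    (∀ a b : Fin N, σ.fldArr 1 (a * N + b) = B a b) →
    ∃ (σ' : Memory F) (c : ℕ), Exec p σ σ' c ∧
      (∀ a b : Fin N, σ'.fldArr 2 (a * N + b) = (A * B) a b) ∧ c ≤ M

/-- Multiply the matrices in the arrays `64` and `65`, with result in the array `66`. These are the
field arrays `0`, `1` and `2` of the shifted program `p`, and register `64` is its register `0`. -/
def callMul (p : Prog) : Prog := natConst 18 0 ⨾ natAdd 64 5 18 ⨾ p.shift 64

theorem runs_callMul {p : Prog} {M : ℕ} (hp : Multiplies F p (2 ^ t) M) {σ : Memory F}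
    (hN : σ.nat 5 = 2 ^ t) (hB : 2 ^ t ≤ B) :
    Runs B (callMul p) σ (M + 2) (fun τ => slot t (τ.fldArr 66) 0 =
      slot t (σ.fldArr 64) 0 * slot t (σ.fldArr 65) 0) := by
  refine Runs.cons (by simp only [length]; omega) ?_
  simp only [wp, length]
  refine ⟨by omega, Runs.cons (by simp only [length]; omega) ?_⟩
  simp only [wp, length, Memory.nat_setNat, Nat.reduceEqDiff, if_false, if_true, hN]
  refine ⟨hB, by omega, ?_⟩
  set σ' := (σ.setNat 18 0).setNat 64 (2 ^ t + 0)
  obtain ⟨τ, c, e, h, hc⟩ := hp (Matrix.of fun a b => σ.fldArr 64 (a * 2 ^ t + b))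
    (Matrix.of fun a b => σ.fldArr 65 (a * 2 ^ t + b)) (σ'.view 64)
    (by simp [Memory.view, σ']) (fun _ _ => rfl) (fun _ _ => rfl)
  obtain ⟨σ'', e', rfl⟩ := exec_shift 64 e σ' rfl
  refine ⟨σ'', c, e', ?_, ?_⟩
  · calc c ≤ M * 1 := by omega
      _ ≤ _ := Nat.mul_le_mul (by omega) (by omega)
  ext a b
  have := h (ixEquiv t a) (ixEquiv t b)
  simp only [slot, zero_mul, zero_add, Matrix.mul_apply]
  refine this.trans ?_
  rw [Matrix.mul_apply, ← Equiv.sum_comp (ixEquiv t)]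
  rfl

/-- Copy the slot whose number is in the register `r` to an array of its own. -/
def copySlot (arr r : ℕ) : Prog :=
  natConst 13 0 ⨾ zeroBlock arr ⨾ mulReg 14 r 6 ⨾ fldOne 1 ⨾ axpyBlock arr 3

theorem runs_copySlot (hb : Bounds t L B W) {σ : Memory F} {arr r q : ℕ} (harr : 64 ≤ arr)
    (hr : 14 < r) (hQ : σ.nat 6 = 2 ^ t * 2 ^ t) (hq : σ.nat r = q) (hqL : q < L) :
    Runs B (copySlot arr r) σ (40 * W) (fun τ => slot t (τ.fldArr arr) 0 =
      slot t (σ.fldArr 3) q) := by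
  have b1 := hb.slot hqL
  have b4 := hb.le
  have b5 := hb.pos
  have b6 := hb.size
  have b7 := hb.slots
  refine Runs.cons (by simp only [length]; omega) ?_
  simp only [wp, length]
  refine ⟨by omega, ?_⟩
  refine (runs_zeroBlock (B := B) (b := 0) (Q := 2 ^ t * 2 ^ t) (by simp [hQ])
    (by simp) (by omega)).andThen (by omega) fun τ2 ag2 h2 => ?_
  refine (runs_mulReg (B := B) (a := q) (b := 2 ^ t * 2 ^ t)
    (by rw [ag2.nat r (by simp only [zeroBlock, forLoop, WritesNat, or_false]; omega),
      Memory.nat_setNat,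
      if_neg (by omega), hq])
    (by rw [ag2.nat 6 (by simp [zeroBlock, forLoop, WritesNat])]; simp [hQ])
    (by omega) (by omega) (by omega) (by omega) (by omega)
    (by omega) (by omega) (by omega)).andThen (by omega) fun τ3 ag3 h3 => ?_
  refine Runs.cons (by simp only [length]; omega) ?_
  simp only [wp, length]
  refine (runs_axpyBlock (B := B) (σ := τ3.setFld 1 1) (b := 0) (b' := q * (2 ^ t * 2 ^ t))
    (c := 1) (Q := 2 ^ t * 2 ^ t) (dst := arr) (src := 3) ?_ ?_ h3 (by simp) (by omega) (by omega)
      (.inl (by omega))).mono (by omega) fun τ ag hτ => ?_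
  · rw [Memory.nat_setFld, ag3.nat 6 (by simp [mulReg, forLoop, WritesNat]),
      ag2.nat 6 (by simp [zeroBlock, forLoop, WritesNat])]
    simp [hQ]
  · rw [Memory.nat_setFld, ag3.nat 13 (by simp [mulReg, forLoop, WritesNat]),
      ag2.nat 13 (by simp [zeroBlock, forLoop, WritesNat])]
    simp
  · rw [hτ, Memory.fldArr_setFld, ag3.fldArr 3 (by simp [mulReg, forLoop, WritesFldArr]),
      ag3.fldArr arr (by simp [mulReg, forLoop, WritesFldArr]), h2,
      ag2.fldArr 3 (by simp only [zeroBlock, forLoop, WritesFldArr, or_false, false_or]; omega)]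
    ext a b
    have := offset_lt a b
    simp only [slot, zero_mul, zero_add]
    rw [if_pos (by omega), if_pos (by omega)]
    simp

/-- Add the matrix in the array `66` to the slot whose number is in register `r`. -/
def storeSlot (r : ℕ) : Prog := mulReg 13 r 6 ⨾ natConst 14 0 ⨾ fldOne 1 ⨾ axpyBlock 3 66

theorem runs_storeSlot (hb : Bounds t L B W) {σ : Memory F} {r d : ℕ} (hr : 13 < r)
    (hQ : σ.nat 6 = 2 ^ t * 2 ^ t) (hd : σ.nat r = d) (hdL : d < L) :
    Runs B (storeSlot r) σ (30 * W) (fun τ => ∀ q, slot t (τ.fldArr 3) q =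
      if q = d then slot t (σ.fldArr 3) d + slot t (σ.fldArr 66) 0
      else slot t (σ.fldArr 3) q) := by
  have b1 := hb.slot hdL
  have b4 := hb.le
  have b5 := hb.pos
  have b6 := hb.size
  have b7 := hb.slots
  refine (runs_mulReg (B := B) hd hQ (by omega) (by omega) (by omega) (by omega) (by omega)
    (by omega) (by omega) (by omega)).andThen (by omega) fun τ1 ag1 h1 => ?_
  refine Runs.cons (by simp only [length]; omega) ?_
  simp only [wp, length]
  refine ⟨by omega, Runs.cons (by simp only [length]; omega) ?_⟩
  simp only [wp, length]
  refine (runs_axpyBlock (B := B) (b := d * (2 ^ t * 2 ^ t)) (b' := 0) (c := 1)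
    (Q := 2 ^ t * 2 ^ t) (dst := 3) (src := 66) ?_ (by simpa using h1) (by simp) (by simp)
      (by omega) (by omega) (.inl (by omega))).mono (by omega) fun τ ag hτ q => ?_
  · simp [ag1.nat 6 (by simp [mulReg, forLoop, WritesNat]), hQ]
  · rw [hτ, slot_ite]
    simp only [Memory.fldArr_setFld, Memory.fldArr_setNat]
    rw [ag1.fldArr 3 (by simp [mulReg, forLoop, WritesFldArr]),
      ag1.fldArr 66 (by simp [mulReg, forLoop, WritesFldArr])]
    refine if_congr Iff.rfl ?_ rfl
    ext a b
    simp [slot]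

/-- Add the product of the slots whose numbers are in the registers `16` and `17` to the slot whose
number is in register `15`. -/
def mulAcc (p : Prog) : Prog := copySlot 64 16 ⨾ copySlot 65 17 ⨾ callMul p ⨾ storeSlot 15

lemma isLocal_callMul (p : Prog) : (callMul p).IsLocal :=
  isLocal_seq (isLocal_natConst (by omega)) <| isLocal_seq (isLocal_natAdd (by omega)) <|
  isLocal_shift p

lemma isLocal_copySlot {arr r : ℕ} (h : 3 ≤ arr) : (copySlot arr r).IsLocal :=
  isLocal_seq (isLocal_natConst (by omega)) <| isLocal_seq (isLocal_zeroBlock h) <|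
  isLocal_seq (isLocal_mulReg (by omega)) <| isLocal_seq (isLocal_fldOne _) <|
  isLocal_axpyBlock h

lemma isLocal_storeSlot {r : ℕ} : (storeSlot r).IsLocal :=
  isLocal_seq (isLocal_mulReg (by omega)) <| isLocal_seq (isLocal_natConst (by omega)) <|
  isLocal_seq (isLocal_fldOne _) <| isLocal_axpyBlock (by omega)

lemma isLocal_mulAcc (p : Prog) : (mulAcc p).IsLocal :=
  isLocal_seq (isLocal_copySlot (by omega)) <| isLocal_seq (isLocal_copySlot (by omega)) <|
  isLocal_seq (isLocal_callMul p) isLocal_storeSlot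

/-- Copying and multiplying touch no register from `15` on other than `18`, below `64`. -/
lemma not_writesNat_copySlot {arr r x : ℕ} (h : 14 < x) : ¬(copySlot arr r).WritesNat x := by
  simp only [copySlot, zeroBlock, axpyBlock, mulReg, forLoop, WritesNat, or_false, false_or]
  omega

lemma not_writesNat_storeSlot {r x : ℕ} (h : 14 < x) : ¬(storeSlot r).WritesNat x := by
  simp only [storeSlot, axpyBlock, mulReg, forLoop, WritesNat, or_false, false_or]
  omega

lemma not_writesNat_callMul {p : Prog} {x : ℕ} (h : x < 64) (h' : x ≠ 18) :
    ¬(callMul p).WritesNat x := by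
  have := not_writesNat_shift p h
  simp only [callMul, WritesNat, this, or_false]
  omega

lemma not_writesFldArr_callMul {p : Prog} {x : ℕ} (h : x < 64) :
    ¬(callMul p).WritesFldArr x := by
  have := not_writesFldArr_shift p h
  simp [callMul, WritesFldArr, this]

lemma not_writesNat_mulAcc {p : Prog} {x : ℕ} (h : 14 < x) (h' : x ≠ 18) (h'' : x < 64) :
    ¬(mulAcc p).WritesNat x := by
  have h1 := not_writesNat_copySlot (arr := 64) (r := 16) h
  have h2 := not_writesNat_copySlot (arr := 65) (r := 17) h
  have h3 := not_writesNat_callMul (p := p) h'' h'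
  have h4 := not_writesNat_storeSlot (r := 15) h
  simp only [mulAcc, WritesNat]
  tauto

lemma not_writesFldArr_copySlot {arr r x : ℕ} (h : arr ≠ x) :
    ¬(copySlot arr r).WritesFldArr x := by
  simp only [copySlot, zeroBlock, axpyBlock, mulReg, forLoop, WritesFldArr]
  tauto

theorem runs_mulAcc {p : Prog} {M : ℕ} (hp : Multiplies F p (2 ^ t) M) (hM : M ≤ W)
    (hb : Bounds t L B W) {σ : Memory F} {d q₁ q₂ : ℕ}
    (hN : σ.nat 5 = 2 ^ t) (hQ : σ.nat 6 = 2 ^ t * 2 ^ t) (hd : σ.nat 15 = d)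
    (h₁ : σ.nat 16 = q₁) (h₂ : σ.nat 17 = q₂) (hdL : d < L) (h₁L : q₁ < L) (h₂L : q₂ < L) :
    Runs B (mulAcc p) σ (120 * W) (fun τ => ∀ q, slot t (τ.fldArr 3) q =
      if q = d then slot t (σ.fldArr 3) d + slot t (σ.fldArr 3) q₁ * slot t (σ.fldArr 3) q₂
      else slot t (σ.fldArr 3) q) := by
  have b1 := hb.slot hdL
  have b5 := hb.pos
  have b8 : 2 ^ t ≤ 2 ^ t * 2 ^ t := Nat.le_mul_of_pos_left _ (by positivity)
  refine (runs_copySlot hb (arr := 64) (by omega) (by omega) hQ h₁ h₁L).andThen (by omega)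
    fun τ1 ag1 e1 => ?_
  have s1 := (isLocal_copySlot (by omega)).stable ag1
  refine (runs_copySlot hb (arr := 65) (by omega) (by omega) ((s1.nat 6 (by omega)).trans hQ)
    ((ag1.nat 17 (not_writesNat_copySlot (by omega))).trans h₂) h₂L).andThen (by omega)
    fun τ2 ag2 e2 => ?_
  have s2 := s1.trans ((isLocal_copySlot (by omega)).stable ag2)
  refine (runs_callMul hp ((s2.nat 5 (by omega)).trans hN) (by omega)).andThen (by omega)
    fun τ3 ag3 e3 => ?_
  have s3 := s2.trans ((isLocal_callMul p).stable ag3)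
  refine (runs_storeSlot hb (r := 15) (by omega) ((s3.nat 6 (by omega)).trans hQ) (d := d) ?_
    hdL).mono (by omega) fun τ ag e q => ?_
  · rw [ag3.nat 15 (not_writesNat_callMul (by omega) (by omega)),
      ag2.nat 15 (not_writesNat_copySlot (by omega)),
      ag1.nat 15 (not_writesNat_copySlot (by omega)), hd]
  · have f3 : τ3.fldArr 3 = σ.fldArr 3 := by
      rw [ag3.fldArr 3 (not_writesFldArr_callMul (by omega)),
        ag2.fldArr 3 (not_writesFldArr_copySlot (by omega)),
        ag1.fldArr 3 (not_writesFldArr_copySlot (by omega))]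
    rw [e, e3, e2, ag2.fldArr 64 (not_writesFldArr_copySlot (by omega)), e1,
      ag1.fldArr 3 (not_writesFldArr_copySlot (by omega)), f3]

end Bounds

end Prog

namespace Fock

variable {F : Type*} [Field F]

/-! ### Entries of the matrices of the Clifford map -/

/-- The entries of the matrices of the Clifford map, by the binary expansions of the indices. -/
def cliffEntry (γ : F) (a b : ℕ → F) : ℕ → ℕ → ℕ → F
  | 0, _, _ => γ
  | i + 1, u, v =>
    if u < 2 ^ i then
      if v < 2 ^ i then cliffEntry γ a b i u v else if u = v - 2 ^ i then b i else 0
    else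
      if v < 2 ^ i then if u - 2 ^ i = v then a i else 0
      else -cliffEntry γ a b i (u - 2 ^ i) (v - 2 ^ i)

theorem cliffEntry_pos (γ : F) (a b : ℕ → F) {t : ℕ} (x y : Ix t) :
    cliffEntry γ a b t (pos x) (pos y) = cliff t γ (fun i => a i) (fun i => b i) x y := by
  induction t with
  | zero =>
    have : x = y := Subsingleton.elim (α := Unit) x y
    subst this
    simp [cliffEntry, cliff]
  | succ t ih =>
    have hle : ∀ z : Ix t, ¬2 ^ t + pos z < 2 ^ t := fun z => by omega
    have hs : ∀ z : Ix t, 2 ^ t + pos z - 2 ^ t = pos z := fun z => by omega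
    rcases x with x | x <;> rcases y with y | y <;>
      simp only [pos_inl, pos_inr, cliffEntry, pos_lt, if_true, hle, if_false, hs]
    · exact ih x y
    · change _ = (b t • (1 : Matrix (Ix t) (Ix t) F)) x y
      by_cases h : x = y
      · subst h; simp
      · simp [h, pos_injective.ne h]
    · change _ = (a t • (1 : Matrix (Ix t) (Ix t) F)) x y
      by_cases h : x = y
      · subst h; simp
      · simp [h, pos_injective.ne h]
    · rw [ih x y]; rfl

end Fock

namespace Prog

open Fock

variable {F : Type*} [Field F] {B : ℕ}

lemma not_writesNat_forLoop {i n r : ℕ} {p : Prog} (hi : r ≠ i) (h9 : r ≠ 9)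
    (hp : ¬p.WritesNat r) : ¬(forLoop i n p).WritesNat r := by
  simp only [forLoop, WritesNat]
  rintro (h | h | h | h | h | h) <;> first | omega | exact hp h

/-- If the registers `22` and `23` agree, add to the field register `4` the product of the sign in
the field register `8`, the scalar `sc`, and the entry number `24` of the array; clear the sign. -/
def offDiagonal (arr sc : ℕ) : Prog :=
  natSub 26 22 23 ⨾ natSub 27 23 22 ⨾ natAdd 26 26 27 ⨾
  natIf 26 (fldZero 8) (fldLoad 2 arr 24 ⨾ fldMul 2 2 sc ⨾ fldMul 2 2 8 ⨾ fldAdd 4 4 2 ⨾ fldZero 8)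

/-- Compare the leading bits of the row index (register `22`) and of the column index (register
`23`). Equal bits are removed, with a sign if they are ones; at the first difference, the entry is
that of a scalar matrix. -/
def entryStep : Prog :=
  natConst 28 1 ⨾ natSub 24 24 28 ⨾ natLoad 25 3 24 ⨾ natSub 26 25 22 ⨾ natSub 27 25 23 ⨾
  natIf 26
    (natIf 27 (natConst 28 0) (natSub 23 23 25 ⨾ offDiagonal 5 7))
    (natSub 22 22 25 ⨾ natIf 27 (offDiagonal 4 6)
      (natSub 23 23 25 ⨾ fldZero 2 ⨾ fldSub 8 2 8))

/-- Compute an entry of a matrix of the Clifford map. The row is in register `20` and the column in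
register `21`; the vectors are in the field arrays `4` and `5`, scaled by the field registers `6`
and `7`; the coefficient of the parity operator is in the field register `5`. -/
def entry : Prog :=
  natConst 28 0 ⨾ natAdd 22 20 28 ⨾ natAdd 23 21 28 ⨾ natAdd 24 1 28 ⨾ fldZero 4 ⨾ fldOne 8 ⨾
  forLoop 29 1 entryStep ⨾ fldMul 2 8 5 ⨾ fldAdd 4 4 2

theorem wp_entryStep {t i x y : ℕ} (hB : 2 ^ t + 4 < B) (hi : i < t) {γ α β : F} {a b : ℕ → F}
    {τ : Memory F} (h22 : τ.nat 22 = x) (h23 : τ.nat 23 = y) (h24 : τ.nat 24 = i + 1)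
    (hx : x < 2 ^ t) (hy : y < 2 ^ t)
    (hpow : τ.natArr 3 i = 2 ^ i) (h4 : τ.fldArr 4 = a) (h5 : τ.fldArr 5 = b)
    (h6 : τ.fld 6 = α) (h7 : τ.fld 7 = β) {v : F}
    (hv : τ.fld 4 + τ.fld 8 * cliffEntry γ (fun i => a i * α) (fun i => b i * β) (i + 1) x y = v) :
    wp B entryStep (fun τ => τ.nat 24 = i ∧ τ.nat 22 < 2 ^ t ∧ τ.nat 23 < 2 ^ t ∧
      τ.fld 4 + τ.fld 8 * cliffEntry γ (fun i => a i * α) (fun i => b i * β) i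
        (τ.nat 22) (τ.nat 23) = v) τ := by
  have hp : 2 ^ i ≤ 2 ^ t := Nat.pow_le_pow_right (by omega) hi.le
  have ht : t < 2 ^ t := Nat.lt_two_pow_self
  rw [cliffEntry] at hv
  simp only [entryStep, offDiagonal, wp, Memory.nat_setNat, Memory.natArr_setNat,
    Memory.fldArr_setNat, Memory.fld_setNat, Memory.fld_setFld, Memory.nat_setFld,
    Nat.reduceEqDiff, if_true, if_false, h22, h23, h24, hpow, h4, h5, h6, h7,
    Nat.add_sub_cancel, zero_mul, add_zero]
  have e1 : (2 ^ i - x ≠ 0) = (x < 2 ^ i) := propext (by omega)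
  have e1' : (2 ^ i - x = 0) = ¬(x < 2 ^ i) := propext (by omega)
  have e2 : (2 ^ i - y ≠ 0) = (y < 2 ^ i) := propext (by omega)
  have e2' : (2 ^ i - y = 0) = ¬(y < 2 ^ i) := propext (by omega)
  simp only [e1, e1', e2, e2']
  refine ⟨by omega, by omega, by omega, by omega, by omega, by omega, by omega, by omega, by omega,
    by omega, fun hx' => ?_, fun hx' => ?_⟩
  · simp only [if_pos hx'] at hv
    refine ⟨by omega, fun hy' => ?_, fun hy' => ?_⟩
    · simp only [if_pos hy'] at hv
      exact ⟨by omega, trivial, hx, hy, hv⟩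
    · simp only [if_neg hy'] at hv
      refine ⟨by omega, by omega, by omega, by omega, by omega, by omega, by omega, by omega,
        by omega, fun he => ?_, fun he => ?_⟩
      · rw [if_neg (by omega)] at hv
        exact ⟨trivial, hx, by omega, by simpa using hv⟩
      · rw [if_pos (by omega)] at hv
        refine ⟨by omega, trivial, hx, by omega, ?_⟩
        rw [← hv]; ring
  · simp only [if_neg hx'] at hv
    refine ⟨by omega, by omega, by omega, fun hy' => ?_, fun hy' => ?_⟩
    · simp only [if_pos hy'] at hv
      refine ⟨by omega, by omega, by omega, by omega, by omega, by omega,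
        by omega, fun he => ?_, fun he => ?_⟩
      · rw [if_neg (by omega)] at hv
        exact ⟨trivial, by omega, hy, by simpa using hv⟩
      · rw [if_pos (by omega)] at hv
        refine ⟨by omega, trivial, by omega, hy, ?_⟩
        rw [← hv]; ring
    · simp only [if_neg hy'] at hv
      refine ⟨by omega, by omega, trivial, by omega, by omega, ?_⟩
      rw [← hv]; ring

theorem runs_entry {t u v : ℕ} (hB : 2 ^ t + 4 < B) {γ α β : F} {σ : Memory F}
    (ht : σ.nat 1 = t) (hu : σ.nat 20 = u) (hv : σ.nat 21 = v) (hu' : u < 2 ^ t) (hv' : v < 2 ^ t)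
    (hpow : ∀ i < t, σ.natArr 3 i = 2 ^ i) (h5 : σ.fld 5 = γ) (h6 : σ.fld 6 = α)
    (h7 : σ.fld 7 = β) :
    Runs B entry σ (50 * (t + 1)) (fun τ => τ.fld 4 =
      cliffEntry γ (fun i => σ.fldArr 4 i * α) (fun i => σ.fldArr 5 i * β) t u v) := by
  have htt : t < 2 ^ t := Nat.lt_two_pow_self
  refine Runs.cons (by simp only [length]; omega) ?_
  simp only [wp, length]
  refine ⟨by omega, Runs.cons (by simp only [length]; omega) ?_⟩
  simp only [wp, length, Memory.nat_setNat, Nat.reduceEqDiff, if_true, if_false, hu]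
  refine ⟨by omega, by omega, Runs.cons (by simp only [length]; omega) ?_⟩
  simp only [wp, length, Memory.nat_setNat, Nat.reduceEqDiff, if_true, if_false, hv]
  refine ⟨by omega, by omega, Runs.cons (by simp only [length]; omega) ?_⟩
  simp only [wp, length, Memory.nat_setNat, OfNat.one_ne_ofNat, Nat.reduceEqDiff, if_true, if_false,
    ht]
  refine ⟨by omega, by omega, Runs.cons (by simp only [length]; omega) ?_⟩
  simp only [wp, length]
  refine Runs.cons (by simp only [length]; omega) ?_
  simp only [wp, length]
  refine (Runs.forLoop (B := B) (k := entryStep.length) (len := t) (fun j τ =>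
      τ.nat 24 = t - j ∧ τ.nat 22 < 2 ^ t ∧ τ.nat 23 < 2 ^ t ∧
      τ.fld 4 + τ.fld 8 * cliffEntry γ (fun i => σ.fldArr 4 i * α) (fun i => σ.fldArr 5 i * β)
        (t - j) (τ.nat 22) (τ.nat 23) =
      cliffEntry γ (fun i => σ.fldArr 4 i * α) (fun i => σ.fldArr 5 i * β) t u v)
    (by simp [ht]) (by omega) (by omega) (by omega) (by omega)
    (by simp [entryStep, offDiagonal, WritesNat]) (by simp [entryStep, offDiagonal, WritesNat])
    ?_ ?_ ?_).andThen (by simp only [entryStep, offDiagonal, length]; omega) fun τ1 ag1 h1 => ?_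
  · intro j τ x w hx h
    simp only [Memory.nat_setNat, Memory.fld_setNat]
    rw [if_neg (by omega), if_neg (by omega), if_neg (by omega)]
    exact h
  · simp [hu', hv']
  · intro j hj τ hτ ag ⟨hj1, hj2, hj3, hj4⟩
    refine runs_of_wp ?_
    have e : t - j = t - (j + 1) + 1 := by omega
    refine wp_entryStep hB (show t - (j + 1) < t by omega) rfl rfl (by rw [hj1, e]) hj2 hj3 ?_ ?_ ?_
      ?_ ?_ (by rw [← e]; exact hj4)
    · rw [ag.natArr 3 (by simp [forLoop, entryStep, offDiagonal, WritesNatArr])]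
      exact hpow _ (by omega)
    · rw [ag.fldArr 4 (by simp [forLoop, entryStep, offDiagonal, WritesFldArr])]; simp
    · rw [ag.fldArr 5 (by simp [forLoop, entryStep, offDiagonal, WritesFldArr])]; simp
    · rw [ag.fld 6 (by simp [forLoop, entryStep, offDiagonal, WritesFld])]; simp [h6]
    · rw [ag.fld 7 (by simp [forLoop, entryStep, offDiagonal, WritesFld])]; simp [h7]
  · refine (runs_of_wp ?_).mono (by simp only [entryStep, offDiagonal, length]; omega)
      fun _ _ h => h
    have e5 : τ1.fld 5 = γ := by
      rw [ag1.fld 5 (by simp [forLoop, entryStep, offDiagonal, WritesFld])]; simp [h5]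
    simp only [wp, Memory.fld_setFld, Nat.reduceEqDiff, if_false, if_true, e5]
    simpa only [Nat.sub_self, cliffEntry] using h1.2.2.2

lemma isLocal_entry : entry.IsLocal := by
  refine ⟨fun r hr => ?_, fun r hr => ?_, fun r hr => ?_⟩
  · simp only [entry, forLoop, entryStep, offDiagonal, WritesNat, or_false, false_or]
    omega
  · simp [entry, forLoop, entryStep, offDiagonal, WritesNatArr]
  · simp [entry, forLoop, entryStep, offDiagonal, WritesFldArr]

/-- Write a matrix of the Clifford map to an array, in the conventions of `Prog.entry`. -/
def fill (arr : ℕ) : Prog :=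
  natConst 19 0 ⨾ forLoop 20 5 (forLoop 21 5 (entry ⨾ fldStore arr 19 4 ⨾ natConst 28 1 ⨾
    natAdd 19 19 28))

theorem runs_fill {t L W : ℕ} (hb : Bounds t L B W) (hL : 0 < L) {arr : ℕ} (harr : 5 < arr)
    {γ α β : F} {σ : Memory F}
    (ht : σ.nat 1 = t) (hN : σ.nat 5 = 2 ^ t) (hpow : ∀ i < t, σ.natArr 3 i = 2 ^ i)
    (h5 : σ.fld 5 = γ) (h6 : σ.fld 6 = α) (h7 : σ.fld 7 = β) :
    Runs B (fill arr) σ (70 * ((t + 1) * W)) (fun τ => slot t (τ.fldArr arr) 0 =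
      cliff t γ (fun i => σ.fldArr 4 i * α) (fun i => σ.fldArr 5 i * β)) := by
  have b1 := hb.slot hL
  have b8 : 2 ^ t ≤ 2 ^ t * 2 ^ t := Nat.le_mul_of_pos_left _ (by positivity)
  have bt : t < 2 ^ t := Nat.lt_two_pow_self
  set N := 2 ^ t with hNdef
  -- `E c` is the entry at the position `c` of the matrix
  let E : ℕ → F := fun c => cliffEntry γ (fun i => σ.fldArr 4 i * α) (fun i => σ.fldArr 5 i * β) t
    (c / N) (c % N)
  let body := entry ⨾ fldStore arr 19 4 ⨾ natConst 28 1 ⨾ natAdd 19 19 28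
  let I : ℕ → Memory F → Prop := fun c τ => τ.nat 19 = c ∧ ∀ x < c, τ.fldArr arr x = E x
  have hI : ∀ c τ x v, (x = 20 ∨ x = 21 ∨ x = 9) → I c τ → I c (τ.setNat x v) := by
    rintro c τ x v hx ⟨h1, h2⟩
    exact ⟨by rw [Memory.nat_setNat, if_neg (by omega), h1], h2⟩
  have w1 : ∀ x, x = 1 ∨ x = 5 ∨ x = 20 → ¬body.WritesNat x := by
    intro x hx
    simp only [body, entry, forLoop, entryStep, offDiagonal, WritesNat, or_false, false_or]
    omega
  have w9 : ∀ x, x = 5 → ¬(forLoop 21 5 body).WritesNat x := by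
    intro x hx
    exact not_writesNat_forLoop (by omega) (by omega) (w1 x (by omega))
  have w20 : ¬(forLoop 21 5 body).WritesNat 20 :=
    not_writesNat_forLoop (by omega) (by omega) (w1 20 (by omega))
  have w2 : ¬body.WritesNat 21 := by
    simp [body, entry, forLoop, entryStep, offDiagonal, WritesNat]
  have cost : 1 + (N * (N * (50 * (t + 1) + 3 + 4) + 3 + 4) + 3) ≤ 70 * ((t + 1) * W) := by
    have e1 : (t + 1) * (N * N) ≤ (t + 1) * W := Nat.mul_le_mul_left _ hb.size
    have e2 : N * N ≤ (t + 1) * (N * N) := Nat.le_mul_of_pos_left _ (by omega)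
    have e3 : N * (N * (50 * (t + 1) + 3 + 4) + 3 + 4) =
      50 * ((t + 1) * (N * N)) + 7 * (N * N) + 7 * N := by ring
    omega
  refine Runs.cons (by simp only [length]; omega) ?_
  simp only [wp, length]
  refine ⟨by omega, ?_⟩
  refine (Runs.forLoop (B := B) (k := N * (50 * (t + 1) + 3 + 4) + 3) (len := N)
    (fun j τ => I (j * N) τ) (by simp [hN]) (by omega) (by omega) (by omega)
    (by omega) w20 (w9 5 rfl) (fun j τ x v hx => hI _ τ x v (by tauto)) ⟨by simp, by simp⟩
    ?_).mono (by omega) fun τ _ h => ?_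
  · intro j hj τ hτ ag h
    have g1 : ∀ x, (x = 1 ∨ x = 5) → τ.nat x = σ.nat x := by
      intro x hx
      rw [ag.nat x, Memory.nat_setNat, if_neg (by omega)]
      exact not_writesNat_forLoop (by omega) (by omega)
        (not_writesNat_forLoop (by omega) (by omega) (w1 x (by omega)))
    refine (Runs.forLoop (B := B) (k := 50 * (t + 1) + 3) (len := N)
      (fun l τ => I (j * N + l) τ) ((g1 5 (by omega)).trans hN) (by omega) (by omega) (by omega)
      (by omega) w2 (w1 5 (by omega)) (fun j τ x v hx => hI _ τ x v (by tauto)) h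
      ?_).mono (by omega) fun υ _ h => by rw [add_mul, one_mul]; exact h
    intro l hl υ hυ ag' ⟨e1, e2⟩
    have g3 : υ.natArr 3 = σ.natArr 3 := by
      rw [ag'.natArr 3 (by simp [body, entry, forLoop, entryStep, offDiagonal, WritesNatArr]),
        ag.natArr 3 (by simp [body, entry, forLoop, entryStep, offDiagonal, WritesNatArr])]
      rfl
    have g4 : ∀ r, 4 < r → r < 8 → υ.fld r = σ.fld r := by
      intro r hr hr'
      rw [ag'.fld r, ag.fld r]
      · rfl
      all_goals
        simp only [body, entry, forLoop, entryStep, offDiagonal, WritesFld, or_false, false_or]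
        omega
    have g5 : ∀ r, r < 6 → υ.fldArr r = σ.fldArr r := by
      intro r hr
      rw [ag'.fldArr r, ag.fldArr r]
      · rfl
      all_goals
        simp only [body, entry, forLoop, entryStep, offDiagonal, WritesFldArr, or_false, false_or]
        omega
    have g6 : υ.nat 20 = j := by
      rw [ag'.nat 20, hτ]
      exact not_writesNat_forLoop (by omega) (by omega) (w1 20 (by omega))
    have g7 : υ.nat 1 = t := by
      rw [ag'.nat 1, g1 1 (by omega), ht]
      exact not_writesNat_forLoop (by omega) (by omega) (w1 1 (by omega))
    refine (runs_entry (B := B) (by omega) g7 g6 hυ hj hl (by rw [g3]; exact hpow)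
      ((g4 5 (by omega) (by omega)).trans h5) ((g4 6 (by omega) (by omega)).trans h6)
      ((g4 7 (by omega) (by omega)).trans h7)).andThen (by omega) fun κ agk hk => ?_
    refine (runs_of_wp ?_).mono (by simp only [length]; omega) fun _ _ h => h
    have k19 : κ.nat 19 = j * N + l := by
      rw [agk.nat 19, e1]
      simp [entry, forLoop, entryStep, offDiagonal, WritesNat]
    have karr : κ.fldArr arr = υ.fldArr arr := by
      rw [agk.fldArr arr]
      simp [entry, forLoop, entryStep, offDiagonal, WritesFldArr]
    have hlt : j * N + l < N * N := by
      have := Nat.mul_le_mul_right N (Nat.succ_le_of_lt hj)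
      rw [Nat.succ_eq_add_one, add_mul] at this
      omega
    simp only [wp, Memory.nat_setNat, Memory.nat_setFldArr, Nat.reduceEqDiff, if_false, if_true,
      k19, hk, I, Memory.fldArr_setFldArr, Memory.fldArr_setNat, karr]
    refine ⟨by omega, by omega, by omega, by omega, by omega, fun x hx => ?_⟩
    rw [Function.update_apply]
    split_ifs with hx'
    · simp only [E, hx', g5 4 (by omega), g5 5 (by omega)]
      rw [Nat.mul_comm j N, Nat.mul_add_div (by omega), Nat.mul_add_mod, Nat.div_eq_of_lt hl,
        Nat.mod_eq_of_lt hl, add_zero]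
    · exact e2 x (by omega)
  · ext x y
    have := offset_lt x y
    rw [← cliffEntry_pos _ (fun i => σ.fldArr 4 i * α) (fun i => σ.fldArr 5 i * β)]
    simp only [slot, zero_mul, zero_add]
    rw [h.2 _ this]
    simp only [E]
    rw [Nat.mul_comm (pos x) N, Nat.mul_add_div (by omega), Nat.mul_add_mod,
      Nat.div_eq_of_lt (pos_lt y), Nat.mod_eq_of_lt (pos_lt y), add_zero]

end Prog

namespace Prog

open Fock

variable {F : Type*} {B : ℕ} {t n z : ℕ}
  {A : Matrix (Fin t ⊕ (Fin n ⊕ Fin z)) (Fin t ⊕ (Fin n ⊕ Fin z)) F} {C : Circuit F n}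
  {ρ : Fin n ⊕ Fin z → F}

theorem Stable.holdsInput {σ τ : Memory F} (h : Stable σ τ) (hσ : HoldsInput A C ρ σ) :
    HoldsInput A C ρ τ := by
  unfold HoldsInput
  rw [h.nat 0 (by omega), h.nat 1 (by omega), h.nat 2 (by omega), h.nat 3 (by omega),
    h.natArr 0 (by omega), h.natArr 1 (by omega), h.natArr 2 (by omega), h.fldArr 0 (by omega),
    h.fldArr 1 (by omega), h.fldArr 2 (by omega)]
  exact hσ

/-! ### The numbers computed from the input -/

/-- The memory holds the input and some numbers computed from it: the size of the matrix, the
dimension of the Fock space and its square, the number of coefficients that are kept of a polynomial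
over the Clifford algebra, the number of the first slot that is not used for the elements, and the
powers of two. The degrees up to `t + 1` are kept: degree `t` is the one of interest, and the gate
of a variable needs degree `1` even if `t = 0`. -/
structure Ready (A : Matrix (Fin t ⊕ (Fin n ⊕ Fin z)) (Fin t ⊕ (Fin n ⊕ Fin z)) F)
    (C : Circuit F n) (ρ : Fin n ⊕ Fin z → F) (σ : Memory F) : Prop where
  input : HoldsInput A C ρ σ
  nat4 : σ.nat 4 = t + n + z
  nat5 : σ.nat 5 = 2 ^ t
  nat6 : σ.nat 6 = 2 ^ t * 2 ^ t
  nat7 : σ.nat 7 = t + 2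
  nat8 : σ.nat 8 = t + n + z + 1
  pow : ∀ i < t, σ.natArr 3 i = 2 ^ i

theorem Ready.stable {σ τ : Memory F} (hσ : Ready A C ρ σ) (h : Stable σ τ) :
    Ready A C ρ τ where
  input := h.holdsInput hσ.input
  nat4 := (h.nat 4 (by omega)).trans hσ.nat4
  nat5 := (h.nat 5 (by omega)).trans hσ.nat5
  nat6 := (h.nat 6 (by omega)).trans hσ.nat6
  nat7 := (h.nat 7 (by omega)).trans hσ.nat7
  nat8 := (h.nat 8 (by omega)).trans hσ.nat8
  pow i hi := by rw [h.natArr 3 (by omega)]; exact hσ.pow i hi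

lemma Ready.nat0 {σ : Memory F} (h : Ready A C ρ σ) : σ.nat 0 = n := h.input.1
lemma Ready.nat1 {σ : Memory F} (h : Ready A C ρ σ) : σ.nat 1 = t := h.input.2.1
lemma Ready.nat3 {σ : Memory F} (h : Ready A C ρ σ) : σ.nat 3 = C.last + 1 := h.input.2.2.2.1

variable [Field F]

/-- Compute the numbers of `Prog.Ready`. There is no multiplication of natural numbers: register `5`
is doubled `t` times, while the powers of two are stored, and then added up `2 ^ t` times. -/
def setup : Prog :=
  natAdd 4 1 0 ⨾ natAdd 4 4 2 ⨾ natConst 28 1 ⨾ natAdd 8 4 28 ⨾ natConst 28 2 ⨾ natAdd 7 1 28 ⨾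
  natConst 5 1 ⨾ forLoop 20 1 (natStore 3 20 5 ⨾ natAdd 5 5 5) ⨾ natConst 13 0 ⨾
  forLoop 10 5 (natAdd 13 13 5) ⨾ natConst 28 0 ⨾ natAdd 6 13 28

theorem runs_setup {L W : ℕ} (hb : Bounds t L B W) (hL : t + n + z < L) {σ : Memory F}
    (h : HoldsInput A C ρ σ) : Runs B setup σ (40 * ((t + 1) * W)) (Ready A C ρ) := by
  obtain ⟨h0, h1, h2, h3, hA, hC, hρ⟩ := h
  have b4 := hb.le
  have b1 := hb.slot hL
  have b5 : W ≤ (t + 1) * W := Nat.le_mul_of_pos_left _ (by omega)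
  have b6 : t + 1 ≤ (t + 1) * W := Nat.le_mul_of_pos_right _ hb.pos
  have b7 := hb.size
  have b8 : 2 ^ t ≤ 2 ^ t * 2 ^ t := Nat.le_mul_of_pos_left _ (by positivity)
  have bt : t < 2 ^ t := Nat.lt_two_pow_self
  refine Runs.cons (by simp only [length]; omega) ?_
  simp only [wp, length]
  refine ⟨by omega, by omega, Runs.cons (by simp only [length]; omega) ?_⟩
  simp only [wp, length, Memory.nat_setNat, Nat.reduceEqDiff, if_true, if_false, h0, h1, h2]
  refine ⟨by omega, by omega, Runs.cons (by simp only [length]; omega) ?_⟩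
  simp only [wp, length]
  refine ⟨by omega, Runs.cons (by simp only [length]; omega) ?_⟩
  simp only [wp, length, Memory.nat_setNat, Nat.reduceEqDiff, if_true, if_false]
  refine ⟨by omega, by omega, Runs.cons (by simp only [length]; omega) ?_⟩
  simp only [wp, length]
  refine ⟨by omega, Runs.cons (by simp only [length]; omega) ?_⟩
  simp only [wp, length, Memory.nat_setNat, Nat.reduceEqDiff, OfNat.one_ne_ofNat, if_true,
    if_false, h1]
  refine ⟨by omega, by omega, Runs.cons (by simp only [length]; omega) ?_⟩
  simp only [wp, length]
  refine ⟨by omega, ?_⟩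
  refine (Runs.forLoop (B := B) (k := 2) (len := t) (fun j τ => τ.nat 5 = 2 ^ j ∧
      ∀ i < j, τ.natArr 3 i = 2 ^ i) (by simp [h1]) (by omega) (by omega) (by omega) (by omega)
      (by simp [WritesNat]) (by simp [WritesNat]) ?_ (by simp) ?_).andThen (by omega)
      fun τ1 ag1 ⟨h5, hpow⟩ => ?_
  · intro j τ x v hx ⟨e1, e2⟩
    exact ⟨by rw [Memory.nat_setNat, if_neg (by omega), e1], e2⟩
  · intro j hj τ hτ ag ⟨e1, e2⟩
    refine runs_of_wp ?_
    have : 2 ^ j ≤ 2 ^ t := Nat.pow_le_pow_right (by omega) hj.le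
    simp only [wp, hτ, e1, Memory.nat_setNatArr, Memory.nat_setNat, if_true, Memory.natArr_setNat,
      Memory.natArr_setNatArr]
    refine ⟨by omega, by omega, by omega, by omega, by omega, fun i hi => ?_⟩
    rw [Function.update_apply]
    split_ifs with hij
    · rw [hij]
    · exact e2 i (by omega)
  refine Runs.cons (by simp only [length]; omega) ?_
  simp only [wp, length]
  refine ⟨by omega, ?_⟩
  refine (Runs.forLoop (B := B) (k := 1) (len := 2 ^ t) (fun j τ => τ.nat 13 = j * 2 ^ t)
      (by simp [h5]) (by omega) (by omega) (by omega) (by omega)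
      (by simp [WritesNat]) (by simp [WritesNat]) ?_ (by simp) ?_).andThen (by omega)
      fun τ2 ag2 h6 => ?_
  · intro j τ x v hx e1
    rw [Memory.nat_setNat, if_neg (by omega), e1]
  · intro j hj τ hτ ag e1
    refine runs_of_wp ?_
    have e5 : τ.nat 5 = 2 ^ t := by
      rw [ag.nat 5 (by simp [forLoop, WritesNat])]
      simp [h5]
    have := Nat.mul_le_mul_right (2 ^ t) (Nat.succ_le_of_lt hj)
    rw [Nat.succ_eq_add_one, add_mul] at this
    simp only [wp, e5, e1, Memory.nat_setNat, if_true, add_mul, one_mul]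
    exact ⟨by omega, by omega, trivial⟩
  refine (runs_of_wp ?_).mono (by simp only [length]; omega) fun _ _ h => h
  simp only [wp, Memory.nat_setNat, Nat.reduceEqDiff, if_true, if_false, h6]
  refine ⟨by omega, by omega, by omega, ?_⟩
  have k1 : ∀ r, r < 9 → r ≠ 5 → τ2.nat r = if r = 7 then t + 2 else if r = 8 then t + n + z + 1
      else if r = 4 then t + n + z else σ.nat r := by
    intro r hr hr5
    rw [ag2.nat r, Memory.nat_setNat, if_neg (by omega), ag1.nat r]
    · simp only [Memory.nat_setNat]
      rw [if_neg (by omega)]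
      refine if_congr Iff.rfl rfl ?_
      rw [if_neg (by omega)]
      refine if_congr Iff.rfl rfl ?_
      rw [if_neg (by omega)]
      split_ifs <;> omega
    all_goals
      simp only [forLoop, WritesNat, false_or]
      omega
  have k2 : ∀ r, r ≠ 3 → τ2.natArr r = σ.natArr r := by
    intro r hr
    rw [ag2.natArr r (by simp [forLoop, WritesNatArr]), Memory.natArr_setNat, ag1.natArr r
      (by simp only [forLoop, WritesNatArr, or_false, false_or]; omega)]
    rfl
  have k3 : τ2.fldArr = σ.fldArr := by
    ext1 r
    rw [ag2.fldArr r (by simp [forLoop, WritesFldArr]), Memory.fldArr_setNat, ag1.fldArr r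
      (by simp [forLoop, WritesFldArr])]
    rfl
  refine ⟨⟨?_, ?_, ?_, ?_, ?_, ?_, ?_⟩, ?_, ?_, ?_, ?_, ?_, ?_⟩
  · simp [k1, h0]
  · simp [k1, h1]
  · simp [k1, h2]
  · simp [k1, h3]
  · intro u v
    simp only [Memory.fldArr_setNat, k3]
    exact hA u v
  · intro i
    simp only [Memory.fldArr_setNat, Memory.natArr_setNat, k3, k2 0 (by omega), k2 1 (by omega),
      k2 2 (by omega)]
    exact hC i
  · simp only [Memory.fldArr_setNat, k3]
    exact hρ
  · simp [k1]
  · simp only [Memory.nat_setNat, Nat.reduceEqDiff, if_false]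
    rw [ag2.nat 5 (by simp [forLoop, WritesNat])]
    simp [h5]
  · simp
  · simp [k1]
  · simp [k1]
  · simp only [Memory.natArr_setNat]
    rw [ag2.natArr 3 (by simp [forLoop, WritesNatArr])]
    exact hpow

/-! ### The operators of the elements -/

/-- Write the two vectors of the element whose number is in register `30` to the field arrays `4`
and `5`; the field register `5` is zero. One number behind the last element, the vectors are zero
and the field register is one. -/
def prep : Prog :=
  natSub 31 4 30 ⨾ natSub 32 1 30 ⨾
  natIf 31 (fldZero 5 ⨾ natIf 32 (fldOne 10 ⨾ fldZero 11) (natSub 33 30 1 ⨾ fldLoad 10 2 33 ⨾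
    fldOne 11)) (fldOne 5 ⨾ fldZero 10 ⨾ fldZero 11) ⨾
  natConst 28 0 ⨾ natAdd 33 30 28 ⨾
  forLoop 34 1 (fldLoad 2 0 33 ⨾ fldMul 3 10 2 ⨾ fldStore 4 34 3 ⨾ fldMul 3 11 2 ⨾
    fldStore 5 34 3 ⨾ natAdd 33 33 4) ⨾
  natIf 32 (fldOne 2 ⨾ fldStore 5 30 2) (natConst 28 0)

theorem runs_prep {L W : ℕ} (hb : Bounds t L B W) (hL : t + n + z < L) {σ : Memory F}
    (h : Ready A C ρ σ) {κ : ℕ} (hκ : σ.nat 30 = κ) (hκ' : κ ≤ t + n + z) :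
    Runs B prep σ (40 * ((t + 1) * W)) (fun τ =>
      τ.fld 5 = (if κ < t + n + z then 0 else 1) ∧
      (∀ j < t, τ.fldArr 4 j = (if κ < t + n + z then if κ < t then 1 else σ.fldArr 2 (κ - t)
        else 0) * σ.fldArr 0 (j * (t + n + z) + κ)) ∧
      ∀ j < t, τ.fldArr 5 j = if j = κ then 1 else
        (if κ < t + n + z ∧ t ≤ κ then 1 else 0) * σ.fldArr 0 (j * (t + n + z) + κ)) := by
  have b4 := hb.le
  have b6 : t + 1 ≤ (t + 1) * W := Nat.le_mul_of_pos_right _ hb.pos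
  have bt : t < 2 ^ t := Nat.lt_two_pow_self
  have b9 : (t + 1) * (t + n + z) + 4 < B := by
    have e1 : t + 1 ≤ 2 ^ t * 2 ^ t := le_trans bt (Nat.le_mul_of_pos_left _ (by positivity))
    have e2 := Nat.mul_le_mul e1 hL.le
    have e3 := hb.nat
    rw [mul_comm L] at e3
    omega
  rw [add_mul, one_mul] at b9
  set m := t + n + z with hm
  have h1 := h.nat1
  have h4 : σ.nat 4 = m := h.nat4
  let c10 : F := if κ < m then if κ < t then 1 else σ.fldArr 2 (κ - t) else 0
  let c11 : F := if κ < m ∧ t ≤ κ then 1 else 0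
  refine Runs.cons (by simp only [length]; omega) ?_
  simp only [wp, length]
  refine ⟨by omega, by omega, Runs.cons (by simp only [length]; omega) ?_⟩
  simp only [wp, length, Memory.nat_setNat, Nat.reduceEqDiff, OfNat.one_ne_ofNat, if_false, h1, hκ]
  refine ⟨by omega, by omega, ?_⟩
  have first : ∀ τ : Memory F, τ.nat 31 = m - κ → τ.nat 32 = t - κ → τ.nat 30 = κ → τ.nat 1 = t →
      τ.fldArr 2 = σ.fldArr 2 → Runs B (natIf 31 (fldZero 5 ⨾ natIf 32 (fldOne 10 ⨾ fldZero 11)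
        (natSub 33 30 1 ⨾ fldLoad 10 2 33 ⨾ fldOne 11)) (fldOne 5 ⨾ fldZero 10 ⨾ fldZero 11)) τ 11
        (fun υ => υ.fld 5 = (if κ < m then 0 else 1) ∧ υ.fld 10 = c10 ∧ υ.fld 11 = c11) := by
    intro τ e31 e32 e30 e1 e2
    refine (runs_of_wp ?_).mono (by simp only [length]; omega) fun _ _ h => h
    simp only [wp, e31, e32, e30, e1, e2, Memory.nat_setFld, Memory.nat_setNat, Memory.fld_setFld,
      Memory.fldArr_setNat, Memory.fldArr_setFld, Memory.fld_setNat, Nat.reduceEqDiff, if_true,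
      if_false, c10, c11]
    refine ⟨by omega, fun hh => ⟨by omega, fun hh' => ?_, fun hh' => ⟨by omega, by omega, by omega,
      ?_⟩⟩, fun hh => ?_⟩
    · rw [if_pos (by omega), if_pos (by omega), if_pos (by omega), if_neg (by omega)]
      exact ⟨rfl, rfl, rfl⟩
    · rw [if_pos (by omega), if_pos (by omega), if_neg (by omega), if_pos (by omega)]
      exact ⟨rfl, rfl, rfl⟩
    · rw [if_neg (by omega), if_neg (by omega), if_neg (by omega)]
      exact ⟨rfl, rfl, rfl⟩
  refine (first _ (by simp [h4]) (by simp) (by simp [hκ]) (by simp [h1]) (by simp)).andThen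
    (by omega) fun τ1 ag1 ⟨e5, e10, e11⟩ => ?_
  have g1 : ∀ r, r ≠ 33 → τ1.nat r = if r = 32 then t - κ else if r = 31 then m - κ
      else σ.nat r := by
    intro r hr
    rw [ag1.nat r (by simp only [WritesNat, or_false, false_or]; omega)]
    simp [h4]
  have g2 : τ1.fldArr = σ.fldArr := by
    ext1 r
    rw [ag1.fldArr r (by simp [WritesFldArr])]
    rfl
  refine Runs.cons (by simp only [length]; omega) ?_
  simp only [wp, length]
  refine ⟨by omega, Runs.cons (by simp only [length]; omega) ?_⟩
  simp only [wp, length, Memory.nat_setNat, Nat.reduceEqDiff, if_true, if_false,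
    g1 30 (by omega), hκ]
  refine ⟨by omega, by omega, ?_⟩
  refine (Runs.forLoop (B := B) (k := 6) (len := t) (fun j τ => τ.nat 33 = j * m + κ ∧
      (∀ i < j, τ.fldArr 4 i = c10 * σ.fldArr 0 (i * m + κ)) ∧
      ∀ i < j, τ.fldArr 5 i = c11 * σ.fldArr 0 (i * m + κ)) (by simp [g1, h1]) (by omega)
      (by omega) (by omega) (by omega) (by simp [WritesNat]) (by simp [WritesNat]) ?_ (by simp)
      ?_).andThen (by omega) fun τ2 ag2 ⟨f1, f2, f3⟩ => ?_
  · intro j τ x v hx ⟨f1, f2⟩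
    exact ⟨by rw [Memory.nat_setNat, if_neg (by omega), f1], f2⟩
  · intro j hj τ hτ ag ⟨f1, f2, f3⟩
    refine runs_of_wp ?_
    have q1 : τ.nat 4 = m := by
      rw [ag.nat 4 (by simp [forLoop, WritesNat])]
      simp [g1, h4]
    have q2 : τ.fld 10 = c10 := by
      rw [ag.fld 10 (by simp [forLoop, WritesFld])]
      exact e10
    have q3 : τ.fld 11 = c11 := by
      rw [ag.fld 11 (by simp [forLoop, WritesFld])]
      exact e11
    have q4 : τ.fldArr 0 = σ.fldArr 0 := by
      rw [ag.fldArr 0 (by simp [forLoop, WritesFldArr]), ← g2]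
      rfl
    have := Nat.mul_le_mul_right m (Nat.succ_le_of_lt hj)
    rw [Nat.succ_eq_add_one, add_mul] at this
    simp only [wp, hτ, f1, q1, q2, q3, q4, Memory.nat_setFld, Memory.nat_setNat,
      Memory.nat_setFldArr, Memory.fld_setFld, Memory.fld_setFldArr, Memory.fldArr_setFld,
      Memory.fldArr_setFldArr, Memory.fldArr_setNat, Nat.reduceEqDiff, if_true, if_false]
    refine ⟨by omega, by omega, by omega, by omega, by omega, by ring, fun i hi => ?_,
      fun i hi => ?_⟩
    · rw [Function.update_apply]
      split_ifs with hij
      · rw [hij]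
      · exact f2 i (by omega)
    · rw [Function.update_apply]
      split_ifs with hij
      · rw [hij]
      · exact f3 i (by omega)
  have g3 : ∀ r, r = 30 ∨ r = 32 → τ2.nat r = τ1.nat r := by
    intro r hr
    rw [ag2.nat r (by simp only [forLoop, WritesNat, false_or]; omega)]
    simp only [Memory.nat_setNat]
    rw [if_neg (by omega), if_neg (by omega)]
  have g4 : τ2.fld 5 = if κ < m then 0 else 1 := by
    rw [ag2.fld 5 (by simp [forLoop, WritesFld])]
    exact e5
  refine (runs_of_wp ?_).mono (by simp only [length]; omega) fun _ _ h => h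
  simp only [wp, g3 32 (by omega), g3 30 (by omega), g1 32 (by omega), g1 30 (by omega),
    Memory.nat_setFld, Memory.fld_setFld, Memory.fld_setNat, Memory.fldArr_setNat,
    Memory.fldArr_setFldArr, Memory.fld_setFldArr, Memory.fldArr_setFld, Nat.reduceEqDiff, if_true,
    if_false, hκ, g4]
  refine ⟨by omega, fun hh => ⟨by omega, trivial, f2, fun j hj => ?_⟩,
    fun hh => ⟨by omega, trivial, f2,
    fun j hj => ?_⟩⟩
  · rw [Function.update_apply]
    exact if_congr Iff.rfl rfl (f3 j hj)
  · rw [if_neg (by omega)]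
    exact f3 j hj

end Prog

namespace Prog

open Fock

variable {F : Type*} [Field F] {B : ℕ} {t n z : ℕ}
  {A : Matrix (Fin t ⊕ (Fin n ⊕ Fin z)) (Fin t ⊕ (Fin n ⊕ Fin z)) F} {C : Circuit F n}
  {ρ : Fin n ⊕ Fin z → F}

lemma isLocal_fill {arr : ℕ} (h : 3 ≤ arr) : (fill arr).IsLocal :=
  isLocal_seq (isLocal_natConst (by omega)) <| isLocal_forLoop (by omega) <|
  isLocal_forLoop (by omega) <| isLocal_seq isLocal_entry <| isLocal_seq (isLocal_fldStore h) <|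
  isLocal_seq (isLocal_natConst (by omega)) <| isLocal_natAdd (by omega)

lemma not_writesNat_fill {arr x : ℕ} (h : 29 < x) : ¬(fill arr).WritesNat x := by
  simp only [fill, entry, forLoop, entryStep, offDiagonal, WritesNat, or_false, false_or]
  omega

lemma not_writesFld_fill {arr x : ℕ} (h : 4 < x) (h' : x < 8) : ¬(fill arr).WritesFld x := by
  simp only [fill, entry, forLoop, entryStep, offDiagonal, WritesFld, or_false, false_or]
  omega

lemma not_writesFldArr_fill {arr x : ℕ} (h : arr ≠ x) : ¬(fill arr).WritesFldArr x := by
  simp only [fill, entry, forLoop, entryStep, offDiagonal, WritesFldArr, or_false, false_or]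
  exact h

lemma not_writesNat_zeroSlot {x : ℕ} (h : 14 < x) : ¬zeroSlot.WritesNat x := by
  simp only [zeroSlot, zeroBlock, mulReg, forLoop, WritesNat, or_false]
  omega

lemma not_writesFldArr_zeroSlot {x : ℕ} (h : 3 ≠ x) : ¬zeroSlot.WritesFldArr x := by
  simp only [zeroSlot, zeroBlock, mulReg, forLoop, WritesFldArr, or_false, false_or]
  exact h

lemma not_writesNat_addSlot {x : ℕ} (h : 14 < x) : ¬addSlot.WritesNat x := by
  simp only [addSlot, axpyBlock, mulReg, forLoop, WritesNat, or_false, false_or]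
  omega

/-- Write the operator with the vectors in the field arrays `4` and `5` to the slot whose number is
in register `30`. If the field register `5` is one and the vectors are zero, this is the square of
the parity operator, the identity. -/
def genPair (p : Prog) : Prog :=
  fldZero 6 ⨾ fldOne 7 ⨾ fill 64 ⨾ fldOne 6 ⨾ fldZero 7 ⨾ fill 65 ⨾ callMul p ⨾
  natConst 28 0 ⨾ natAdd 15 30 28 ⨾ zeroSlot ⨾ storeSlot 30

theorem runs_genPair {L W M : ℕ} (hb : Bounds t L B W) {p : Prog}
    (hp : Multiplies F p (2 ^ t) M) (hM : M ≤ W) {σ : Memory F} (h : Ready A C ρ σ) {κ : ℕ}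
    (hκ : σ.nat 30 = κ) (hκL : κ < L) {γ : F} {a b : Fin t → F} (h5 : σ.fld 5 = γ)
    (ha : ∀ i : Fin t, σ.fldArr 4 i = a i) (hb' : ∀ i : Fin t, σ.fldArr 5 i = b i) :
    Runs B (genPair p) σ (250 * ((t + 1) * W)) (fun τ => ∀ q, slot t (τ.fldArr 3) q =
      if q = κ then cliff t γ 0 b * cliff t γ a 0 else slot t (σ.fldArr 3) q) := by
  have b4 := hb.le
  have b1 := hb.slot hκL
  have b5 : W ≤ (t + 1) * W := Nat.le_mul_of_pos_left _ (by omega)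
  have b6 : t + 1 ≤ (t + 1) * W := Nat.le_mul_of_pos_right _ hb.pos
  have b8 : 2 ^ t ≤ 2 ^ t * 2 ^ t := Nat.le_mul_of_pos_left _ (by positivity)
  refine Runs.cons (by simp only [length]; omega) ?_
  simp only [wp, length]
  refine Runs.cons (by simp only [length]; omega) ?_
  simp only [wp, length]
  refine (runs_fill (B := B) (σ := (σ.setFld 6 0).setFld 7 1) hb (by omega) (arr := 64) (by omega)
    (γ := γ) (α := 0) (β := 1) (by simp [h.nat1]) (by simp [h.nat5]) (by simpa using h.pow)
    (by simp [h5]) (by simp) (by simp)).andThen (by omega) fun τ1 ag1 h1 => ?_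
  have s1 : Stable σ τ1 :=
    Stable.trans (τ := (σ.setFld 6 0).setFld 7 1) ⟨fun _ _ => rfl, fun _ _ => rfl, fun _ _ => rfl⟩
      ((isLocal_fill (arr := 64) (by omega)).stable ag1)
  have r1 := h.stable s1
  refine Runs.cons (by simp only [length]; omega) ?_
  simp only [wp, length]
  refine Runs.cons (by simp only [length]; omega) ?_
  simp only [wp, length]
  refine (runs_fill (B := B) (σ := (τ1.setFld 6 1).setFld 7 0) hb (by omega) (arr := 65) (by omega)
    (γ := γ) (α := 1) (β := 0) (by simp [r1.nat1]) (by simp [r1.nat5]) (by simpa using r1.pow)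
    ?_ (by simp) (by simp)).andThen (by omega) fun τ2 ag2 h2 => ?_
  · simp only [Memory.fld_setFld, Nat.reduceEqDiff, if_false]
    rw [ag1.fld 5 (not_writesFld_fill (by omega) (by omega))]
    simp [h5]
  have s2 : Stable σ τ2 :=
    (s1.trans (υ := (τ1.setFld 6 1).setFld 7 0)
      ⟨fun _ _ => rfl, fun _ _ => rfl, fun _ _ => rfl⟩).trans
      ((isLocal_fill (arr := 65) (by omega)).stable ag2)
  have r2 := h.stable s2
  have q1 : slot t (τ2.fldArr 64) 0 = cliff t γ 0 b := by
    rw [ag2.fldArr 64 (not_writesFldArr_fill (by omega))]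
    refine h1.trans ?_
    simp only [mul_zero, mul_one]
    congr 1
    ext i
    exact hb' i
  have q2 : slot t (τ2.fldArr 65) 0 = cliff t γ a 0 := by
    rw [h2]
    simp only [mul_zero, mul_one]
    congr 1
    ext i
    rw [Memory.fldArr_setFld, Memory.fldArr_setFld,
      ag1.fldArr 4 (not_writesFldArr_fill (by omega))]
    exact ha i
  refine (runs_callMul hp r2.nat5 (by omega)).andThen (by omega) fun τ3 ag3 h3 => ?_
  have s3 : Stable σ τ3 := s2.trans ((isLocal_callMul p).stable ag3)
  have r3 := h.stable s3
  have e30 : τ3.nat 30 = κ := by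
    rw [ag3.nat 30 (not_writesNat_callMul (by omega) (by omega)),
      ag2.nat 30 (not_writesNat_fill (by omega))]
    simp only [Memory.nat_setFld]
    rw [ag1.nat 30 (not_writesNat_fill (by omega))]
    simpa using hκ
  refine Runs.cons (by simp only [length]; omega) ?_
  simp only [wp, length]
  refine ⟨by omega, Runs.cons (by simp only [length]; omega) ?_⟩
  simp only [wp, length, Memory.nat_setNat, Nat.reduceEqDiff, if_true, if_false, e30]
  refine ⟨by omega, by omega, ?_⟩
  refine (runs_zeroSlot hb (σ := (τ3.setNat 28 0).setNat 15 (κ + 0)) (d := κ) (by simp [r3.nat6])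
    (by simp) hκL).andThen (by omega) fun τ4 ag4 h4 => ?_
  refine (runs_storeSlot hb (r := 30) (d := κ) (by omega) ?_ ?_ hκL).mono (by omega)
    fun τ ag hτ q => ?_
  · rw [ag4.nat 6 (isLocal_zeroSlot.1 6 (by omega))]
    simp [r3.nat6]
  · rw [ag4.nat 30 (not_writesNat_zeroSlot (by omega))]
    simp [e30]
  · rw [hτ, h4 κ, h4 q, if_pos rfl, zero_add, ag4.fldArr 66 (not_writesFldArr_zeroSlot (by omega))]
    refine if_ctx_congr Iff.rfl (fun _ => ?_) fun hq => ?_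
    · simp only [Memory.fldArr_setNat]
      rw [h3, q1, q2]
    · rw [if_neg hq]
      simp only [Memory.fldArr_setNat]
      rw [ag3.fldArr 3 (not_writesFldArr_callMul (by omega)),
        ag2.fldArr 3 (not_writesFldArr_fill (by omega)), Memory.fldArr_setFld, Memory.fldArr_setFld,
        ag1.fldArr 3 (not_writesFldArr_fill (by omega)), Memory.fldArr_setFld, Memory.fldArr_setFld]

lemma isLocal_prep : prep.IsLocal := by
  refine ⟨fun r hr => ?_, fun r hr => ?_, fun r hr => ?_⟩
  · simp only [prep, forLoop, WritesNat, or_false, false_or]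
    omega
  · simp [prep, forLoop, WritesNatArr]
  · simp only [prep, forLoop, WritesFldArr, or_false, false_or]
    omega

lemma isLocal_genPair (p : Prog) : (genPair p).IsLocal :=
  isLocal_seq (isLocal_fldZero _) <| isLocal_seq (isLocal_fldOne _) <|
  isLocal_seq (isLocal_fill (by omega)) <| isLocal_seq (isLocal_fldOne _) <|
  isLocal_seq (isLocal_fldZero _) <| isLocal_seq (isLocal_fill (by omega)) <|
  isLocal_seq (isLocal_callMul p) <| isLocal_seq (isLocal_natConst (by omega)) <|
  isLocal_seq (isLocal_natAdd (by omega)) <| isLocal_seq isLocal_zeroSlot isLocal_storeSlot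

/-- Write the operators of the elements to the slots with their numbers, and the identity behind
them. -/
def buildPairs (p : Prog) : Prog := forLoop 30 8 (prep ⨾ genPair p)

lemma isLocal_buildPairs (p : Prog) : (buildPairs p).IsLocal :=
  isLocal_forLoop (by omega) (isLocal_seq isLocal_prep (isLocal_genPair p))

/-- The slots hold the operators of the elements with numbers below `c`, and the identity behind
them. -/
def HoldsPairs (A : Matrix (Fin t ⊕ (Fin n ⊕ Fin z)) (Fin t ⊕ (Fin n ⊕ Fin z)) F)
    (ρ : Fin n ⊕ Fin z → F) (c : ℕ) (f : ℕ → F) : Prop :=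
  (∀ e : Fin t ⊕ (Fin n ⊕ Fin z), position e < c →
    slot t f (position e) = pairOp (elementPair A ρ e)) ∧
  (t + n + z < c → slot t f (t + n + z) = 1)

lemma position_lt (e : Fin t ⊕ (Fin n ⊕ Fin z)) : position e < t + n + z := by
  rcases e with e | e | e <;> simp only [position] <;> omega

theorem runs_buildPairs {L W M : ℕ} (hb : Bounds t L B W) (hL : t + n + z < L) {p : Prog}
    (hp : Multiplies F p (2 ^ t) M) (hM : M ≤ W) {σ : Memory F} (h : Ready A C ρ σ) :
    Runs B (buildPairs p) σ ((t + n + z + 1) * (300 * ((t + 1) * W)) + 3) (fun τ =>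
      HoldsPairs A ρ (t + n + z + 1) (τ.fldArr 3)) := by
  have b4 := hb.le
  have b6 : t + 1 ≤ (t + 1) * W := Nat.le_mul_of_pos_right _ hb.pos
  have loc := isLocal_seq isLocal_prep (isLocal_genPair p)
  have w30 : ¬(prep ⨾ genPair p).WritesNat 30 := by
    have h1 := not_writesNat_fill (arr := 64) (x := 30) (by omega)
    have h2 := not_writesNat_fill (arr := 65) (x := 30) (by omega)
    have h3 := not_writesNat_callMul (p := p) (x := 30) (by omega) (by omega)
    have h4 := not_writesNat_zeroSlot (x := 30) (by omega)
    have h5 := not_writesNat_storeSlot (r := 30) (x := 30) (by omega)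
    simp [genPair, prep, forLoop, WritesNat, h1, h2, h3, h4, h5]
  refine (Runs.forLoop (B := B) (k := 40 * ((t + 1) * W) + 250 * ((t + 1) * W))
    (len := t + n + z + 1) (fun j τ => HoldsPairs A ρ j (τ.fldArr 3)) h.nat8
    (by omega) (by omega) (by omega) (by omega) w30 (loc.1 8 (by omega))
    (fun _ _ _ _ _ h => h) ⟨fun e he => absurd he (by omega), fun he => absurd he (by omega)⟩
    ?_).mono ?_ fun _ _ h => h
  · intro κ hκ τ hτ ag ⟨i1, i2⟩
    have r := h.stable ((isLocal_forLoop (by omega) loc).stable ag)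
    have hin := r.input
    obtain ⟨-, -, -, -, hA, -, hρ1, hρ2⟩ := hin
    refine (runs_prep hb hL r hτ (by omega)).seq fun τ1 ag1 ⟨e1, e2, e3⟩ => ?_
    have r1 := r.stable (isLocal_prep.stable ag1)
    have g3 : τ1.fldArr 3 = τ.fldArr 3 := ag1.fldArr 3 (by simp [prep, forLoop, WritesFldArr])
    have g30 : τ1.nat 30 = κ := by
      rw [ag1.nat 30 (by simp [prep, forLoop, WritesNat]), hτ]
    refine (runs_genPair hb hp hM r1 g30 (by omega) e1 (a := fun i => τ1.fldArr 4 i)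
      (b := fun i => τ1.fldArr 5 i) (fun _ => rfl) (fun _ => rfl)).mono le_rfl fun υ _ hυ =>
      ⟨fun e he => ?_, fun hs => ?_⟩
    · rw [hυ, g3]
      by_cases heκ : position e = κ
      · subst heκ
        have hlt := position_lt e
        have c1 : ∀ j : Fin t, τ.fldArr 0 (j * (t + n + z) + position e) = A (.inl j) e :=
          fun j => hA (.inl j) e
        rw [if_pos rfl, if_pos hlt, pairOp, annih, create]
        rcases e with i | v
        · have hi : position (Sum.inl i : Fin t ⊕ (Fin n ⊕ Fin z)) < t := i.isLt
          have hn : ¬(position (Sum.inl i : Fin t ⊕ (Fin n ⊕ Fin z)) < t + n + z ∧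
              t ≤ position (Sum.inl i : Fin t ⊕ (Fin n ⊕ Fin z))) := by omega
          congr 2
          · ext j
            rw [e3 j j.isLt, if_neg hn, zero_mul]
            simp only [elementPair, Pi.single_apply]
            exact if_congr (by simp [position, Fin.ext_iff]) rfl rfl
          · ext j
            rw [e2 j j.isLt, c1, if_pos hlt, if_pos hi, one_mul]
            rfl
        · have hge : t ≤ position (t := t) (Sum.inr v) := by
            rcases v with v | v <;> simp only [position] <;> omega
          have hρv : τ.fldArr 2 (position (t := t) (Sum.inr v) - t) = ρ v := by
            rcases v with v | v
            · rw [← hρ1 v]; simp [position]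
            · rw [← hρ2 v]; simp [position, add_assoc]
          congr 2
          · ext j
            rw [e3 j j.isLt, c1, if_neg (by omega), if_pos ⟨hlt, hge⟩, one_mul]
            rfl
          · ext j
            rw [e2 j j.isLt, c1, if_pos hlt, if_neg (by omega), hρv]
            rfl
      · rw [if_neg heκ]
        exact i1 e (by omega)
    · have hκs : κ = t + n + z := by omega
      rw [hυ, if_pos hκs.symm, if_neg (by omega)]
      have z1 : (fun i : Fin t => τ1.fldArr 4 i) = 0 := by
        ext j
        rw [e2 j j.isLt, if_neg (by omega), zero_mul]
        rfl
      have z2 : (fun i : Fin t => τ1.fldArr 5 i) = 0 := by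
        ext j
        rw [e3 j j.isLt, if_neg (by omega), if_neg (by omega), zero_mul]
        rfl
      rw [z1, z2]
      exact parity_mul_parity t
  · have e : 40 * ((t + 1) * W) + 250 * ((t + 1) * W) + 4 ≤ 300 * ((t + 1) * W) := by omega
    have := Nat.mul_le_mul_left (t + n + z + 1) e
    omega

end Prog

namespace Prog

open Fock

variable {F : Type*} [Field F] {B : ℕ} {t n z : ℕ}
  {A : Matrix (Fin t ⊕ (Fin n ⊕ Fin z)) (Fin t ⊕ (Fin n ⊕ Fin z)) F} {C : Circuit F n}
  {ρ : Fin n ⊕ Fin z → F}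

/-! ### The gates -/

/-- Clear the slots of the current gate, which begin at the number in register `36`. -/
def clearGate : Prog := forLoop 37 7 (natAdd 15 36 37 ⨾ zeroSlot)

/-- A variable: the coefficient of degree one is the operator of the variable. -/
def varGate : Prog :=
  fldOne 1 ⨾ natLoad 39 1 35 ⨾ natAdd 16 1 39 ⨾ natConst 28 1 ⨾ natAdd 15 36 28 ⨾ addSlot

/-- A constant: the coefficient of degree zero is a multiple of the identity. -/
def constGate : Prog :=
  fldLoad 1 1 35 ⨾ natConst 28 0 ⨾ natAdd 15 36 28 ⨾ natAdd 16 4 28 ⨾ addSlot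

/-- Find the slots of the arguments of the current gate. -/
def loadArgs : Prog :=
  natLoad 39 1 35 ⨾ mulReg 40 39 7 ⨾ natAdd 40 40 8 ⨾
  natLoad 39 2 35 ⨾ mulReg 41 39 7 ⨾ natAdd 41 41 8

/-- Add the coefficients of the arguments. -/
def addGate : Prog :=
  fldOne 1 ⨾ forLoop 37 7 (natAdd 15 36 37 ⨾ natAdd 16 40 37 ⨾ addSlot ⨾ natAdd 16 41 37 ⨾ addSlot)

/-- Add the products of coefficients of the arguments up to the truncation degree, one product of
matrices for each pair of degrees. -/
def mulGate (p : Prog) : Prog :=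
  forLoop 37 7 (forLoop 42 7 (natAdd 43 37 42 ⨾ natSub 44 7 43 ⨾
    natIf 44 (natAdd 15 36 43 ⨾ natAdd 16 40 37 ⨾ natAdd 17 41 42 ⨾ mulAcc p) (natConst 28 0)))

theorem runs_clearGate {L W : ℕ} (hb : Bounds t L B W) {σ : Memory F} (h : Ready A C ρ σ) {b : ℕ}
    (h36 : σ.nat 36 = b) (hbL : b + (t + 2) ≤ L) :
    Runs B clearGate σ (30 * ((t + 2) * W)) (fun τ =>
      (∀ x < t + 2, slot t (τ.fldArr 3) (b + x) = 0) ∧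
      ∀ q < b, slot t (τ.fldArr 3) q = slot t (σ.fldArr 3) q) := by
  have b4 := hb.le
  have b5 := hb.pos
  have loc : (natAdd 15 36 37 ⨾ zeroSlot).IsLocal :=
    isLocal_seq (isLocal_natAdd (by omega)) isLocal_zeroSlot
  have w : ∀ r, r = 36 ∨ r = 37 → ¬(natAdd 15 36 37 ⨾ zeroSlot).WritesNat r := by
    intro r hr hw
    rcases hw with hw | hw
    · simp only [WritesNat] at hw
      omega
    · exact not_writesNat_zeroSlot (by omega) hw
  refine (Runs.forLoop (B := B) (k := 20 * W + 1) (len := t + 2) (fun j τ =>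
      (∀ x < j, slot t (τ.fldArr 3) (b + x) = 0) ∧
      ∀ q < b, slot t (τ.fldArr 3) q = slot t (σ.fldArr 3) q) h.nat7 (by omega) (by omega)
      (by omega) (by omega) (w 37 (by omega)) (loc.1 7 (by omega)) (fun _ _ _ _ _ h => h)
      ⟨by omega, fun _ _ => rfl⟩ ?_).mono ?_ fun _ _ h => h
  · intro j hj τ hτ ag ⟨i1, i2⟩
    have r := h.stable ((isLocal_forLoop (by omega) loc).stable ag)
    have e36 : τ.nat 36 = b := by
      rw [ag.nat 36 (not_writesNat_forLoop (by omega) (by omega) (w 36 (by omega))), h36]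
    refine Runs.cons (by simp only [length]; omega) ?_
    simp only [wp, length, hτ, e36]
    refine ⟨by omega, by omega, ?_⟩
    refine (runs_zeroSlot hb (σ := τ.setNat 15 (b + j)) (d := b + j) (by simp [r.nat6]) (by simp)
      (by omega)).mono (by omega) fun υ _ hυ => ⟨fun x hx => ?_, fun q hq => ?_⟩
    · rw [hυ]
      split_ifs with hx'
      · rfl
      · exact i1 x (by omega)
    · rw [hυ, if_neg (by omega)]
      exact i2 q hq
  · have : (t + 2) * (20 * W + 1 + 4) + 3 ≤ (t + 2) * (20 * W + 1 + 4) + (t + 2) * 3 := by omega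
    have e : 20 * W + 1 + 4 + 3 ≤ 30 * W := by omega
    have := Nat.mul_le_mul_left (t + 2) e
    rw [mul_add] at this
    have e2 : (t + 2) * (30 * W) = 30 * ((t + 2) * W) := by ring
    omega

theorem runs_varGate {L W : ℕ} (hb : Bounds t L B W) {σ : Memory F} (h : Ready A C ρ σ) {b g v : ℕ}
    (h35 : σ.nat 35 = g) (h36 : σ.nat 36 = b) (hg : g ≤ B) (hv : σ.natArr 1 g = v)
    (hvb : t + v < b) (hbL : b + 1 < L) :
    Runs B varGate σ (50 * W) (fun τ => ∀ q, slot t (τ.fldArr 3) q =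
      if q = b + 1 then slot t (σ.fldArr 3) (b + 1) + slot t (σ.fldArr 3) (t + v)
      else slot t (σ.fldArr 3) q) := by
  have b4 := hb.le
  have b5 := hb.pos
  refine Runs.cons (by simp only [length]; omega) ?_
  simp only [wp, length]
  refine Runs.cons (by simp only [length]; omega) ?_
  simp only [wp, length, Memory.nat_setFld, Memory.natArr_setFld, h35, hv]
  refine ⟨by omega, by omega, Runs.cons (by simp only [length]; omega) ?_⟩
  simp only [wp, length, Memory.nat_setNat, Memory.nat_setFld, if_true, OfNat.one_ne_ofNat,
    if_false, h.nat1]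
  refine ⟨by omega, by omega, Runs.cons (by simp only [length]; omega) ?_⟩
  simp only [wp, length]
  refine ⟨by omega, Runs.cons (by simp only [length]; omega) ?_⟩
  simp only [wp, length, Memory.nat_setNat, Memory.nat_setFld, Nat.reduceEqDiff, if_true,
    if_false, h36]
  refine ⟨by omega, by omega, ?_⟩
  refine (runs_addSlot (B := B) hb (d := b + 1) (q' := t + v) (c := 1) (by simp [h.nat6]) (by simp)
    (by simp) (by simp) (by omega) (by omega) (by omega)).mono (by omega) fun τ _ hτ q => ?_
  rw [hτ]
  simp

theorem runs_constGate {L W : ℕ} (hb : Bounds t L B W) {σ : Memory F} (h : Ready A C ρ σ)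
    {b g : ℕ} {c : F} (h35 : σ.nat 35 = g) (h36 : σ.nat 36 = b) (hg : g ≤ B)
    (hc : σ.fldArr 1 g = c) (hmb : t + n + z < b) (hbL : b < L) :
    Runs B constGate σ (50 * W) (fun τ => ∀ q, slot t (τ.fldArr 3) q =
      if q = b then slot t (σ.fldArr 3) b + c • slot t (σ.fldArr 3) (t + n + z)
      else slot t (σ.fldArr 3) q) := by
  have b4 := hb.le
  have b5 := hb.pos
  refine Runs.cons (by simp only [length]; omega) ?_
  simp only [wp, length, h35, hc]
  refine ⟨by omega, Runs.cons (by simp only [length]; omega) ?_⟩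
  simp only [wp, length]
  refine ⟨by omega, Runs.cons (by simp only [length]; omega) ?_⟩
  simp only [wp, length, Memory.nat_setNat, Memory.nat_setFld, Nat.reduceEqDiff, if_true,
    if_false, h36]
  refine ⟨by omega, by omega, Runs.cons (by simp only [length]; omega) ?_⟩
  simp only [wp, length, Memory.nat_setNat, Memory.nat_setFld, Nat.reduceEqDiff, if_true,
    if_false, h.nat4]
  refine ⟨by omega, by omega, ?_⟩
  refine (runs_addSlot (B := B) hb (d := b) (q' := t + n + z) (c := c) (by simp [h.nat6]) (by simp)
    (by simp) (by simp) (by omega) (by omega) (by omega)).mono (by omega) fun τ _ hτ q => ?_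
  rw [hτ]
  simp

lemma isLocal_loadArgs : loadArgs.IsLocal :=
  isLocal_seq (isLocal_natLoad (by omega)) <| isLocal_seq (isLocal_mulReg (by omega)) <|
  isLocal_seq (isLocal_natAdd (by omega)) <| isLocal_seq (isLocal_natLoad (by omega)) <|
  isLocal_seq (isLocal_mulReg (by omega)) <| isLocal_natAdd (by omega)

theorem runs_loadArgs {L W : ℕ} (hb : Bounds t L B W) {σ : Memory F} (h : Ready A C ρ σ)
    {g a₁ a₂ : ℕ} (h35 : σ.nat 35 = g) (ha₁ : σ.natArr 1 g = a₁) (ha₂ : σ.natArr 2 g = a₂)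
    (h₁ : a₁ < g) (h₂ : a₂ < g) (hgL : t + n + z + 1 + g * (t + 2) ≤ L) :
    Runs B loadArgs σ (30 * W) (fun τ => τ.nat 40 = t + n + z + 1 + a₁ * (t + 2) ∧
      τ.nat 41 = t + n + z + 1 + a₂ * (t + 2)) := by
  have b4 := hb.le
  have b5 := hb.pos
  have b6 := hb.slots
  have m1 := Nat.mul_le_mul_right (t + 2) h₁.le
  have m2 := Nat.mul_le_mul_right (t + 2) h₂.le
  have m3 : g ≤ g * (t + 2) := Nat.le_mul_of_pos_right _ (by omega)
  refine Runs.cons (by simp only [length]; omega) ?_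
  simp only [wp, length, h35, ha₁]
  refine ⟨by omega, by omega, ?_⟩
  refine (runs_mulReg (B := B) (a := a₁) (b := t + 2) (by simp) (by simp [h.nat7])
    (by omega) (by omega) (by omega) (by omega) (by omega)
    (by omega) (by omega) (by omega)).andThen (by omega) fun τ1 ag1 e1 => ?_
  have k1 : ∀ r, 10 < r → r ≠ 40 → τ1.nat r = (σ.setNat 39 a₁).nat r := fun r hr hr' =>
    ag1.nat r (by simp only [mulReg, forLoop, WritesNat]; omega)
  have k2 : τ1.natArr 2 = σ.natArr 2 := ag1.natArr 2 (by simp [mulReg, forLoop, WritesNatArr])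
  have k3 : ∀ r, r < 9 → τ1.nat r = σ.nat r := fun r hr => by
    rw [ag1.nat r (by simp only [mulReg, forLoop, WritesNat]; omega), Memory.nat_setNat,
      if_neg (by omega)]
  have k35 : τ1.nat 35 = g := by rw [k1 35 (by omega) (by omega)]; simp [h35]
  refine Runs.cons (by simp only [length]; omega) ?_
  simp only [wp, length, e1, k3 8 (by omega), h.nat8]
  refine ⟨by omega, by omega, Runs.cons (by simp only [length]; omega) ?_⟩
  simp only [wp, length, Memory.nat_setNat, Memory.natArr_setNat, Nat.reduceEqDiff, if_false, k35,
    k2, ha₂]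
  refine ⟨by omega, by omega, ?_⟩
  refine (runs_mulReg (B := B) (a := a₂) (b := t + 2) (by simp)
    (by simp [k3 7 (by omega), h.nat7]) (by omega) (by omega) (by omega) (by omega) (by omega)
    (by omega) (by omega) (by omega)).andThen (by omega) fun τ2 ag2 e2 => ?_
  have k4 : τ2.nat 8 = t + n + z + 1 := by
    rw [ag2.nat 8 (by simp [mulReg, forLoop, WritesNat])]
    simp [k3 8 (by omega), h.nat8]
  have k5 : τ2.nat 40 = a₁ * (t + 2) + (t + n + z + 1) := by
    rw [ag2.nat 40 (by simp [mulReg, forLoop, WritesNat])]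
    simp
  refine (runs_of_wp ?_).mono (by simp only [length]; omega) fun _ _ h => h
  simp only [wp, e2, k4, Memory.nat_setNat, Nat.reduceEqDiff, if_true, if_false, k5]
  omega

theorem runs_addGate {L W : ℕ} (hb : Bounds t L B W) {σ : Memory F} (h : Ready A C ρ σ)
    {b q₁ q₂ : ℕ} (h36 : σ.nat 36 = b) (h40 : σ.nat 40 = q₁) (h41 : σ.nat 41 = q₂)
    (h₁ : q₁ + (t + 2) ≤ b) (h₂ : q₂ + (t + 2) ≤ b) (hbL : b + (t + 2) ≤ L) :
    Runs B addGate σ (100 * ((t + 2) * W)) (fun τ =>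
      (∀ x < t + 2, slot t (τ.fldArr 3) (b + x) = slot t (σ.fldArr 3) (b + x) +
        slot t (σ.fldArr 3) (q₁ + x) + slot t (σ.fldArr 3) (q₂ + x)) ∧
      ∀ q < b, slot t (τ.fldArr 3) q = slot t (σ.fldArr 3) q) := by
  have b4 := hb.le
  have b5 := hb.pos
  let body := natAdd 15 36 37 ⨾ natAdd 16 40 37 ⨾ addSlot ⨾ natAdd 16 41 37 ⨾ addSlot
  have loc : body.IsLocal := isLocal_seq (isLocal_natAdd (by omega)) <|
    isLocal_seq (isLocal_natAdd (by omega)) <| isLocal_seq isLocal_addSlot <|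
    isLocal_seq (isLocal_natAdd (by omega)) isLocal_addSlot
  have w : ∀ r, 18 < r → ¬body.WritesNat r := by
    intro r hr
    have := not_writesNat_addSlot (x := r) (by omega)
    rintro (h | h | h | h | h) <;> first | exact this h | (simp only [WritesNat] at h; omega)
  have w1 : ¬body.WritesFld 1 := by
    simp [body, addSlot, mulReg, axpyBlock, forLoop, WritesFld]
  have e0 : 10 ≤ 100 * ((t + 2) * W) := by
    have : 1 ≤ (t + 2) * W := Nat.mul_pos (by omega) (by omega)
    omega
  refine Runs.cons (by simp only [length]; omega) ?_
  simp only [wp, length]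
  refine (Runs.forLoop (B := B) (σ := σ.setFld 1 1) (k := 80 * W + 3) (len := t + 2) (fun j τ =>
      (∀ x < t + 2, slot t (τ.fldArr 3) (b + x) = if x < j then slot t (σ.fldArr 3) (b + x) +
        slot t (σ.fldArr 3) (q₁ + x) + slot t (σ.fldArr 3) (q₂ + x)
        else slot t (σ.fldArr 3) (b + x)) ∧
      ∀ q < b, slot t (τ.fldArr 3) q = slot t (σ.fldArr 3) q) h.nat7 (by omega) (by omega)
      (by omega) (by omega) (w 37 (by omega)) (loc.1 7 (by omega)) (fun _ _ _ _ _ h => h)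
      ⟨fun x hx => by simp, fun _ _ => rfl⟩ ?_).mono ?_ fun τ _ ⟨h1, h2⟩ =>
        ⟨fun x hx => by rw [h1 x hx, if_pos hx], h2⟩
  · intro j hj τ hτ ag ⟨i1, i2⟩
    have r : Ready A C ρ τ := h.stable (Stable.trans (τ := σ.setFld 1 1)
      ⟨fun _ _ => rfl, fun _ _ => rfl, fun _ _ => rfl⟩
      ((isLocal_forLoop (by omega) loc).stable ag))
    have k : ∀ r, 18 < r → r ≠ 37 → τ.nat r = σ.nat r := fun r hr hr' =>
      ag.nat r (not_writesNat_forLoop (by omega) (by omega) (w r hr))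
    have k1 : τ.fld 1 = 1 := by
      rw [ag.fld 1 (by simpa [forLoop, WritesFld] using w1)]
      simp
    refine Runs.cons (by simp only [length]; omega) ?_
    simp only [wp, length, hτ, k 36 (by omega) (by omega), h36]
    refine ⟨by omega, by omega, Runs.cons (by simp only [length]; omega) ?_⟩
    simp only [wp, length, Memory.nat_setNat, Nat.reduceEqDiff, if_false, hτ,
      k 40 (by omega) (by omega), h40]
    refine ⟨by omega, by omega, ?_⟩
    refine (runs_addSlot (B := B) hb (d := b + j) (q' := q₁ + j) (c := 1) (by simp [r.nat6])
      (by simp) (by simp) (by simp [k1]) (by omega) (by omega) (by omega)).andThen (by omega)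
      fun τ1 ag1 e1 => ?_
    have l : ∀ r, 18 < r → τ1.nat r = τ.nat r := by
      intro r hr
      rw [ag1.nat r (not_writesNat_addSlot (by omega)), Memory.nat_setNat, if_neg (by omega),
        Memory.nat_setNat, if_neg (by omega)]
    refine Runs.cons (by simp only [length]; omega) ?_
    simp only [wp, length, l 41 (by omega), l 37 (by omega), k 41 (by omega) (by omega), hτ, h41]
    refine ⟨by omega, by omega, ?_⟩
    refine (runs_addSlot (B := B) hb (d := b + j) (q' := q₂ + j) (c := 1) ?_ ?_ (by simp) ?_
      (by omega) (by omega) (by omega)).mono (by omega) fun υ _ hυ => ?_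
    · simp [ag1.nat 6 (isLocal_addSlot.1 6 (by omega)), r.nat6]
    · simp [ag1.nat 15 (not_writesNat_addSlot (by omega))]
    · simp [ag1.fld 1 (by simp [addSlot, mulReg, axpyBlock, forLoop, WritesFld]), k1]
    · simp only [Memory.fldArr_setNat, one_smul] at hυ e1
      refine ⟨fun x hx => ?_, fun q hq => ?_⟩
      · rw [hυ]
        by_cases hxj : x = j
        · subst hxj
          rw [if_pos rfl, e1, if_pos rfl, e1, if_neg (by omega), i1 x hx, if_neg (by omega),
            i2 _ (by omega), i2 _ (by omega), if_pos (by omega)]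
        · rw [if_neg (by omega), e1, if_neg (by omega), i1 x hx]
          exact if_congr (by omega) rfl rfl
      · rw [hυ, if_neg (by omega), e1, if_neg (by omega), i2 q hq]
  · have e : 80 * W + 3 + 4 + 5 ≤ 100 * W := by omega
    have := Nat.mul_le_mul_left (t + 2) e
    rw [mul_add] at this
    have e2 : (t + 2) * (100 * W) = 100 * ((t + 2) * W) := by ring
    omega

end Prog

namespace Prog

open Fock

variable {F : Type*} [Field F] {B : ℕ} {t n z : ℕ}
  {A : Matrix (Fin t ⊕ (Fin n ⊕ Fin z)) (Fin t ⊕ (Fin n ⊕ Fin z)) F} {C : Circuit F n}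
  {ρ : Fin n ⊕ Fin z → F}

lemma isLocal_mulGate (p : Prog) : (mulGate p).IsLocal :=
  isLocal_forLoop (by omega) <| isLocal_forLoop (by omega) <|
  isLocal_seq (isLocal_natAdd (by omega)) <| isLocal_seq (isLocal_natSub (by omega)) <|
  isLocal_natIf (isLocal_seq (isLocal_natAdd (by omega)) <|
    isLocal_seq (isLocal_natAdd (by omega)) <| isLocal_seq (isLocal_natAdd (by omega)) <|
    isLocal_mulAcc p) (isLocal_natConst (by omega))

theorem runs_mulGate {L W M : ℕ} (hb : Bounds t L B W) {p : Prog} (hp : Multiplies F p (2 ^ t) M)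
    (hM : M ≤ W) {σ : Memory F} (h : Ready A C ρ σ)
    {b q₁ q₂ : ℕ} (h36 : σ.nat 36 = b) (h40 : σ.nat 40 = q₁) (h41 : σ.nat 41 = q₂)
    (h₁ : q₁ + (t + 2) ≤ b) (h₂ : q₂ + (t + 2) ≤ b) (hbL : b + (t + 2) ≤ L) :
    Runs B (mulGate p) σ (150 * ((t + 2) ^ 2 * W)) (fun τ =>
      (∀ x < t + 2, slot t (τ.fldArr 3) (b + x) = slot t (σ.fldArr 3) (b + x) +
        ∑ d ∈ range (t + 2), ∑ e ∈ range (t + 2), if d + e = x then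
          slot t (σ.fldArr 3) (q₁ + d) * slot t (σ.fldArr 3) (q₂ + e) else 0) ∧
      ∀ q < b, slot t (τ.fldArr 3) q = slot t (σ.fldArr 3) q) := by
  have b4 := hb.le
  have b5 := hb.pos
  let body := natAdd 43 37 42 ⨾ natSub 44 7 43 ⨾
    natIf 44 (natAdd 15 36 43 ⨾ natAdd 16 40 37 ⨾ natAdd 17 41 42 ⨾ mulAcc p) (natConst 28 0)
  have loc : body.IsLocal := isLocal_seq (isLocal_natAdd (by omega)) <|
    isLocal_seq (isLocal_natSub (by omega)) <|
    isLocal_natIf (isLocal_seq (isLocal_natAdd (by omega)) <|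
    isLocal_seq (isLocal_natAdd (by omega)) <| isLocal_seq (isLocal_natAdd (by omega)) <|
    isLocal_mulAcc p) (isLocal_natConst (by omega))
  have w : ∀ r, 28 < r → r < 43 → ¬body.WritesNat r := by
    intro r hr hr'
    have := not_writesNat_mulAcc (p := p) (x := r) (by omega) (by omega) (by omega)
    rintro (h | h | (h | h | h | h) | h) <;>
      first | exact this h | (simp only [WritesNat] at h; omega)
  have w' : ∀ r, 28 < r → r < 43 → r ≠ 42 → ¬(forLoop 42 7 body).WritesNat r :=
    fun r hr hr' hr'' => not_writesNat_forLoop (by omega) (by omega) (w r hr hr')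
  let T : ℕ → ℕ → ℕ → Matrix (Ix t) (Ix t) F := fun d e x =>
    if d + e = x then slot t (σ.fldArr 3) (q₁ + d) * slot t (σ.fldArr 3) (q₂ + e) else 0
  let I : ℕ → ℕ → Memory F → Prop := fun j l τ =>
    (∀ x < t + 2, slot t (τ.fldArr 3) (b + x) = slot t (σ.fldArr 3) (b + x) +
      (∑ d ∈ range j, ∑ e ∈ range (t + 2), T d e x + ∑ e ∈ range l, T j e x)) ∧
      ∀ q < b, slot t (τ.fldArr 3) q = slot t (σ.fldArr 3) q
  refine (Runs.forLoop (B := B) (k := (t + 2) * (120 * W + 6 + 4) + 3) (len := t + 2) (fun j τ =>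
      I j 0 τ) h.nat7 (by omega) (by omega)
      (by omega) (by omega) (w' 37 (by omega) (by omega) (by omega))
      ((isLocal_forLoop (by omega) loc).1 7 (by omega)) (fun _ _ _ _ _ h => h)
      ⟨fun x hx => by simp, fun _ _ => rfl⟩ ?_).mono ?_ fun τ _ hτ => by simpa [I, T] using hτ
  · intro j hj τ hτ ag hI
    have r : Ready A C ρ τ := h.stable ((isLocal_mulGate p).stable ag)
    have k : ∀ r, 28 < r → r < 43 → r ≠ 42 → r ≠ 37 → τ.nat r = σ.nat r :=
      fun r hr hr' hr1 hr2 =>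
        ag.nat r (not_writesNat_forLoop hr2 (by omega) (w' r hr hr' hr1))
    refine (Runs.forLoop (B := B) (σ := τ) (k := 120 * W + 6) (len := t + 2) (fun l τ =>
      I j l τ) r.nat7 (by omega) (by omega)
      (by omega) (by omega) (w 42 (by omega) (by omega))
      (loc.1 7 (by omega)) (fun _ _ _ _ _ h => h) hI ?_).mono le_rfl fun τ _ ⟨h1, h2⟩ =>
        ⟨fun x hx => by rw [h1 x hx, range_zero, sum_empty, add_zero, sum_range_succ _ j], h2⟩
    intro l hl υ hυ ag' ⟨i1, i2⟩
    have r' : Ready A C ρ υ := r.stable ((isLocal_forLoop (by omega) loc).stable ag')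
    have k' : ∀ r, 28 < r → r < 43 → r ≠ 42 → υ.nat r = τ.nat r :=
      fun r hr hr' hr1 => ag'.nat r (w' r hr hr' hr1)
    have e37 : υ.nat 37 = j := by rw [k' 37 (by omega) (by omega) (by omega), hτ]
    have e36 : υ.nat 36 = b := by
      rw [k' 36 (by omega) (by omega) (by omega), k 36 (by omega) (by omega) (by omega) (by omega),
        h36]
    have e40 : υ.nat 40 = q₁ := by
      rw [k' 40 (by omega) (by omega) (by omega), k 40 (by omega) (by omega) (by omega) (by omega),
        h40]
    have e41 : υ.nat 41 = q₂ := by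
      rw [k' 41 (by omega) (by omega) (by omega), k 41 (by omega) (by omega) (by omega) (by omega),
        h41]
    refine Runs.cons (by simp only [length]; omega) ?_
    simp only [wp, length, hυ, e37]
    refine ⟨by omega, by omega, Runs.cons (by simp only [length]; omega) ?_⟩
    simp only [wp, length, Memory.nat_setNat, Nat.reduceEqDiff, if_true, if_false, r'.nat7]
    refine ⟨by omega, by omega, ?_⟩
    refine (Runs.natIf (B := B) (k := 120 * W + 3) ?_ ?_ ?_).mono (by omega) fun _ _ h => h
    · simp only [Memory.nat_setNat, if_true]
      omega
    · simp only [Memory.nat_setNat, if_true]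
      intro hlt
      refine Runs.cons (by simp only [length]; omega) ?_
      simp only [wp, length, Memory.nat_setNat, Nat.reduceEqDiff, if_true, if_false, e36]
      refine ⟨by omega, by omega, Runs.cons (by simp only [length]; omega) ?_⟩
      simp only [wp, length, Memory.nat_setNat, Nat.reduceEqDiff, if_false, e37, e40]
      refine ⟨by omega, by omega, Runs.cons (by simp only [length]; omega) ?_⟩
      simp only [wp, length, Memory.nat_setNat, Nat.reduceEqDiff, if_false, hυ, e41]
      refine ⟨by omega, by omega, ?_⟩
      refine (runs_mulAcc (B := B) hp hM hb (d := b + (j + l)) (q₁ := q₁ + j) (q₂ := q₂ + l)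
        (by simp [r'.nat5]) (by simp [r'.nat6]) (by simp) (by simp) (by simp) (by omega) (by omega)
        (by omega)).mono (by omega) fun κ _ hκ => ⟨fun x hx => ?_, fun q hq => ?_⟩
      · simp only [Memory.fldArr_setNat] at hκ
        rw [hκ, i2 (q₁ + j) (by omega), i2 (q₂ + l) (by omega), sum_range_succ _ l]
        by_cases hx' : x = j + l
        · rw [if_pos (by omega), ← hx', i1 x hx]
          simp only [T]
          rw [if_pos hx'.symm, add_assoc, add_assoc]
        · rw [if_neg (by omega), i1 x hx]
          simp only [T]
          rw [if_neg (Ne.symm hx'), add_zero]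
      · rw [hκ, if_neg (by omega)]
        exact i2 q hq
    · simp only [Memory.nat_setNat, if_true]
      intro hge
      refine (runs_of_wp ?_).mono (by simp only [length]; omega) fun _ _ h => h
      simp only [wp]
      refine ⟨by omega, fun x hx => ?_, i2⟩
      rw [sum_range_succ]
      simp only [T]
      rw [if_neg (show j + l ≠ x by omega), add_zero]
      exact i1 x hx
  · have e : 120 * W + 6 + 4 + 7 ≤ 150 * W := by omega
    have e1 := Nat.mul_le_mul_left ((t + 2) ^ 2) e
    have e2 : (t + 2) ^ 2 * (120 * W + 6 + 4 + 7) = (t + 2) * ((t + 2) * (120 * W + 6 + 4)) +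
      (t + 2) * (7 * (t + 2)) := by ring
    have e3 : (t + 2) * ((t + 2) * (120 * W + 6 + 4) + 3 + 4) =
      (t + 2) * ((t + 2) * (120 * W + 6 + 4)) + 7 * (t + 2) := by ring
    have e4 : (t + 2) * (7 * (t + 2)) = 7 * t * t + 28 * t + 28 := by ring
    have e5 : (t + 2) ^ 2 * (150 * W) = 150 * ((t + 2) ^ 2 * W) := by ring
    omega

/-- Compute the slots of the gate whose number is in register `35`. Registers `40` and `41` hold the
first slots of its arguments. -/
def gateStep (p : Prog) : Prog :=
  clearGate ⨾ natLoad 38 0 35 ⨾ natConst 28 1 ⨾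
  natIf 38 (natSub 38 38 28 ⨾
    natIf 38 (loadArgs ⨾ natSub 38 38 28 ⨾ natIf 38 (mulGate p) addGate) constGate) varGate ⨾
  natAdd 36 36 7

/-- The slots of the gates with numbers below `c` hold the coefficients of liftings of the values of
the gates. -/
def HoldsGates (A : Matrix (Fin t ⊕ (Fin n ⊕ Fin z)) (Fin t ⊕ (Fin n ⊕ Fin z)) F)
    (C : Circuit F n) (ρ : Fin n ⊕ Fin z → F) (c : ℕ) (f : ℕ → F) : Prop :=
  ∀ g : Fin (C.last + 1), g < c → ∃ M, (C.value g, M) ∈ liftings A ρ ∧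
    ∀ x < t + 2, slot t f (t + n + z + 1 + g * (t + 2) + x) = M.coeff x

lemma isLocal_clearGate : clearGate.IsLocal :=
  isLocal_forLoop (by omega) (isLocal_seq (isLocal_natAdd (by omega)) isLocal_zeroSlot)

lemma isLocal_varGate : varGate.IsLocal :=
  isLocal_seq (isLocal_fldOne _) <| isLocal_seq (isLocal_natLoad (by omega)) <|
  isLocal_seq (isLocal_natAdd (by omega)) <| isLocal_seq (isLocal_natConst (by omega)) <|
  isLocal_seq (isLocal_natAdd (by omega)) isLocal_addSlot

lemma isLocal_constGate : constGate.IsLocal :=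
  isLocal_seq (isLocal_fldLoad _ _ _) <| isLocal_seq (isLocal_natConst (by omega)) <|
  isLocal_seq (isLocal_natAdd (by omega)) <| isLocal_seq (isLocal_natAdd (by omega))
  isLocal_addSlot

lemma isLocal_addGate : addGate.IsLocal :=
  isLocal_seq (isLocal_fldOne _) <| isLocal_forLoop (by omega) <|
  isLocal_seq (isLocal_natAdd (by omega)) <|
  isLocal_seq (isLocal_natAdd (by omega)) <| isLocal_seq isLocal_addSlot <|
  isLocal_seq (isLocal_natAdd (by omega)) isLocal_addSlot

lemma isLocal_gateStep (p : Prog) : (gateStep p).IsLocal :=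
  isLocal_seq isLocal_clearGate <| isLocal_seq (isLocal_natLoad (by omega)) <|
  isLocal_seq (isLocal_natConst (by omega)) <| isLocal_seq (isLocal_natIf
    (isLocal_seq (isLocal_natSub (by omega)) <| isLocal_natIf
      (isLocal_seq isLocal_loadArgs <| isLocal_seq (isLocal_natSub (by omega)) <|
        isLocal_natIf (isLocal_mulGate p) isLocal_addGate) isLocal_constGate) isLocal_varGate)
    (isLocal_natAdd (by omega))

lemma not_writesNat_clearGate {r : ℕ} (h : 18 < r) (h' : r ≠ 37) : ¬clearGate.WritesNat r := by
  refine not_writesNat_forLoop h' (by omega) ?_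
  rintro (h | h)
  · simp only [WritesNat] at h; omega
  · exact not_writesNat_zeroSlot (by omega) h

lemma not_writesNat_varGate {r : ℕ} (h : 28 < r) (h' : r ≠ 39) : ¬varGate.WritesNat r := by
  have := not_writesNat_addSlot (x := r) (by omega)
  rintro (h | h | h | h | h | h) <;>
    first | exact this h | exact h | (simp only [WritesNat] at h; omega)

lemma not_writesNat_constGate {r : ℕ} (h : 28 < r) : ¬constGate.WritesNat r := by
  have := not_writesNat_addSlot (x := r) (by omega)
  rintro (h | h | h | h | h) <;>
    first | exact this h | exact h | (simp only [WritesNat] at h; omega)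

lemma not_writesNat_loadArgs {r : ℕ} (h : 10 < r) (h' : r < 39 ∨ 41 < r) :
    ¬loadArgs.WritesNat r := by
  simp only [loadArgs, mulReg, forLoop, WritesNat]
  omega

lemma not_writesNat_addGate {r : ℕ} (h : 18 < r) (h' : r ≠ 37) : ¬addGate.WritesNat r := by
  have := not_writesNat_addSlot (x := r) (by omega)
  rintro (h | h)
  · exact h
  · refine not_writesNat_forLoop h' (by omega) ?_ h
    rintro (h | h | h | h | h) <;> first | exact this h | (simp only [WritesNat] at h; omega)

lemma not_writesNat_mulGate {p : Prog} {r : ℕ} (h : 28 < r) (h' : r < 42) (h'' : r ≠ 37) :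
    ¬(mulGate p).WritesNat r := by
  refine not_writesNat_forLoop (by omega) (by omega)
    (not_writesNat_forLoop (by omega) (by omega) ?_)
  have := not_writesNat_mulAcc (p := p) (x := r) (by omega) (by omega) (by omega)
  rintro (h | h | (h | h | h | h) | h) <;>
    first | exact this h | (simp only [WritesNat] at h; omega)

end Prog

namespace Fock

variable {R : Type*} [Semiring R]

lemma coeff_mul_eq_sum_range (P Q : Polynomial R) {D x : ℕ} (hx : x < D) :
    (P * Q).coeff x = ∑ d ∈ range D, ∑ e ∈ range D,
      if d + e = x then P.coeff d * Q.coeff e else 0 := by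
  rw [Polynomial.coeff_mul, ← sum_product']
  rw [← sum_filter]
  refine sum_congr ?_ fun _ _ => rfl
  ext ⟨d, e⟩
  simp only [HasAntidiagonal.mem_antidiagonal, mem_filter, mem_product, mem_range]
  omega

end Fock

namespace Prog

open Fock

variable {F : Type*} [Field F] {B : ℕ} {t n z : ℕ}
  {A : Matrix (Fin t ⊕ (Fin n ⊕ Fin z)) (Fin t ⊕ (Fin n ⊕ Fin z)) F} {C : Circuit F n}
  {ρ : Fin n ⊕ Fin z → F}

/-- The slots of the current gate hold a lifting of its value, and the slots before it are
unchanged. -/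
def GateDone (A : Matrix (Fin t ⊕ (Fin n ⊕ Fin z)) (Fin t ⊕ (Fin n ⊕ Fin z)) F)
    (C : Circuit F n) (ρ : Fin n ⊕ Fin z → F) (g : Fin (C.last + 1)) (f f' : ℕ → F) : Prop :=
  (∃ M, (C.value g, M) ∈ liftings A ρ ∧
    ∀ x < t + 2, slot t f' (t + n + z + 1 + g * (t + 2) + x) = M.coeff x) ∧
  ∀ q < t + n + z + 1 + g * (t + 2), slot t f' q = slot t f q

theorem runs_branch {L W M : ℕ} (hb : Bounds t L B W) {p : Prog} (hp : Multiplies F p (2 ^ t) M)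
    (hM : M ≤ W) {σ : Memory F} (h : Ready A C ρ σ) {g : Fin (C.last + 1)} {b : ℕ}
    (hbg : b = t + n + z + 1 + g * (t + 2)) (h35 : σ.nat 35 = g) (h36 : σ.nat 36 = b)
    (h28 : σ.nat 28 = 1) (h38 : σ.nat 38 = σ.natArr 0 g) (hbL : b + (t + 2) ≤ L)
    (hP : HoldsPairs A ρ (t + n + z + 1) (σ.fldArr 3)) (hG : HoldsGates A C ρ g (σ.fldArr 3))
    (hz : ∀ x < t + 2, slot t (σ.fldArr 3) (b + x) = 0) :
    Runs B (natIf 38 (natSub 38 38 28 ⨾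
      natIf 38 (loadArgs ⨾ natSub 38 38 28 ⨾ natIf 38 (mulGate p) addGate) constGate) varGate) σ
      (200 * ((t + 2) ^ 2 * W)) (fun τ => GateDone A C ρ g (σ.fldArr 3) (τ.fldArr 3)) := by
  have b4 := hb.le
  have b5 := hb.pos
  have b6 : (t + 2) * W ≤ (t + 2) ^ 2 * W := Nat.mul_le_mul_right _ (by nlinarith)
  have b7 : 2 * W ≤ (t + 2) * W := Nat.mul_le_mul_right _ (by omega)
  have b8 : (g : ℕ) ≤ g * (t + 2) := Nat.le_mul_of_pos_right _ (by omega)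
  have hin := h.input.2.2.2.2.2.1 g
  have done : ∀ f', (∀ q < b, slot t f' q = slot t (σ.fldArr 3) q) →
      (∃ M, (C.value g, M) ∈ liftings A ρ ∧ ∀ x < t + 2, slot t f' (b + x) = M.coeff x) →
      GateDone A C ρ g (σ.fldArr 3) f' := by
    rintro f' h1 ⟨M, hM, h2⟩
    subst hbg
    exact ⟨⟨M, hM, h2⟩, h1⟩
  cases hgate : C.gate g with
  | var v =>
    rw [hgate] at hin
    have hval : C.value g = MvPolynomial.X v := by rw [Circuit.value, hgate]
    refine (Runs.natIf (k := 50 * W) (by omega) (fun hne => absurd (h38.trans hin.1) hne)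
      fun _ => ?_).mono (by omega) fun _ _ h => h
    have := v.isLt
    refine (runs_varGate hb h h35 h36 (by omega) hin.2 (by omega) (by omega)).mono le_rfl
      fun τ _ hτ => done _ (fun q hq => by rw [hτ, if_neg (by omega)])
        ⟨Polynomial.monomial 1 (pairOp (elementPair A ρ (.inr (.inl v)))),
          by rw [hval]; exact Algebra.subset_adjoin ⟨v, rfl⟩, fun x hx => ?_⟩
    have hv : slot t (σ.fldArr 3) (t + v) = pairOp (elementPair A ρ (.inr (.inl v))) :=
      hP.1 (.inr (.inl v)) (by simp only [position]; omega)
    rw [hτ, hz x hx, hz 1 (by omega), zero_add, hv, Polynomial.coeff_monomial]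
    exact if_congr (by omega) rfl rfl
  | const c =>
    rw [hgate] at hin
    have hval : C.value g = MvPolynomial.C c := by rw [Circuit.value, hgate]
    refine (Runs.natIf (k := 50 * W + 2) (by omega) (fun _ => ?_)
      fun he => absurd (h38.trans hin.1) (by omega)).mono (by omega) fun _ _ h => h
    refine Runs.cons (by simp only [length]; omega) ?_
    simp only [wp, length, h38, hin.1, h28]
    refine ⟨by omega, by omega, ?_⟩
    refine (Runs.natIf (k := 50 * W) (by simp) (fun hne => absurd rfl hne)
      fun _ => ?_).mono (by omega) fun _ _ h => h
    have r : Ready A C ρ (σ.setNat 38 (1 - 1)) := h.stable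
      ⟨fun r hr => by rw [Memory.nat_setNat, if_neg (by omega)], fun _ _ => rfl, fun _ _ => rfl⟩
    refine (runs_constGate hb r (g := g) (b := b) (by simpa using h35) (by simpa using h36)
      (by omega) hin.2 (by omega) (by omega)).mono le_rfl
      fun τ _ hτ => done _ (fun q hq => by rw [hτ, if_neg (by omega)]; rfl)
        ⟨algebraMap F (Polynomial (Matrix (Ix t) (Ix t) F)) c,
          by rw [hval]; exact (liftings A ρ).algebraMap_mem c, fun x hx => ?_⟩
    simp only [Memory.fldArr_setNat] at hτ
    rw [hτ, hz x hx, hP.2 (by omega)]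
    have h0 := hz 0 (by omega)
    rw [add_zero] at h0
    rw [h0, zero_add, Polynomial.algebraMap_apply, Polynomial.coeff_C,
      Algebra.algebraMap_eq_smul_one]
    exact if_congr (by omega) rfl rfl
  | add a₁ a₂ =>
    rw [hgate] at hin
    have hval : C.value g = C.value ⟨a₁, a₁.isLt.trans g.isLt⟩ +
      C.value ⟨a₂, a₂.isLt.trans g.isLt⟩ := by rw [Circuit.value, hgate]
    obtain ⟨M₁, m₁, c₁⟩ := hG ⟨a₁, a₁.isLt.trans g.isLt⟩ a₁.isLt
    obtain ⟨M₂, m₂, c₂⟩ := hG ⟨a₂, a₂.isLt.trans g.isLt⟩ a₂.isLt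
    have l₁ := Nat.mul_le_mul_right (t + 2) (Nat.succ_le_of_lt a₁.isLt)
    have l₂ := Nat.mul_le_mul_right (t + 2) (Nat.succ_le_of_lt a₂.isLt)
    rw [Nat.succ_eq_add_one, add_mul, one_mul] at l₁ l₂
    refine (Runs.natIf (k := 30 * W + 100 * ((t + 2) * W) + 4) (by omega) (fun _ => ?_)
      fun he => absurd (h38.trans hin.1) (by omega)).mono (by omega) fun _ _ h => h
    refine Runs.cons (by simp only [length]; omega) ?_
    simp only [wp, length, h38, hin.1, h28]
    refine ⟨by omega, by omega, ?_⟩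
    refine (Runs.natIf (k := 30 * W + 100 * ((t + 2) * W) + 2) (by simp; omega) (fun _ => ?_)
      fun he => absurd he (by simp)).mono (by omega) fun _ _ h => h
    have r : Ready A C ρ (σ.setNat 38 (2 - 1)) := h.stable
      ⟨fun r hr => by rw [Memory.nat_setNat, if_neg (by omega)], fun _ _ => rfl, fun _ _ => rfl⟩
    refine (runs_loadArgs hb r (by simpa using h35) hin.2.1 hin.2.2 a₁.isLt a₂.isLt
      (by omega)).andThen (by omega) fun τ1 ag1 ⟨e40, e41⟩ => ?_
    have r1 := r.stable (isLocal_loadArgs.stable ag1)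
    have k1 : ∀ x, 10 < x → x < 38 → τ1.nat x = σ.nat x := fun x hx hx' => by
      rw [ag1.nat x (not_writesNat_loadArgs hx (by omega)), Memory.nat_setNat, if_neg (by omega)]
    have k2 : τ1.nat 38 = 1 := by
      rw [ag1.nat 38 (not_writesNat_loadArgs (by omega) (by omega))]
      simp
    have k3 : τ1.fldArr 3 = σ.fldArr 3 := ag1.fldArr 3 (by
      simp [loadArgs, mulReg, forLoop, WritesFldArr])
    refine Runs.cons (by simp only [length]; omega) ?_
    simp only [wp, length, k2, k1 28 (by omega) (by omega), h28]
    refine ⟨by omega, by omega, ?_⟩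
    have r2 : Ready A C ρ (τ1.setNat 38 (1 - 1)) := r1.stable
      ⟨fun r hr => by rw [Memory.nat_setNat, if_neg (by omega)], fun _ _ => rfl, fun _ _ => rfl⟩
    refine (Runs.natIf (k := 100 * ((t + 2) * W)) (by simp) (fun hne => absurd (by simp) hne)
      fun _ => ?_).mono (by omega) fun _ _ h => h
    refine (runs_addGate hb r2 (b := b)
      (q₁ := t + n + z + 1 + a₁ * (t + 2)) (q₂ := t + n + z + 1 + a₂ * (t + 2))
      (by simp [k1 36 (by omega) (by omega), h36])
      (by simpa using e40) (by simpa using e41) (by omega) (by omega) hbL).mono le_rfl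
      fun τ _ ⟨hτ, hτ'⟩ => done _ (fun q hq => by rw [hτ' q hq, Memory.fldArr_setNat, k3])
        ⟨M₁ + M₂, by
          rw [hval, ← Prod.mk_add_mk]; exact add_mem m₁ m₂, fun x hx => ?_⟩
    simp only [Memory.fldArr_setNat, k3] at hτ
    rw [hτ x hx, hz x hx, c₁ x hx, c₂ x hx, zero_add]
    exact (Polynomial.coeff_add _ _ _).symm
  | mul a₁ a₂ =>
    rw [hgate] at hin
    have hval : C.value g = C.value ⟨a₁, a₁.isLt.trans g.isLt⟩ *
      C.value ⟨a₂, a₂.isLt.trans g.isLt⟩ := by rw [Circuit.value, hgate]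
    obtain ⟨M₁, m₁, c₁⟩ := hG ⟨a₁, a₁.isLt.trans g.isLt⟩ a₁.isLt
    obtain ⟨M₂, m₂, c₂⟩ := hG ⟨a₂, a₂.isLt.trans g.isLt⟩ a₂.isLt
    have l₁ := Nat.mul_le_mul_right (t + 2) (Nat.succ_le_of_lt a₁.isLt)
    have l₂ := Nat.mul_le_mul_right (t + 2) (Nat.succ_le_of_lt a₂.isLt)
    rw [Nat.succ_eq_add_one, add_mul, one_mul] at l₁ l₂
    refine (Runs.natIf (k := 30 * W + 150 * ((t + 2) ^ 2 * W) + 4) (by omega) (fun _ => ?_)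
      fun he => absurd (h38.trans hin.1) (by omega)).mono (by omega) fun _ _ h => h
    refine Runs.cons (by simp only [length]; omega) ?_
    simp only [wp, length, h38, hin.1, h28]
    refine ⟨by omega, by omega, ?_⟩
    refine (Runs.natIf (k := 30 * W + 150 * ((t + 2) ^ 2 * W) + 2) (by simp; omega) (fun _ => ?_)
      fun he => absurd he (by simp)).mono (by omega) fun _ _ h => h
    have r : Ready A C ρ (σ.setNat 38 (3 - 1)) := h.stable
      ⟨fun r hr => by rw [Memory.nat_setNat, if_neg (by omega)], fun _ _ => rfl, fun _ _ => rfl⟩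
    refine (runs_loadArgs hb r (by simpa using h35) hin.2.1 hin.2.2 a₁.isLt a₂.isLt
      (by omega)).andThen (by omega) fun τ1 ag1 ⟨e40, e41⟩ => ?_
    have r1 := r.stable (isLocal_loadArgs.stable ag1)
    have k1 : ∀ x, 10 < x → x < 38 → τ1.nat x = σ.nat x := fun x hx hx' => by
      rw [ag1.nat x (not_writesNat_loadArgs hx (by omega)), Memory.nat_setNat, if_neg (by omega)]
    have k2 : τ1.nat 38 = 2 := by
      rw [ag1.nat 38 (not_writesNat_loadArgs (by omega) (by omega))]
      simp
    have k3 : τ1.fldArr 3 = σ.fldArr 3 := ag1.fldArr 3 (by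
      simp [loadArgs, mulReg, forLoop, WritesFldArr])
    refine Runs.cons (by simp only [length]; omega) ?_
    simp only [wp, length, k2, k1 28 (by omega) (by omega), h28]
    refine ⟨by omega, by omega, ?_⟩
    have r2 : Ready A C ρ (τ1.setNat 38 (2 - 1)) := r1.stable
      ⟨fun r hr => by rw [Memory.nat_setNat, if_neg (by omega)], fun _ _ => rfl, fun _ _ => rfl⟩
    refine (Runs.natIf (k := 150 * ((t + 2) ^ 2 * W)) (by simp; omega) (fun _ => ?_)
      fun he => absurd he (by simp)).mono (by omega) fun _ _ h => h
    refine (runs_mulGate hb hp hM r2 (b := b)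
      (q₁ := t + n + z + 1 + a₁ * (t + 2)) (q₂ := t + n + z + 1 + a₂ * (t + 2))
      (by simp [k1 36 (by omega) (by omega), h36])
      (by simpa using e40) (by simpa using e41) (by omega) (by omega) hbL).mono le_rfl
      fun τ _ ⟨hτ, hτ'⟩ => done _ (fun q hq => by rw [hτ' q hq, Memory.fldArr_setNat, k3])
        ⟨M₁ * M₂, by
          rw [hval, ← Prod.mk_mul_mk]; exact mul_mem m₁ m₂, fun x hx => ?_⟩
    simp only [Memory.fldArr_setNat, k3] at hτ
    rw [hτ x hx, hz x hx, zero_add]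
    rw [coeff_mul_eq_sum_range M₁ M₂ hx]
    refine sum_congr rfl fun d hd => sum_congr rfl fun e he => ?_
    rw [c₁ d (mem_range.mp hd), c₂ e (mem_range.mp he)]

end Prog

namespace Prog

open Fock

variable {F : Type*} [Field F] {B : ℕ} {t n z : ℕ}
  {A : Matrix (Fin t ⊕ (Fin n ⊕ Fin z)) (Fin t ⊕ (Fin n ⊕ Fin z)) F} {C : Circuit F n}
  {ρ : Fin n ⊕ Fin z → F}

lemma not_writesNat_gateStep {p : Prog} {r : ℕ} (h : 28 < r) (h' : r < 36) :
    ¬(gateStep p).WritesNat r := by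
  have h1 := not_writesNat_clearGate (r := r) (by omega) (by omega)
  have h2 := not_writesNat_loadArgs (r := r) (by omega) (by omega)
  have h3 := not_writesNat_mulGate (p := p) (r := r) (by omega) (by omega) (by omega)
  have h4 := not_writesNat_addGate (r := r) (by omega) (by omega)
  have h5 := not_writesNat_constGate (r := r) (by omega)
  have h6 := not_writesNat_varGate (r := r) (by omega) (by omega)
  simp only [gateStep, WritesNat, h1, h2, h3, h4, h5, h6, or_false, false_or]
  omega

theorem runs_gateStep {L W M : ℕ} (hb : Bounds t L B W) {p : Prog} (hp : Multiplies F p (2 ^ t) M)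
    (hM : M ≤ W) {σ : Memory F} (h : Ready A C ρ σ) {g : Fin (C.last + 1)}
    (h35 : σ.nat 35 = g) (h36 : σ.nat 36 = t + n + z + 1 + g * (t + 2))
    (hbL : t + n + z + 1 + (g + 1) * (t + 2) ≤ L)
    (hP : HoldsPairs A ρ (t + n + z + 1) (σ.fldArr 3)) (hG : HoldsGates A C ρ g (σ.fldArr 3)) :
    Runs B (gateStep p) σ (300 * ((t + 2) ^ 2 * W)) (fun τ =>
      τ.nat 36 = t + n + z + 1 + (g + 1) * (t + 2) ∧
      HoldsPairs A ρ (t + n + z + 1) (τ.fldArr 3) ∧ HoldsGates A C ρ (g + 1) (τ.fldArr 3)) := by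
  have b4 := hb.le
  have b5 := hb.pos
  have b6 : (t + 2) * W ≤ (t + 2) ^ 2 * W := Nat.mul_le_mul_right _ (by nlinarith)
  have b7 : 2 * W ≤ (t + 2) * W := Nat.mul_le_mul_right _ (by omega)
  have b8 : (g : ℕ) ≤ g * (t + 2) := Nat.le_mul_of_pos_right _ (by omega)
  rw [add_mul, one_mul] at hbL
  rw [add_mul, one_mul]
  set b := t + n + z + 1 + g * (t + 2) with hbdef
  have keepP : ∀ f : ℕ → F, (∀ q < b, slot t f q = slot t (σ.fldArr 3) q) →
      HoldsPairs A ρ (t + n + z + 1) f := fun f hf =>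
    ⟨fun e he => by rw [hf _ (by omega), hP.1 e he], fun he => by rw [hf _ (by omega), hP.2 he]⟩
  have keepG : ∀ f : ℕ → F, (∀ q < b, slot t f q = slot t (σ.fldArr 3) q) →
      HoldsGates A C ρ g f := by
    intro f hf g' hg'
    obtain ⟨M, hM, hc⟩ := hG g' hg'
    refine ⟨M, hM, fun x hx => ?_⟩
    have := Nat.mul_le_mul_right (t + 2) (Nat.succ_le_of_lt hg')
    rw [Nat.succ_eq_add_one, add_mul, one_mul] at this
    rw [hf _ (by omega), hc x hx]
  refine (runs_clearGate hb h h36 (by omega)).andThen (by omega) fun τ1 ag1 ⟨e1, e2⟩ => ?_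
  have r1 := h.stable (isLocal_clearGate.stable ag1)
  have k1 : ∀ r, 28 < r → r < 37 → τ1.nat r = σ.nat r := fun r hr hr' =>
    ag1.nat r (not_writesNat_clearGate (by omega) (by omega))
  have type : τ1.natArr 0 g ≤ 3 := by
    have := r1.input.2.2.2.2.2.1 g
    cases hgate : C.gate g <;> rw [hgate] at this <;> have := this.1 <;> omega
  refine Runs.cons (by simp only [length]; omega) ?_
  simp only [wp, length, k1 35 (by omega) (by omega), h35]
  refine ⟨by omega, by omega, Runs.cons (by simp only [length]; omega) ?_⟩
  simp only [wp, length]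
  refine ⟨by omega, ?_⟩
  set τ2 := (τ1.setNat 38 (τ1.natArr 0 g)).setNat 28 1 with hτ2
  have s2 : Stable τ1 τ2 := ⟨fun r hr => by
    rw [hτ2, Memory.nat_setNat, if_neg (by omega), Memory.nat_setNat, if_neg (by omega)],
    fun _ _ => rfl, fun _ _ => rfl⟩
  have r2 := r1.stable s2
  have n2 : ∀ r, r ≠ 38 → r ≠ 28 → τ2.nat r = τ1.nat r := fun r hr hr' => by
    rw [hτ2, Memory.nat_setNat, if_neg (by omega), Memory.nat_setNat, if_neg (by omega)]
  refine (runs_branch (B := B) hb hp hM r2 hbdef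
    (by rw [n2 35 (by omega) (by omega), k1 35 (by omega) (by omega), h35])
    (by rw [n2 36 (by omega) (by omega), k1 36 (by omega) (by omega), h36]) (by simp [hτ2])
    (by simp [hτ2]) (by omega) (keepP _ e2) (keepG _ e2) e1).andThen (by omega)
    fun τ3 ag3 ⟨⟨M', m', c'⟩, e3⟩ => ?_
  have r3 : Ready A C ρ τ3 := r2.stable ((isLocal_natIf
    (isLocal_seq (isLocal_natSub (by omega)) <| isLocal_natIf
      (isLocal_seq isLocal_loadArgs <| isLocal_seq (isLocal_natSub (by omega)) <|
        isLocal_natIf (isLocal_mulGate p) isLocal_addGate) isLocal_constGate)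
    isLocal_varGate).stable ag3)
  have e36 : τ3.nat 36 = b := by
    rw [ag3.nat 36, n2 36 (by omega) (by omega), k1 36 (by omega) (by omega), h36]
    have h2 := not_writesNat_loadArgs (r := 36) (by omega) (by omega)
    have h3 := not_writesNat_mulGate (p := p) (r := 36) (by omega) (by omega) (by omega)
    have h4 := not_writesNat_addGate (r := 36) (by omega) (by omega)
    have h5 := not_writesNat_constGate (r := 36) (by omega)
    have h6 := not_writesNat_varGate (r := 36) (by omega) (by omega)
    simp [WritesNat, h2, h3, h4, h5, h6]
  refine (runs_of_wp ?_).mono (by simp only [length]; omega) fun _ _ h => h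
  simp only [wp, Memory.nat_setNat, if_true, e36, r3.nat7, Memory.fldArr_setNat]
  have e4 : ∀ q < b, slot t (τ3.fldArr 3) q = slot t (σ.fldArr 3) q := fun q hq =>
    (e3 q hq).trans (e2 q hq)
  refine ⟨by omega, by omega, by omega, keepP _ e4, fun g' hg' => ?_⟩
  by_cases hgg : (g' : ℕ) = g
  · obtain rfl : g' = g := Fin.ext hgg
    exact ⟨M', m', c'⟩
  · exact keepG _ e4 g' (by omega)

/-- Compute the slots of all gates. -/
def evalGates (p : Prog) : Prog := natConst 28 0 ⨾ natAdd 36 8 28 ⨾ forLoop 35 3 (gateStep p)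

lemma isLocal_evalGates (p : Prog) : (evalGates p).IsLocal :=
  isLocal_seq (isLocal_natConst (by omega)) <| isLocal_seq (isLocal_natAdd (by omega)) <|
  isLocal_forLoop (by omega) (isLocal_gateStep p)

theorem runs_evalGates {L W M : ℕ} (hb : Bounds t L B W) {p : Prog} (hp : Multiplies F p (2 ^ t) M)
    (hM : M ≤ W) {σ : Memory F} (h : Ready A C ρ σ)
    (hbL : t + n + z + 1 + (C.last + 1) * (t + 2) ≤ L)
    (hP : HoldsPairs A ρ (t + n + z + 1) (σ.fldArr 3)) :
    Runs B (evalGates p) σ ((C.last + 1) * (310 * ((t + 2) ^ 2 * W)) + 5) (fun τ =>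
      τ.nat 36 = t + n + z + 1 + (C.last + 1) * (t + 2) ∧
      HoldsPairs A ρ (t + n + z + 1) (τ.fldArr 3) ∧
      HoldsGates A C ρ (C.last + 1) (τ.fldArr 3)) := by
  have b4 := hb.le
  have b5 := hb.pos
  have b8 : C.last + 1 ≤ (C.last + 1) * (t + 2) := Nat.le_mul_of_pos_right _ (by omega)
  have e : (C.last + 1) * (300 * ((t + 2) ^ 2 * W) + 4) ≤
      (C.last + 1) * (310 * ((t + 2) ^ 2 * W)) := by
    refine Nat.mul_le_mul_left _ ?_
    have : 1 ≤ (t + 2) ^ 2 * W := Nat.mul_pos (by positivity) b5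
    omega
  refine Runs.cons (by simp only [length]; omega) ?_
  simp only [wp, length]
  refine ⟨by omega, Runs.cons (by simp only [length]; omega) ?_⟩
  simp only [wp, length, Memory.nat_setNat, Nat.reduceEqDiff, if_true, if_false, h.nat8]
  refine ⟨by omega, by omega, ?_⟩
  refine (Runs.forLoop (B := B) (k := 300 * ((t + 2) ^ 2 * W)) (len := C.last + 1) (fun j τ =>
      τ.nat 36 = t + n + z + 1 + j * (t + 2) ∧
      HoldsPairs A ρ (t + n + z + 1) (τ.fldArr 3) ∧
      HoldsGates A C ρ j (τ.fldArr 3)) (by simp [h.nat3]) (by omega) (by omega)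
      (by omega) (by omega) (not_writesNat_gateStep (by omega) (by omega))
      ((isLocal_gateStep p).1 3 (by omega)) ?_ ?_ ?_).mono (by omega) fun _ _ h => h
  · intro j τ x v hx ⟨i1, i2⟩
    exact ⟨by rw [Memory.nat_setNat, if_neg (by omega), i1], i2⟩
  · exact ⟨by simp, hP, fun g hg => absurd hg (by omega)⟩
  · intro g hg τ hτ ag ⟨i1, i2, i3⟩
    have := Nat.mul_le_mul_right (t + 2) (Nat.succ_le_of_lt hg)
    rw [Nat.succ_eq_add_one] at this
    exact runs_gateStep hb hp hM (h.stable (Stable.trans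
      (τ := (σ.setNat 28 0).setNat 36 (t + n + z + 1 + 0)) ⟨fun r hr => by
        rw [Memory.nat_setNat, if_neg (by omega), Memory.nat_setNat, if_neg (by omega)],
        fun _ _ => rfl, fun _ _ => rfl⟩
      ((isLocal_forLoop (by omega) (isLocal_gateStep p)).stable ag))) (g := ⟨g, hg⟩) hτ i1
      (by simp only; omega) i2 i3

/-! ### The elements that are always chosen or summed over -/

/-- Multiply the polynomial in the slots from the number in register `36` on by `1 + h E`, for the
operator `E` in the slot whose number is in register `30`. Descending degrees make this possible in
place. -/
def mulFactor (p : Prog) : Prog :=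
  natConst 28 1 ⨾ natAdd 45 1 28 ⨾ forLoop 37 45 (natSub 38 45 37 ⨾ natAdd 15 36 38 ⨾
    natConst 28 1 ⨾ natSub 16 15 28 ⨾ natConst 28 0 ⨾ natAdd 17 30 28 ⨾ mulAcc p)

lemma isLocal_mulFactor (p : Prog) : (mulFactor p).IsLocal :=
  isLocal_seq (isLocal_natConst (by omega)) <| isLocal_seq (isLocal_natAdd (by omega)) <|
  isLocal_forLoop (by omega) <| isLocal_seq (isLocal_natSub (by omega)) <|
  isLocal_seq (isLocal_natAdd (by omega)) <| isLocal_seq (isLocal_natConst (by omega)) <|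
  isLocal_seq (isLocal_natSub (by omega)) <| isLocal_seq (isLocal_natConst (by omega)) <|
  isLocal_seq (isLocal_natAdd (by omega)) <| isLocal_mulAcc p

lemma not_writesNat_mulFactor {p : Prog} {r : ℕ} (h : 28 < r) (h' : r < 37) :
    ¬(mulFactor p).WritesNat r := by
  have := not_writesNat_mulAcc (p := p) (x := r) (by omega) (by omega) (by omega)
  rintro (h | h | h)
  · simp only [WritesNat] at h; omega
  · simp only [WritesNat] at h; omega
  · refine not_writesNat_forLoop (by omega) (by omega) ?_ h
    rintro (h | h | h | h | h | h | h) <;>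
      first | exact this h | (simp only [WritesNat] at h; omega)

theorem runs_mulFactor {L W M : ℕ} (hb : Bounds t L B W) {p : Prog} (hp : Multiplies F p (2 ^ t) M)
    (hM : M ≤ W) {σ : Memory F} (h : Ready A C ρ σ) {b κ : ℕ} (h30 : σ.nat 30 = κ)
    (h36 : σ.nat 36 = b) (hκb : κ < b) (hbL : b + (t + 2) ≤ L) :
    Runs B (mulFactor p) σ (150 * ((t + 2) * W)) (fun τ =>
      (∀ x < t + 2, slot t (τ.fldArr 3) (b + x) = if 0 < x then slot t (σ.fldArr 3) (b + x) +
        slot t (σ.fldArr 3) (b + (x - 1)) * slot t (σ.fldArr 3) κ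
        else slot t (σ.fldArr 3) (b + x)) ∧
      ∀ q < b, slot t (τ.fldArr 3) q = slot t (σ.fldArr 3) q) := by
  have b4 := hb.le
  have b5 := hb.pos
  let body := natSub 38 45 37 ⨾ natAdd 15 36 38 ⨾
    natConst 28 1 ⨾ natSub 16 15 28 ⨾ natConst 28 0 ⨾ natAdd 17 30 28 ⨾ mulAcc p
  have loc : body.IsLocal := isLocal_seq (isLocal_natSub (by omega)) <|
    isLocal_seq (isLocal_natAdd (by omega)) <| isLocal_seq (isLocal_natConst (by omega)) <|
    isLocal_seq (isLocal_natSub (by omega)) <| isLocal_seq (isLocal_natConst (by omega)) <|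
    isLocal_seq (isLocal_natAdd (by omega)) <| isLocal_mulAcc p
  have w : ∀ r, 28 < r → r < 64 → r ≠ 38 → ¬body.WritesNat r := by
    intro r hr hr' hr2
    have := not_writesNat_mulAcc (p := p) (x := r) (by omega) (by omega) (by omega)
    rintro (h | h | h | h | h | h | h) <;>
      first | exact this h | (simp only [WritesNat] at h; omega)
  have e0 : (t + 1) * (120 * W + 6 + 4) + 5 ≤ 150 * ((t + 2) * W) := by
    have e1 : 120 * W + 6 + 4 ≤ 130 * W := by omega
    have e2 := Nat.mul_le_mul_left (t + 1) e1
    have e3 : (t + 1) * (130 * W) = 130 * (t * W) + 130 * W := by ring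
    have e4 : (t + 2) * W = t * W + 2 * W := by ring
    omega
  refine Runs.cons (by simp only [length]; omega) ?_
  simp only [wp, length]
  refine ⟨by omega, Runs.cons (by simp only [length]; omega) ?_⟩
  simp only [wp, length, Memory.nat_setNat, OfNat.one_ne_ofNat, if_true, if_false, h.nat1]
  refine ⟨by omega, by omega, ?_⟩
  set σ' := (σ.setNat 28 1).setNat 45 (t + 1) with hσ'
  have r' : Ready A C ρ σ' := h.stable ⟨fun r hr => by
    rw [Memory.nat_setNat, if_neg (by omega), Memory.nat_setNat, if_neg (by omega)],
    fun _ _ => rfl, fun _ _ => rfl⟩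
  refine (Runs.forLoop (B := B) (σ := σ') (k := 120 * W + 6) (len := t + 1) (fun j τ =>
      (∀ x < t + 2, slot t (τ.fldArr 3) (b + x) = if t + 1 - j < x then
        slot t (σ.fldArr 3) (b + x) +
        slot t (σ.fldArr 3) (b + (x - 1)) * slot t (σ.fldArr 3) κ
        else slot t (σ.fldArr 3) (b + x)) ∧
      ∀ q < b, slot t (τ.fldArr 3) q = slot t (σ.fldArr 3) q) (by simp [hσ']) (by omega) (by omega)
      (by omega) (by omega) (w 37 (by omega) (by omega) (by omega))
      (w 45 (by omega) (by omega) (by omega)) (fun _ _ _ _ _ h => h)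
      ⟨fun x hx => by rw [if_neg (by omega)]; rfl, fun _ _ => rfl⟩ ?_).mono (by omega)
      fun τ _ h => by simpa using h
  intro j hj τ hτ ag ⟨i1, i2⟩
  have r : Ready A C ρ τ := r'.stable ((isLocal_forLoop (by omega) loc).stable ag)
  have k : ∀ r, 28 < r → r < 64 → r ≠ 38 → r ≠ 37 → τ.nat r = σ'.nat r :=
    fun r hr hr' hr1 hr2 => ag.nat r (not_writesNat_forLoop hr2 (by omega) (w r hr hr' hr1))
  have e45 : τ.nat 45 = t + 1 := by
    rw [k 45 (by omega) (by omega) (by omega) (by omega)]; simp [hσ']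
  have e36 : τ.nat 36 = b := by
    rw [k 36 (by omega) (by omega) (by omega) (by omega)]; simp [hσ', h36]
  have e30 : τ.nat 30 = κ := by
    rw [k 30 (by omega) (by omega) (by omega) (by omega)]; simp [hσ', h30]
  refine Runs.cons (by simp only [length]; omega) ?_
  simp only [wp, length, hτ, e45]
  refine ⟨by omega, by omega, Runs.cons (by simp only [length]; omega) ?_⟩
  simp only [wp, length, Memory.nat_setNat, Nat.reduceEqDiff, if_true, if_false, e36]
  refine ⟨by omega, by omega, Runs.cons (by simp only [length]; omega) ?_⟩
  simp only [wp, length]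
  refine ⟨by omega, Runs.cons (by simp only [length]; omega) ?_⟩
  simp only [wp, length, Memory.nat_setNat, Nat.reduceEqDiff, if_true, if_false]
  refine ⟨by omega, by omega, Runs.cons (by simp only [length]; omega) ?_⟩
  simp only [wp, length]
  refine ⟨by omega, Runs.cons (by simp only [length]; omega) ?_⟩
  simp only [wp, length, Memory.nat_setNat, Nat.reduceEqDiff, if_true, if_false, e30]
  refine ⟨by omega, by omega, ?_⟩
  refine (runs_mulAcc (B := B) hp hM hb (d := b + (t + 1 - j)) (q₁ := b + (t + 1 - j) - 1)
    (q₂ := κ) (by simp [r.nat5]) (by simp [r.nat6]) (by simp) (by simp) (by simp) (by omega)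
    (by omega) (by omega)).mono (by omega) fun υ _ hυ => ⟨fun x hx => ?_, fun q hq => ?_⟩
  · simp only [Memory.fldArr_setNat] at hυ
    rw [hυ, i2 κ hκb]
    by_cases hx' : x = t + 1 - j
    · subst hx'
      rw [if_pos rfl, if_pos (by omega), i1 _ (by omega), if_neg (by omega),
        show b + (t + 1 - j) - 1 = b + (t + 1 - j - 1) by omega, i1 _ (by omega),
        if_neg (by omega)]
    · rw [if_neg (by omega), i1 x hx]
      exact if_congr (by omega) rfl rfl
  · rw [hυ, if_neg (by omega)]
    exact i2 q hq

end Prog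

namespace Fock

variable {F : Type*} [Field F] {t n z : ℕ}

/-! ### The elements of `T` and `Z` as factors -/

/-- The pairs of vectors of the elements of `T ∪ Z` with numbers below `κ`, in the order of their
numbers. -/
def factorList (A : Matrix (Fin t ⊕ (Fin n ⊕ Fin z)) (Fin t ⊕ (Fin n ⊕ Fin z)) F)
    (ρ : Fin n ⊕ Fin z → F) : ℕ → List ((Fin t → F) × (Fin t → F))
  | 0 => []
  | κ + 1 => factorList A ρ κ ++
    if h : κ < t then [elementPair A ρ (.inl ⟨κ, h⟩)]
    else if h : t + n ≤ κ ∧ κ < t + n + z then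
      [elementPair A ρ (.inr (.inr ⟨κ - (t + n), by omega⟩))]
    else []

variable (A : Matrix (Fin t ⊕ (Fin n ⊕ Fin z)) (Fin t ⊕ (Fin n ⊕ Fin z)) F)
  (ρ : Fin n ⊕ Fin z → F)

lemma sum_factorList : ((factorList A ρ (t + n + z)).map fun p =>
      Matrix.vecMulVec p.1 p.2).sum =
    ∑ i, Matrix.vecMulVec (elementPair A ρ (.inl i)).1 (elementPair A ρ (.inl i)).2 +
    ∑ j, Matrix.vecMulVec (elementPair A ρ (.inr (.inr j))).1
      (elementPair A ρ (.inr (.inr j))).2 := by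
  have h : ∀ κ, ((factorList A ρ κ).map fun p => Matrix.vecMulVec p.1 p.2).sum =
      ∑ c ∈ range κ, ((if h : c < t then [elementPair A ρ (.inl ⟨c, h⟩)]
        else if h : t + n ≤ c ∧ c < t + n + z then
          [elementPair A ρ (.inr (.inr ⟨c - (t + n), by omega⟩))]
        else []).map fun p => Matrix.vecMulVec p.1 p.2).sum := by
    intro κ
    induction κ with
    | zero => rfl
    | succ κ ih => rw [factorList, List.map_append, List.sum_append, ih, sum_range_succ]
  rw [h, sum_range_add, sum_range_add, sum_range, sum_range, sum_range]
  have h2 : ∀ i : Fin n, ¬t + (i : ℕ) < t ∧ ¬(t + n ≤ t + (i : ℕ) ∧ t + (i : ℕ) < t + n + z) := by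
    intro i
    omega
  have h3 : ∀ i : Fin z, ¬t + n + (i : ℕ) < t ∧ (t + n ≤ t + n + (i : ℕ) ∧
      t + n + (i : ℕ) < t + n + z) := by
    intro i
    omega
  congr 1
  · rw [sum_eq_zero (s := (univ : Finset (Fin n))) fun i _ => ?_, add_zero]
    · exact sum_congr rfl fun i _ => by simp
    · rw [dif_neg (h2 i).1, dif_neg (h2 i).2]
      rfl
  · refine sum_congr rfl fun i _ => ?_
    rw [dif_neg (h3 i).1, dif_pos (h3 i).2]
    simp

lemma parity_transpose (t : ℕ) : (parity t : Matrix (Ix t) (Ix t) F).transpose = parity t := by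
  ext x y
  induction t with
  | zero => rfl
  | succ t ih =>
    rcases x with x | x <;> rcases y with y | y
    · exact ih x y
    · change ((0 : F) • (1 : Matrix (Ix t) (Ix t) F)) y x = ((0 : F) • (1 : Matrix _ _ F)) x y
      rw [zero_smul]
      rfl
    · change ((0 : F) • (1 : Matrix (Ix t) (Ix t) F)) y x = ((0 : F) • (1 : Matrix _ _ F)) x y
      rw [zero_smul]
      rfl
    · exact congrArg Neg.neg (ih x y)

/-- The supertrace of the matrix in a slot, as a sum over the entries. -/
lemma str_slot (f g : ℕ → F) (q : ℕ) (hg : slot t g 0 = parity t) :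
    ∑ c ∈ range (2 ^ t * 2 ^ t), g c * f (q * (2 ^ t * 2 ^ t) + c) = str (slot t f q) := by
  rw [str_apply, ← parity_transpose, ← hg, Matrix.trace]
  simp only [Matrix.diag, Matrix.mul_apply, Matrix.transpose_apply, slot]
  rw [sum_comm, sum_range, ← finProdFinEquiv.sum_comp, Fintype.sum_prod_type,
    ← (ixEquiv t).sum_comp]
  refine sum_congr rfl fun x _ => ?_
  rw [← (ixEquiv t).sum_comp]
  refine sum_congr rfl fun y _ => ?_
  simp only [finProdFinEquiv_apply_val, zero_mul, zero_add, pos]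
  rw [add_comm, mul_comm (2 ^ t)]

lemma coeff_mul_pairFactor (N : Polynomial (Matrix (Ix t) (Ix t) F)) (p) (x : ℕ) :
    (N * pairFactor p).coeff x =
      if 0 < x then N.coeff x + N.coeff (x - 1) * pairOp p else N.coeff x := by
  rw [pairFactor, mul_add, mul_one, Polynomial.coeff_add]
  rcases x with _ | x
  · simp
  · simp [Polynomial.coeff_mul_monomial]

end Fock

namespace Prog

open Fock

variable {F : Type*} [Field F] {B : ℕ} {t n z : ℕ}
  {A : Matrix (Fin t ⊕ (Fin n ⊕ Fin z)) (Fin t ⊕ (Fin n ⊕ Fin z)) F} {C : Circuit F n}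
  {ρ : Fin n ⊕ Fin z → F}

/-- Multiply the polynomial of the last gate by the factors of the elements of `T ∪ Z`. -/
def mulFactors (p : Prog) : Prog :=
  natSub 36 36 7 ⨾ natAdd 33 1 0 ⨾ forLoop 30 4 (natSub 31 1 30 ⨾ natSub 32 33 30 ⨾
    natIf 31 (mulFactor p) (natIf 32 (natConst 28 0) (mulFactor p)))

lemma isLocal_mulFactors (p : Prog) : (mulFactors p).IsLocal :=
  isLocal_seq (isLocal_natSub (by omega)) <| isLocal_seq (isLocal_natAdd (by omega)) <|
  isLocal_forLoop (by omega) <| isLocal_seq (isLocal_natSub (by omega)) <|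
  isLocal_seq (isLocal_natSub (by omega)) <| isLocal_natIf (isLocal_mulFactor p) <|
  isLocal_natIf (isLocal_natConst (by omega)) (isLocal_mulFactor p)

theorem runs_mulFactors {L W M : ℕ} (hb : Bounds t L B W) {p : Prog}
    (hp : Multiplies F p (2 ^ t) M) (hM : M ≤ W) {σ : Memory F} (h : Ready A C ρ σ) {b : ℕ}
    (h36 : σ.nat 36 = b + (t + 2)) (hmb : t + n + z < b) (hbL : b + (t + 2) ≤ L)
    (hP : HoldsPairs A ρ (t + n + z + 1) (σ.fldArr 3)) {N : Polynomial (Matrix (Ix t) (Ix t) F)}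
    (hN : ∀ x < t + 2, slot t (σ.fldArr 3) (b + x) = N.coeff x) :
    Runs B (mulFactors p) σ ((t + n + z + 1) * (160 * ((t + 2) * W))) (fun τ =>
      τ.nat 36 = b ∧ ∀ x < t + 2, slot t (τ.fldArr 3) (b + x) =
        (N * ((factorList A ρ (t + n + z)).map pairFactor).prod).coeff x) := by
  have b4 := hb.le
  have b5 := hb.pos
  have b7 : 2 * W ≤ (t + 2) * W := Nat.mul_le_mul_right _ (by omega)
  have b8 : (t + n + z + 1) * (160 * ((t + 2) * W)) =
    (t + n + z) * (160 * ((t + 2) * W)) + 160 * ((t + 2) * W) := by ring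
  have b9 := Nat.mul_le_mul_left (t + n + z)
    (show 150 * ((t + 2) * W) + 4 + 4 ≤ 160 * ((t + 2) * W) by omega)
  let body := natSub 31 1 30 ⨾ natSub 32 33 30 ⨾
    natIf 31 (mulFactor p) (natIf 32 (natConst 28 0) (mulFactor p))
  have loc : body.IsLocal := isLocal_seq (isLocal_natSub (by omega)) <|
    isLocal_seq (isLocal_natSub (by omega)) <| isLocal_natIf (isLocal_mulFactor p) <|
    isLocal_natIf (isLocal_natConst (by omega)) (isLocal_mulFactor p)
  have w : ∀ r, 28 < r → r < 37 → r ≠ 31 → r ≠ 32 → ¬body.WritesNat r := by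
    intro r hr hr' h31 h32
    have := not_writesNat_mulFactor (p := p) hr hr'
    rintro (h | h | h | h | h) <;> first | exact this h | (simp only [WritesNat] at h; omega)
  refine Runs.cons (by simp only [length]; omega) ?_
  simp only [wp, length, h36, h.nat7]
  refine ⟨by omega, by omega, Runs.cons (by simp only [length]; omega) ?_⟩
  simp only [wp, length, Memory.nat_setNat, OfNat.one_ne_ofNat, OfNat.zero_ne_ofNat, if_false,
    h.nat1, h.nat0, Nat.add_sub_cancel]
  refine ⟨by omega, by omega, ?_⟩
  set σ' := (σ.setNat 36 b).setNat 33 (t + n) with hσ'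
  have r' : Ready A C ρ σ' := h.stable ⟨fun r hr => by
    rw [Memory.nat_setNat, if_neg (by omega), Memory.nat_setNat, if_neg (by omega)],
    fun _ _ => rfl, fun _ _ => rfl⟩
  refine (Runs.forLoop (B := B) (σ := σ') (k := 150 * ((t + 2) * W) + 4) (len := t + n + z)
      (fun κ τ => HoldsPairs A ρ (t + n + z + 1) (τ.fldArr 3) ∧
      ∀ x < t + 2, slot t (τ.fldArr 3) (b + x) =
        (N * ((factorList A ρ κ).map pairFactor).prod).coeff x) r'.nat4 (by omega) (by omega)
      (by omega) (by omega) (w 30 (by omega) (by omega) (by omega) (by omega))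
      (loc.1 4 (by omega)) (fun _ _ _ _ _ h => h) ⟨hP, by simpa [factorList, hσ'] using hN⟩ ?_).mono
      (by omega) fun τ ag ⟨_, h⟩ => ⟨?_, h⟩
  · intro κ hκ τ hτ ag ⟨i1, i2⟩
    have r : Ready A C ρ τ := r'.stable ((isLocal_forLoop (by omega) loc).stable ag)
    have k : ∀ r, 32 < r → r < 37 → τ.nat r = σ'.nat r :=
      fun r hr hr' => ag.nat r (not_writesNat_forLoop (by omega) (by omega)
        (w r (by omega) hr' (by omega) (by omega)))
    have e36 : τ.nat 36 = b := by rw [k 36 (by omega) (by omega)]; simp [hσ']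
    have e33 : τ.nat 33 = t + n := by rw [k 33 (by omega) (by omega)]; simp [hσ']
    refine Runs.cons (by simp only [length]; omega) ?_
    simp only [wp, length, hτ, r.nat1]
    refine ⟨by omega, by omega, Runs.cons (by simp only [length]; omega) ?_⟩
    simp only [wp, length, Memory.nat_setNat, Nat.reduceEqDiff, if_false, hτ, e33]
    refine ⟨by omega, by omega, ?_⟩
    set τ' := (τ.setNat 31 (t - κ)).setNat 32 (t + n - κ) with hτ'
    have r2 : Ready A C ρ τ' := r.stable ⟨fun r hr => by
      rw [Memory.nat_setNat, if_neg (by omega), Memory.nat_setNat, if_neg (by omega)],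
      fun _ _ => rfl, fun _ _ => rfl⟩
    have step : ∀ e : Fin t ⊕ (Fin n ⊕ Fin z), position e = κ →
        factorList A ρ (κ + 1) = factorList A ρ κ ++ [elementPair A ρ e] →
        Runs B (mulFactor p) τ' (150 * ((t + 2) * W)) (fun υ =>
          HoldsPairs A ρ (t + n + z + 1) (υ.fldArr 3) ∧
          ∀ x < t + 2, slot t (υ.fldArr 3) (b + x) =
            (N * ((factorList A ρ (κ + 1)).map pairFactor).prod).coeff x) := by
      intro e he hl
      refine (runs_mulFactor (B := B) hb hp hM r2 (b := b) (κ := κ) (by simp [hτ', hτ])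
        (by simp [hτ', e36]) (by omega) hbL).mono le_rfl fun υ _ ⟨e1, e2⟩ =>
        ⟨⟨fun e' he' => ?_, fun hh => ?_⟩, fun x hx => ?_⟩
      · rw [e2 _ (by omega)]
        exact i1.1 e' he'
      · rw [e2 _ (by omega)]
        exact i1.2 hh
      · have hE : slot t (τ.fldArr 3) κ = pairOp (elementPair A ρ e) := by
          rw [← he]
          exact i1.1 e (by omega)
        simp only [hτ', Memory.fldArr_setNat] at e1
        rw [e1 x hx, hE, i2 x hx, i2 (x - 1) (by omega), hl, List.map_append, List.prod_append,
          List.map_singleton, List.prod_singleton, ← mul_assoc, coeff_mul_pairFactor]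
    refine (Runs.natIf (B := B) (k := 150 * ((t + 2) * W) + 1) (by simp [hτ']; omega)
      (fun hne => ?_) fun heq => ?_).mono (by omega) fun _ _ h => h
    · have hlt : κ < t := by
        simp [hτ'] at hne
        omega
      exact (step (.inl ⟨κ, hlt⟩) rfl (by rw [factorList, dif_pos hlt])).mono (by omega)
        fun _ _ h => h
    · have hge : ¬κ < t := by
        simp [hτ'] at heq
        omega
      refine (Runs.natIf (B := B) (k := 150 * ((t + 2) * W)) (by simp [hτ']; omega) (fun hne => ?_)
        fun heq' => ?_).mono (by omega) fun _ _ h => h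
      · have hlt : ¬(t + n ≤ κ ∧ κ < t + n + z) := by
          simp [hτ'] at hne
          omega
        refine (runs_of_wp ?_).mono (by simp only [length]; omega) fun _ _ h => h
        simp only [wp]
        refine ⟨by omega, i1, ?_⟩
        rw [factorList, dif_neg hge, dif_neg hlt, List.append_nil]
        exact i2
      · have hlt : t + n ≤ κ ∧ κ < t + n + z := by
          simp [hτ'] at heq'
          omega
        exact step (.inr (.inr ⟨κ - (t + n), by omega⟩)) (by simp only [position]; omega)
          (by rw [factorList, dif_neg hge, dif_pos hlt])
  · rw [ag.nat 36 (not_writesNat_forLoop (by omega) (by omega)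
      (w 36 (by omega) (by omega) (by omega) (by omega)))]
    simp [hσ']

/-! ### The whole program -/

/-- Take the supertrace of the coefficient of degree `t`, and compare it with zero. -/
def finish : Prog :=
  fldOne 5 ⨾ fldZero 6 ⨾ fldZero 7 ⨾ fill 64 ⨾ natAdd 16 36 1 ⨾ mulReg 14 16 6 ⨾ fldZero 0 ⨾
  forLoop 11 6 (fldLoad 2 64 11 ⨾ natAdd 12 14 11 ⨾ fldLoad 3 3 12 ⨾ fldMul 2 2 3 ⨾ fldAdd 0 0 2) ⨾
  fldIf 0 (natConst 0 1) (natConst 0 0)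

theorem runs_finish {L W : ℕ} (hb : Bounds t L B W) {σ : Memory F} (h : Ready A C ρ σ) {b : ℕ}
    (h36 : σ.nat 36 = b) (hbL : b + (t + 2) ≤ L) {s : F}
    (hs : str (slot t (σ.fldArr 3) (b + t)) = s) :
    Runs B finish σ (120 * ((t + 1) * W)) (fun τ => τ.fld 0 = s ∧
      (s ≠ 0 → τ.nat 0 = 1) ∧ (s = 0 → τ.nat 0 = 0)) := by
  have b1 := hb.slot (show b + t < L by omega)
  have b4 := hb.le
  have b5 : W ≤ (t + 1) * W := Nat.le_mul_of_pos_left _ (by omega)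
  have b6 := hb.pos
  have b7 := hb.size
  have b8 := hb.slots
  refine Runs.cons (by simp only [length]; omega) ?_
  simp only [wp, length]
  refine Runs.cons (by simp only [length]; omega) ?_
  simp only [wp, length]
  refine Runs.cons (by simp only [length]; omega) ?_
  simp only [wp, length]
  set σ' := ((σ.setFld 5 1).setFld 6 0).setFld 7 0 with hσ'
  have r' : Ready A C ρ σ' := h.stable ⟨fun _ _ => rfl, fun _ _ => rfl, fun _ _ => rfl⟩
  refine (runs_fill (B := B) hb (by omega) (arr := 64) (by omega) (γ := 1) (α := 0) (β := 0)
    r'.nat1 r'.nat5 r'.pow (by simp [hσ']) (by simp [hσ']) (by simp [hσ'])).andThen (by omega)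
    fun τ1 ag1 e1 => ?_
  have r1 := r'.stable ((isLocal_fill (by omega)).stable ag1)
  have hg : slot t (τ1.fldArr 64) 0 = parity t := by
    rw [e1]
    simp only [mul_zero]
    rfl
  have k3 : τ1.fldArr 3 = σ.fldArr 3 := ag1.fldArr 3 (not_writesFldArr_fill (by omega))
  have k36 : τ1.nat 36 = b := by
    rw [ag1.nat 36 (not_writesNat_fill (by omega))]
    exact h36
  refine Runs.cons (by simp only [length]; omega) ?_
  simp only [wp, length, k36, r1.nat1]
  refine ⟨by omega, by omega, ?_⟩
  refine (runs_mulReg (B := B) (a := b + t) (b := 2 ^ t * 2 ^ t) (by simp) (by simp [r1.nat6])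
    (by omega) (by omega) (by omega) (by omega) (by omega)
    (by omega) (by omega) (by omega)).andThen (by omega) fun τ2 ag2 e2 => ?_
  have k6 : τ2.nat 6 = 2 ^ t * 2 ^ t := by
    rw [ag2.nat 6 (by simp [mulReg, forLoop, WritesNat])]
    simp [r1.nat6]
  have kf : τ2.fldArr = τ1.fldArr := by
    ext1 r
    rw [ag2.fldArr r (by simp [mulReg, forLoop, WritesFldArr])]
    rfl
  refine Runs.cons (by simp only [length]; omega) ?_
  simp only [wp, length]
  refine (Runs.forLoop (B := B) (σ := τ2.setFld 0 0) (k := 5) (len := 2 ^ t * 2 ^ t) (fun j τ =>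
      τ.fld 0 = ∑ c ∈ range j, τ1.fldArr 64 c * σ.fldArr 3 ((b + t) * (2 ^ t * 2 ^ t) + c))
      (by simp [k6]) (by omega) (by omega)
      (by omega) (by omega) (by simp [WritesNat]) (by simp [WritesNat]) (fun _ _ _ _ _ h => h)
      (by simp) ?_).andThen (by omega) fun τ3 _ e3 => ?_
  · intro j hj τ hτ ag hI
    have e14 : τ.nat 14 = (b + t) * (2 ^ t * 2 ^ t) := by
      rw [ag.nat 14 (by simp [forLoop, WritesNat])]
      simpa using e2
    have ef : τ.fldArr = τ1.fldArr := by
      ext1 r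
      rw [ag.fldArr r (by simp [forLoop, WritesFldArr]), ← kf]
      rfl
    refine runs_of_wp ?_
    simp only [wp, Memory.nat_setNat, Memory.nat_setFld, Memory.fld_setFld, Memory.fld_setNat,
      if_true, e14, ef, hτ, Memory.fldArr_setFld, Memory.fldArr_setNat, Nat.reduceEqDiff, if_false,
      OfNat.zero_ne_ofNat, hI, k3]
    refine ⟨by omega, by omega, by omega, by omega, ?_⟩
    rw [sum_range_succ]
  · rw [str_slot _ _ _ hg, hs] at e3
    refine (runs_of_wp ?_).mono (by simp only [length]; omega) fun _ _ h => h
    simp only [wp, e3, Memory.fld_setNat, Memory.nat_setNat, if_true]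
    exact ⟨fun hne => ⟨by omega, trivial, fun _ => trivial, fun h0 => absurd h0 hne⟩,
      fun h0 => ⟨by omega, trivial, fun hne => absurd h0 hne, fun _ => trivial⟩⟩

/-- The sieve, for a program `p` that multiplies matrices. -/
def sieve (p : Prog) : Prog :=
  setup ⨾ buildPairs p ⨾ evalGates p ⨾ mulFactors p ⨾ finish

/-- The sieve computes the sieved value, in a number of operations that is polynomial in the size of
the input and linear in the time `W` for an operation on slots. -/
theorem runs_sieve {L W M : ℕ} (hb : Bounds t L B W) {p : Prog} (hp : Multiplies F p (2 ^ t) M)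
    (hM : M ≤ W) (hA : DeltaMatroid.IsSparse A) {σ : Memory F} (h : HoldsInput A C ρ σ)
    (hL : t + n + z + 1 + (C.last + 1) * (t + 2) ≤ L) :
    Runs B (sieve p) σ (1000 * ((t + n + z + C.last + 2) ^ 3 * W)) (fun τ =>
      τ.fld 0 = sieved A C.poly ρ ∧
      (sieved A C.poly ρ ≠ 0 → τ.nat 0 = 1) ∧ (sieved A C.poly ρ = 0 → τ.nat 0 = 0)) := by
  have b5 := hb.pos
  have hL' : t + n + z + 1 + C.last * (t + 2) + (t + 2) ≤ L := by
    rw [add_mul, one_mul] at hL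
    omega
  have cost : 40 * ((t + 1) * W) + ((t + n + z + 1) * (300 * ((t + 1) * W)) + 3) +
      ((C.last + 1) * (310 * ((t + 2) ^ 2 * W)) + 5) +
      (t + n + z + 1) * (160 * ((t + 2) * W)) + 120 * ((t + 1) * W) ≤
      1000 * ((t + n + z + C.last + 2) ^ 3 * W) := by
    set m := t + n + z + C.last + 2 with hm
    have c1 : (t + 1) * W ≤ m ^ 3 * W := Nat.mul_le_mul_right _
      ((show t + 1 ≤ m by omega).trans (Nat.le_self_pow (by omega) m))
    have c2 : (t + n + z + 1) * ((t + 1) * W) ≤ m ^ 3 * W := by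
      rw [← mul_assoc]
      refine Nat.mul_le_mul_right _ ?_
      calc (t + n + z + 1) * (t + 1) ≤ m * m := Nat.mul_le_mul (by omega) (by omega)
        _ ≤ m ^ 3 := by nlinarith
    have c3 : (C.last + 1) * ((t + 2) ^ 2 * W) ≤ m ^ 3 * W := by
      rw [← mul_assoc]
      refine Nat.mul_le_mul_right _ ?_
      calc (C.last + 1) * (t + 2) ^ 2 ≤ m * m ^ 2 :=
          Nat.mul_le_mul (by omega) (Nat.pow_le_pow_left (by omega) 2)
        _ = m ^ 3 := by ring
    have c4 : (t + n + z + 1) * ((t + 2) * W) ≤ m ^ 3 * W := by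
      rw [← mul_assoc]
      refine Nat.mul_le_mul_right _ ?_
      calc (t + n + z + 1) * (t + 2) ≤ m * m := Nat.mul_le_mul (by omega) (by omega)
        _ ≤ m ^ 3 := by nlinarith
    have c5 : 8 * W ≤ m ^ 3 * W := Nat.mul_le_mul_right _
      (le_trans (by norm_num) (Nat.pow_le_pow_left (show 2 ≤ m by omega) 3))
    have d1 : (t + n + z + 1) * (300 * ((t + 1) * W)) =
        300 * ((t + n + z + 1) * ((t + 1) * W)) := by
      ring
    have d2 : (C.last + 1) * (310 * ((t + 2) ^ 2 * W)) =
      310 * ((C.last + 1) * ((t + 2) ^ 2 * W)) := by ring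
    have d3 : (t + n + z + 1) * (160 * ((t + 2) * W)) =
        160 * ((t + n + z + 1) * ((t + 2) * W)) := by
      ring
    omega
  refine (runs_setup hb (by omega) h).andThen (by omega) fun τ1 _ r1 => ?_
  refine (runs_buildPairs hb (by omega) hp hM r1).andThen (by omega) fun τ2 ag2 e2 => ?_
  have r2 := r1.stable ((isLocal_buildPairs p).stable ag2)
  refine (runs_evalGates hb hp hM r2 hL e2).andThen (by omega) fun τ3 ag3 ⟨e3, e4, e5⟩ => ?_
  have r3 := r2.stable ((isLocal_evalGates p).stable ag3)
  obtain ⟨N, hN, hc⟩ := e5 (Fin.last C.last) (by simp)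
  refine (runs_mulFactors hb hp hM r3 (b := t + n + z + 1 + C.last * (t + 2))
    (by rw [e3]; ring) (by omega) hL' e4 hc).andThen (by omega) fun τ4 ag4 ⟨e6, e7⟩ => ?_
  have r4 := r3.stable ((isLocal_mulFactors p).stable ag4)
  refine (runs_finish hb r4 e6 hL' (s := sieved A C.poly ρ) ?_).mono (by omega) fun _ _ h => h
  rw [e7 t (by omega)]
  exact str_coeff_lifting ρ hA _ (sum_factorList A ρ) hN

end Prog

namespace Fock

variable {F : Type*} [Field F] {t n z : ℕ}
  (A : Matrix (Fin t ⊕ (Fin n ⊕ Fin z)) (Fin t ⊕ (Fin n ⊕ Fin z)) F)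

/-! ### The sieved polynomial -/

/-- The exponent of the squarefree monomial with the given set of variables. -/
noncomputable def squarefree {V : Type*} (X : Finset V) : V →₀ ℕ :=
  Finsupp.indicator X fun _ _ => 1

lemma support_squarefree {V : Type*} (X : Finset V) : (squarefree X).support = X := by
  classical
  ext v
  simp [squarefree, Finsupp.indicator_apply]

lemma squarefree_injective {V : Type*} : Function.Injective (squarefree (V := V)) :=
  fun X Y h => by rw [← support_squarefree X, h, support_squarefree]

lemma squarefree_apply {V : Type*} {X : Finset V} {v : V} (h : v ∈ X) : squarefree X v = 1 := by
  classical
  simp [squarefree, h]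

lemma eq_of_support_eq {V : Type*} {m m' : V →₀ ℕ} (h : ∀ i, m i ≤ 1) (h' : ∀ i, m' i ≤ 1)
    (hs : m.support = m'.support) : m = m' := by
  ext i
  have := Finset.ext_iff.mp hs i
  simp only [Finsupp.mem_support_iff] at this
  have := h i
  have := h' i
  omega

/-- The sieved polynomial: the sieved value as a polynomial in the random elements. -/
noncomputable def sievedPoly (P : MvPolynomial (Fin n) F) : MvPolynomial (Fin n ⊕ Fin z) F :=
  ∑ m ∈ P.support with ∀ i, m i ≤ 1, ∑ Y : Finset (Fin z),
    MvPolynomial.monomial (squarefree (m.support.disjSum Y)) (P.coeff m *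
      (DeltaMatroid.principal A
        ((Finset.univ : Finset (Fin t)).disjSum (m.support.disjSum Y))).det)

lemma eval_sievedPoly (P : MvPolynomial (Fin n) F) (ρ : Fin n ⊕ Fin z → F) :
    MvPolynomial.eval ρ (sievedPoly A P) = sieved A P ρ := by
  simp only [sievedPoly, sieved, map_sum]
  refine sum_congr rfl fun m _ => sum_congr rfl fun Y _ => ?_
  rw [MvPolynomial.eval_monomial, Finsupp.prod, support_squarefree]
  congr 1
  rw [← prod_disjSum]
  exact prod_congr rfl fun v hv => by rw [squarefree_apply hv, pow_one]

variable {A}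

lemma totalDegree_sievedPoly_le {P : MvPolynomial (Fin n) F} {k : ℕ} (hP : P.IsHomogeneous k) :
    (sievedPoly A P).totalDegree ≤ k + z := by
  refine MvPolynomial.totalDegree_finsetSum_le fun m hm => MvPolynomial.totalDegree_finsetSum_le
    fun Y _ => (MvPolynomial.totalDegree_monomial_le _ _).trans ?_
  obtain ⟨hm1, hm2⟩ := mem_filter.mp hm
  have hdeg : m.degree = k := by
    rw [← hP (MvPolynomial.mem_support_iff.mp hm1), Finsupp.degree_eq_weight_one]
    rfl
  rw [Finsupp.sum, support_squarefree]
  calc ∑ v ∈ m.support.disjSum Y, squarefree (m.support.disjSum Y) v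
      = #(m.support.disjSum Y) := by
        rw [card_eq_sum_ones]
        exact sum_congr rfl fun v hv => squarefree_apply hv
    _ = #m.support + #Y := card_disjSum _ _
    _ ≤ k + z := by
        refine add_le_add ?_ ((card_le_univ Y).trans_eq (Fintype.card_fin z))
        rw [← hdeg, Finsupp.degree, card_eq_sum_ones]
        refine sum_le_sum fun i hi => ?_
        exact Nat.one_le_iff_ne_zero.mpr (Finsupp.mem_support_iff.mp hi)

/-- Distinct terms of the sieved polynomial have distinct monomials. -/
lemma sievedPoly_ne_zero {P : MvPolynomial (Fin n) F} (h : HasTerm P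
    (DeltaMatroid.project (DeltaMatroid.contract (DeltaMatroid.ofMatrix A)))) :
    sievedPoly A P ≠ 0 := by
  obtain ⟨m, hm, hm1, Y, hY⟩ := h
  have hc : (sievedPoly A P).coeff (squarefree (m.support.disjSum Y)) = P.coeff m *
      (DeltaMatroid.principal A
        ((Finset.univ : Finset (Fin t)).disjSum (m.support.disjSum Y))).det := by
    simp only [sievedPoly, MvPolynomial.coeff_sum, MvPolynomial.coeff_monomial]
    rw [sum_eq_single_of_mem m (mem_filter.mpr ⟨hm, hm1⟩) fun m' hm' hne => ?_,
      sum_eq_single_of_mem Y (mem_univ _) fun Y' _ hne => ?_]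
    · rw [if_pos rfl]
    · rw [if_neg fun he => hne ?_]
      have := congrArg toRight (squarefree_injective he)
      simpa using this
    · refine sum_eq_zero fun Y' _ => if_neg fun he => hne ?_
      have := congrArg toLeft (squarefree_injective he)
      exact eq_of_support_eq (mem_filter.mp hm').2 hm1 (by simpa using this)
  intro h0
  rw [h0, MvPolynomial.coeff_zero] at hc
  exact mul_ne_zero (MvPolynomial.mem_support_iff.mp hm) hY hc.symm

lemma sieved_eq_zero {P : MvPolynomial (Fin n) F} (h : ¬HasTerm P
    (DeltaMatroid.project (DeltaMatroid.contract (DeltaMatroid.ofMatrix A))))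
    (ρ : Fin n ⊕ Fin z → F) : sieved A P ρ = 0 := by
  refine sum_eq_zero fun m hm => sum_eq_zero fun Y _ => ?_
  obtain ⟨hm1, hm2⟩ := mem_filter.mp hm
  have : (DeltaMatroid.principal A
      ((Finset.univ : Finset (Fin t)).disjSum (m.support.disjSum Y))).det = 0 := by
    by_contra hne
    exact h ⟨m, hm1, hm2, Y, hne⟩
  rw [this, mul_zero, zero_mul]

/-- The Schwartz-Zippel lemma, for the number of points that are not zeros. -/
lemma one_sub_div_le_card_ne_zero {V : Type*} [Fintype V] [DecidableEq V] [DecidableEq F]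
    {Q : MvPolynomial V F} (hQ : Q ≠ 0) {d : ℕ} (hd : Q.totalDegree ≤ d) {S : Finset F}
    (hS : S.Nonempty) :
    1 - (d : ℝ) / #S ≤ (#{ρ ∈ Fintype.piFinset fun _ : V => S | MvPolynomial.eval ρ Q ≠ 0} : ℝ) /
      (#S : ℝ) ^ Fintype.card V := by
  let e := Fintype.equivFin V
  have hS0 : (0 : ℝ) < #S := by exact_mod_cast hS.card_pos
  have h1 := MvPolynomial.schwartz_zippel_totalDegree
    (p := MvPolynomial.rename e Q) (by
      rwa [Ne, ← map_zero (MvPolynomial.rename e), (MvPolynomial.rename_injective e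
        e.injective).eq_iff]) S
  have h2 : #{f ∈ Fintype.piFinset fun _ : Fin (Fintype.card V) => S |
      MvPolynomial.eval f (MvPolynomial.rename e Q) = 0} =
      #{ρ ∈ Fintype.piFinset fun _ : V => S | MvPolynomial.eval ρ Q = 0} := by
    refine card_bij (fun f _ => f ∘ e) (fun f hf => ?_) (fun f _ g _ h => ?_) fun ρ hρ =>
      ⟨ρ ∘ e.symm, ?_, ?_⟩
    · simp only [mem_filter, Fintype.mem_piFinset, MvPolynomial.eval_rename] at hf ⊢
      exact ⟨fun v => hf.1 _, hf.2⟩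
    · exact e.surjective.injective_comp_right h
    · simp only [mem_filter, Fintype.mem_piFinset, MvPolynomial.eval_rename] at hρ ⊢
      refine ⟨fun v => hρ.1 _, ?_⟩
      rw [Function.comp_assoc, Equiv.symm_comp_self, Function.comp_id]
      exact hρ.2
    · rw [Function.comp_assoc, Equiv.symm_comp_self, Function.comp_id]
  rw [h2] at h1
  have h3 : (#{ρ ∈ Fintype.piFinset fun _ : V => S | MvPolynomial.eval ρ Q = 0} : ℝ) /
      (#S : ℝ) ^ Fintype.card V ≤ (d : ℝ) / #S := by
    have : (#{ρ ∈ Fintype.piFinset fun _ : V => S | MvPolynomial.eval ρ Q = 0} : ℝ) /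
        (#S : ℝ) ^ Fintype.card V ≤ ((MvPolynomial.rename e Q).totalDegree : ℝ) / #S := by
      have h6 : (((#{ρ ∈ Fintype.piFinset fun _ : V => S | MvPolynomial.eval ρ Q = 0} /
          (#S : ℚ≥0) ^ Fintype.card V : ℚ≥0)) : ℝ) ≤
          (((MvPolynomial.rename e Q).totalDegree / #S : ℚ≥0) : ℝ) := NNRat.cast_le.mpr h1
      simpa using h6
    refine this.trans ?_
    have h4 : (MvPolynomial.rename e Q).totalDegree ≤ d :=
      (MvPolynomial.totalDegree_rename_le _ _).trans hd
    gcongr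
  have h5 : (#{ρ ∈ Fintype.piFinset fun _ : V => S | MvPolynomial.eval ρ Q = 0} : ℝ) +
      #{ρ ∈ Fintype.piFinset fun _ : V => S | MvPolynomial.eval ρ Q ≠ 0} =
      (#S : ℝ) ^ Fintype.card V := by
    rw [← Nat.cast_add, card_filter_add_card_filter_not, Fintype.card_piFinset]
    simp
  rw [← h5] at h3 ⊢
  have hpos : (0 : ℝ) < #{ρ ∈ Fintype.piFinset fun _ : V => S | MvPolynomial.eval ρ Q = 0} +
      #{ρ ∈ Fintype.piFinset fun _ : V => S | MvPolynomial.eval ρ Q ≠ 0} := by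
    rw [h5]
    positivity
  rw [sub_le_iff_le_add]
  refine le_trans (le_of_eq ?_) (add_le_add_right h3 _)
  rw [← add_div, add_comm, div_self hpos.ne']

end Fock

namespace Prog

open Fock

variable {F : Type*} [Field F]

/-! ### Resources -/

/-- A program changes at most as many entries of an array as it has time for. -/
theorem exists_changed {p : Prog} {σ τ : Memory F} {c : ℕ} (h : Exec p σ τ c) (a : ℕ) :
    ∃ S : Finset ℕ, #S ≤ c ∧ ∀ x ∉ S, τ.fldArr a x = σ.fldArr a x := by
  induction h with
  | fldStore σ b y x =>
    refine ⟨{σ.nat y}, by rw [card_singleton]; omega, fun j hj => ?_⟩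
    rw [mem_singleton] at hj
    rw [Memory.fldArr_setFldArr]
    split_ifs with h
    · rw [Function.update_of_ne hj, h]
    · rfl
  | seq _ _ ih1 ih2 =>
    obtain ⟨S1, c1, h1⟩ := ih1
    obtain ⟨S2, c2, h2⟩ := ih2
    refine ⟨S1 ∪ S2, (card_union_le _ _).trans (by omega), fun x hx => ?_⟩
    rw [mem_union, not_or] at hx
    rw [h2 x hx.2, h1 x hx.1]
  | while_true _ _ _ ih1 ih2 =>
    obtain ⟨S1, c1, h1⟩ := ih1
    obtain ⟨S2, c2, h2⟩ := ih2
    refine ⟨S1 ∪ S2, (card_union_le _ _).trans (by omega), fun x hx => ?_⟩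
    rw [mem_union, not_or] at hx
    rw [h2 x hx.2, h1 x hx.1]
  | natIf_true _ _ ih | natIf_false _ _ ih | fldIf_true _ _ ih | fldIf_false _ _ ih =>
    obtain ⟨S, c, h⟩ := ih
    exact ⟨S, by omega, h⟩
  | _ => exact ⟨∅, by simp, fun _ _ => rfl⟩

/-- Multiplication of matrices takes at least as long as writing the result. -/
theorem Multiplies.sq_le {p : Prog} {N M : ℕ} (h : Multiplies F p N M) : N * N ≤ M := by
  let σ : Memory F := ⟨fun _ => N, fun _ _ => 0, fun _ => 0, fun a _ => if a = 2 then 1 else 0⟩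
  obtain ⟨τ, c, e, hτ, hc⟩ := h 0 0 σ rfl (fun _ _ => by simp [σ]) (fun _ _ => by simp [σ])
  obtain ⟨S, hS, hch⟩ := exists_changed e 2
  have hsub : range (N * N) ⊆ S := by
    intro x hx
    rw [mem_range] at hx
    by_contra hxS
    have hN : 0 < N := Nat.pos_of_ne_zero fun h0 => by simp [h0] at hx
    have h1 := hτ ⟨x / N, Nat.div_lt_of_lt_mul hx⟩ ⟨x % N, Nat.mod_lt _ hN⟩
    simp only [mul_comm (x / N) N, Nat.div_add_mod] at h1
    rw [hch x hxS] at h1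
    simp [σ] at h1
  have := card_le_card hsub
  rw [card_range] at this
  omega

end Prog

section Rank

open DeltaMatroid

lemma rank_bddAbove {V : Type*} [Fintype V] (𝓕 : Set (Finset V)) :
    BddAbove {c | ∃ X ∈ 𝓕, #X = c} :=
  ⟨Fintype.card V, by rintro _ ⟨X, _, rfl⟩; exact card_le_univ X⟩

lemma rank_project_le {V Z : Type*} [Fintype V] [Fintype Z] (𝓕 : Set (Finset (V ⊕ Z))) :
    rank (project 𝓕) ≤ rank 𝓕 := by
  refine csSup_le' ?_
  rintro _ ⟨X, ⟨Y, hY⟩, rfl⟩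
  exact le_trans (by rw [card_disjSum]; omega) (le_csSup (rank_bddAbove 𝓕) ⟨_, hY, rfl⟩)

lemma rank_le_rank_project {V Z : Type*} [Fintype V] [Fintype Z] (𝓕 : Set (Finset (V ⊕ Z))) :
    rank 𝓕 ≤ rank (project 𝓕) + Fintype.card Z := by
  refine csSup_le' ?_
  rintro _ ⟨X, hX, rfl⟩
  have h1 : X.toLeft ∈ project 𝓕 := ⟨X.toRight, by rwa [toLeft_disjSum_toRight]⟩
  have h2 := le_csSup (rank_bddAbove (project 𝓕)) ⟨_, h1, rfl⟩
  rw [← toLeft_disjSum_toRight (u := X), card_disjSum]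
  exact add_le_add h2 (card_le_univ _)

end Rank

/-- The time of the sieve (the steps of `Prog.runs_sieve`, times the unit of time), in terms of a
bound `q` on the size of the input. -/
lemma sieve_cost_le {t s m q M W L B : ℕ} (hm : m + s + 1 ≤ q) (hM : 1 ≤ M)
    (hL : L = m + 1 + (s + 1) * (t + 2)) (hW : W = M + L) (hB : B = L * (2 ^ t * 2 ^ t) + 5)
    (hq : 2 ≤ q) (htq : t + 2 ≤ q) :
    1000 * (q ^ 3 * W) * (1 + 2 * B.size) ≤ 100000 * q ^ 7 * M := by
  have hLq : L ≤ 2 * q ^ 2 := by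
    have h1 : (s + 1) * (t + 2) ≤ q * q := Nat.mul_le_mul (by omega) htq
    nlinarith
  have hsize : B.size ≤ L + 3 + (t + t) := by
    rw [Nat.size_le, hB, pow_add, pow_add, pow_add]
    have h1 : L < 2 ^ L := Nat.lt_two_pow_self
    have h2 : 1 ≤ 2 ^ t * 2 ^ t := Nat.mul_pos (by positivity) (by positivity)
    nlinarith
  have hu : 1 + 2 * B.size ≤ 30 * q ^ 2 := by nlinarith
  have hW' : W ≤ 3 * q ^ 2 * M := by
    have : 1 ≤ q ^ 2 := Nat.one_le_pow _ _ (by omega)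
    rw [hW]
    nlinarith [Nat.mul_le_mul_right (q ^ 2) hM, Nat.mul_le_mul_right M this]
  calc 1000 * (q ^ 3 * W) * (1 + 2 * B.size)
      ≤ 1000 * (q ^ 3 * (3 * q ^ 2 * M)) * (30 * q ^ 2) := by gcongr
    _ = 90000 * (q ^ 7 * M) := by ring
    _ ≤ 100000 * q ^ 7 * M := by nlinarith [Nat.zero_le (q ^ 7 * M)]

theorem mainTheorem3 {ι : Type*} (F : ι → Type*) [∀ i, Field (F i)]
    (w : ℝ) (hw : IsMatMulExponent F w) :
    ∃ (p : Prog) (K : ℕ), ∀ (i : ι) (t n z k : ℕ)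
      (A : Matrix (Fin t ⊕ (Fin n ⊕ Fin z)) (Fin t ⊕ (Fin n ⊕ Fin z)) (F i))
      (C : Circuit (F i) n) (D : DeltaMatroid (Fin n)),
      DeltaMatroid.IsSparse A →
      D.feasible = DeltaMatroid.project (DeltaMatroid.contract (DeltaMatroid.ofMatrix A)) →
      C.poly.IsHomogeneous k →
      (∀ (ρ : Fin n ⊕ Fin z → F i) (σ : Memory (F i)), HoldsInput A C ρ σ →
        ∃ (σ' : Memory (F i)) (c : ℕ), Exec p σ σ' c ∧
          (c : ℝ) ≤ K * ((t + n + z + C.last + 1 : ℕ) : ℝ) ^ K * 2 ^ (w * t) ∧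
          (DeltaMatroid.rank (DeltaMatroid.contract (DeltaMatroid.ofMatrix A)) = t → z ≤ 1 →
            (c : ℝ) ≤ K * ((t + n + z + C.last + 1 : ℕ) : ℝ) ^ K *
              2 ^ (w * DeltaMatroid.rank D.feasible)) ∧
          σ'.fld 0 = sieved A C.poly ρ ∧
          (σ'.nat 0 = 0 ∨ σ'.nat 0 = 1) ∧
          (¬ HasTerm C.poly D.feasible → σ'.nat 0 = 0)) ∧
      (HasTerm C.poly D.feasible →
        ∀ (S : Finset (F i)), S.Nonempty →
        ∀ (mem : (Fin n ⊕ Fin z → F i) → Memory (F i)), (∀ ρ, HoldsInput A C ρ (mem ρ)) →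
          1 - ((k + z : ℕ) : ℝ) / S.card ≤
            ({ρ : Fin n ⊕ Fin z → F i | (∀ j, ρ j ∈ S) ∧ Accepts p (mem ρ)}.ncard : ℝ) /
              (S.card : ℝ) ^ (n + z)) := by
  obtain ⟨p, K, hp⟩ := hw
  -- The constant: `100000 * K` times the polynomial factors `q ^ 7 * (t + 1) ^ K`, where
  -- `q = m + 1 ≤ 2 * m`, and a factor for the difference of `t` and the rank.
  set K₀ : ℕ := 100000 * K * 2 ^ (7 + K) with hK₀
  refine ⟨Prog.sieve p, K₀ * 2 ^ ⌈|w|⌉₊ + 7 + K, ?_⟩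
  intro i t n z k A C D hA hD hP
  set m := t + n + z + C.last + 1 with hm
  have hm1 : (1 : ℝ) ≤ (m : ℝ) := by exact_mod_cast (show 1 ≤ m by omega)
  -- The time for the multiplication of matrices of size `2 ^ t`; this number has `t + 1` bits.
  set M : ℕ := ⌊(K : ℝ) * 2 ^ (w * t) * ((t + 1 : ℕ) : ℝ) ^ K⌋₊ with hM
  have hM0 : (0 : ℝ) ≤ (K : ℝ) * 2 ^ (w * t) * ((t + 1 : ℕ) : ℝ) ^ K := by positivity
  have hmul : Prog.Multiplies (F i) p (2 ^ t) M := by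
    intro X Y σ h0 h1 h2
    obtain ⟨σ', c, e, hσ', hc⟩ := hp i (2 ^ t) Nat.one_le_two_pow X Y σ h0 h1 h2
    refine ⟨σ', c, e, hσ', Nat.le_floor (hc.trans_eq ?_)⟩
    rw [Nat.size_pow, Nat.cast_pow, Nat.cast_ofNat, ← Real.rpow_natCast 2 t,
      ← Real.rpow_mul (by norm_num), mul_comm w]
  have hNM := hmul.sq_le
  set L := t + n + z + 1 + (C.last + 1) * (t + 2) with hL
  set B := L * (2 ^ t * 2 ^ t) + 5 with hB
  have hbounds : Prog.Bounds t L B (M + L) := ⟨by omega, by omega, by omega⟩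
  have hrun : ∀ (ρ : Fin n ⊕ Fin z → F i) (σ : Memory (F i)), HoldsInput A C ρ σ →
      ∃ (σ' : Memory (F i)) (c : ℕ), Exec (Prog.sieve p) σ σ' c ∧
        (c : ℝ) ≤ K₀ * (m : ℝ) ^ (7 + K) * 2 ^ (w * t) ∧
        σ'.fld 0 = sieved A C.poly ρ ∧ (sieved A C.poly ρ ≠ 0 → σ'.nat 0 = 1) ∧
        (sieved A C.poly ρ = 0 → σ'.nat 0 = 0) := by
    intro ρ σ hσ
    obtain ⟨σ', c, e, hc, hQ⟩ := Prog.runs_sieve hbounds hmul (by omega) hA hσ le_rfl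
    refine ⟨σ', c, e, ?_, hQ⟩
    have h1 : 1 ≤ M := le_trans (Nat.mul_pos (by positivity) (by positivity)) hNM
    have h2 := hc.trans (sieve_cost_le (m := t + n + z) (s := C.last) (q := m + 1) (by omega)
      h1 hL rfl hB (by omega) (by omega))
    have h3 : (c : ℝ) ≤ 100000 * ((m : ℝ) + 1) ^ 7 * M := by exact_mod_cast h2
    have h4 : (M : ℝ) ≤ (K : ℝ) * 2 ^ (w * t) * ((t + 1 : ℕ) : ℝ) ^ K := Nat.floor_le hM0
    have h5 : ((t + 1 : ℕ) : ℝ) ≤ 2 * m := by exact_mod_cast (show t + 1 ≤ 2 * m by omega)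
    calc (c : ℝ) ≤ 100000 * ((m : ℝ) + 1) ^ 7 * M := h3
      _ ≤ 100000 * (2 * (m : ℝ)) ^ 7 * (K * 2 ^ (w * t) * (2 * m) ^ K) := by
        gcongr
        · linarith
        · exact h4.trans (by gcongr)
      _ = K₀ * (m : ℝ) ^ (7 + K) * 2 ^ (w * t) := by
        rw [hK₀]
        push_cast
        ring
  have hpow : (K₀ : ℝ) * 2 ^ ⌈|w|⌉₊ * (m : ℝ) ^ (7 + K) ≤
      ((K₀ * 2 ^ ⌈|w|⌉₊ + 7 + K : ℕ) : ℝ) * (m : ℝ) ^ (K₀ * 2 ^ ⌈|w|⌉₊ + 7 + K) := by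
    have : ((K₀ * 2 ^ ⌈|w|⌉₊ : ℕ) : ℝ) ≤ ((K₀ * 2 ^ ⌈|w|⌉₊ + 7 + K : ℕ) : ℝ) := by
      exact_mod_cast (by omega)
    refine le_trans (le_of_eq (by push_cast; ring)) (mul_le_mul this
      (pow_le_pow_right₀ hm1 (show 7 + K ≤ K₀ * 2 ^ ⌈|w|⌉₊ + 7 + K by omega)) (by positivity)
      (by positivity))
  refine ⟨fun ρ σ hσ => ?_, fun hT S hS mem hmem => ?_⟩
  · obtain ⟨σ', c, e, hc, h1, h2, h3⟩ := hrun ρ σ hσ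
    refine ⟨σ', c, e, ?_, fun hr hz => ?_, h1, ?_, fun hno => h3 ?_⟩
    · refine hc.trans (mul_le_mul_of_nonneg_right (le_trans ?_ hpow) (by positivity))
      have : (1 : ℝ) ≤ 2 ^ ⌈|w|⌉₊ := one_le_pow₀ (by norm_num)
      have h0 : (0 : ℝ) ≤ K₀ * (m : ℝ) ^ (7 + K) := by positivity
      nlinarith
    · -- The rank of `D` is `t` or `t - 1`.
      have r1 := rank_project_le (DeltaMatroid.contract (DeltaMatroid.ofMatrix A))
      have r2 := rank_le_rank_project (DeltaMatroid.contract (DeltaMatroid.ofMatrix A))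
      rw [← hD, hr] at r1 r2
      rw [Fintype.card_fin] at r2
      set r := DeltaMatroid.rank D.feasible
      have h4 : w * t ≤ |w| + w * r := by
        have a1 : (r : ℝ) ≤ t := by exact_mod_cast r1
        have a2 : (t : ℝ) ≤ r + 1 := by exact_mod_cast (show t ≤ r + 1 by omega)
        have a3 : w * (t - r) ≤ |w| * (t - r) :=
          mul_le_mul_of_nonneg_right (le_abs_self w) (by linarith)
        nlinarith [abs_nonneg w]
      have h5 : (2 : ℝ) ^ (w * t) ≤ 2 ^ ⌈|w|⌉₊ * 2 ^ (w * r) := by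
        rw [← Real.rpow_natCast, ← Real.rpow_add (by norm_num)]
        refine Real.rpow_le_rpow_of_exponent_le (by norm_num) ?_
        linarith [Nat.le_ceil |w|]
      calc (c : ℝ) ≤ K₀ * (m : ℝ) ^ (7 + K) * (2 ^ ⌈|w|⌉₊ * 2 ^ (w * r)) :=
            hc.trans (mul_le_mul_of_nonneg_left h5 (by positivity))
        _ = K₀ * 2 ^ ⌈|w|⌉₊ * (m : ℝ) ^ (7 + K) * 2 ^ (w * r) := by ring
        _ ≤ _ := mul_le_mul_of_nonneg_right hpow (by positivity)
    · by_cases h0 : sieved A C.poly ρ = 0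
      · exact .inl (h3 h0)
      · exact .inr (h2 h0)
    · rw [hD] at hno
      exact Fock.sieved_eq_zero hno ρ
  · classical
    rw [hD] at hT
    have h1 := Fock.one_sub_div_le_card_ne_zero (Fock.sievedPoly_ne_zero hT)
      (Fock.totalDegree_sievedPoly_le (A := A) hP) hS
    have hcard : Fintype.card (Fin n ⊕ Fin z) = n + z := by simp
    rw [hcard] at h1
    refine h1.trans (div_le_div_of_nonneg_right ?_ (by positivity))
    rw [← Set.ncard_coe_finset]
    refine Nat.cast_le.mpr (Set.ncard_le_ncard (fun ρ hρ => ?_) ?_)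
    · rw [mem_coe, mem_filter, Fintype.mem_piFinset, Fock.eval_sievedPoly] at hρ
      obtain ⟨σ', c, e, -, -, h2, -⟩ := hrun ρ (mem ρ) (hmem ρ)
      exact ⟨hρ.1, σ', c, e, h2 hρ.2⟩
    · refine Set.Finite.subset (Fintype.piFinset fun _ => S).finite_toSet fun ρ hρ => ?_
      rw [mem_coe, Fintype.mem_piFinset]
      exact hρ.1
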